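/- Let $K$ be a field. \textbf{Conventions.} A (decreasing) $\mathbb R$-filtration of a $K$-vector space $V$ is a family $(\mathcal F_rV)_{r\in\mathbb R}$ of subspaces with $\mathcal F_rV\supset\mathcal F_{r'}V$ for $r\le r'$. It is separated if $\bigcap_r\mathcal F_rV=\{0\}$, exhaustive if $\bigcup_r\mathcal F_rV=V$, left continuous if $\mathcal F_rV=\bigcap_{s<r}\mathcal F_sV$ for all $r$. The index of $x\in V$ is $\lambda(x)=\sup\{r\in\mathbb R: x\in\mathcal F_rV\}\in[-\infty,+\infty]$. If $V$ has finite dimension $n>0$ and the filtration is separated and exhaustive, a basis $e=(e_i)$ of $V$ defines the probability measure $\nu_e=\frac1n\sum_{i=1}^n\delta_{\lambda(e_i)}$; the basis is maximal if $\int g\,d\nu_e\ge\int g\,d\nu_{e'}$ for every basis $e'$ and every bounded increasing $g:\mathbb R\to\mathbb R$, and $\nu_V$ is $\nu_e$ for any maximal basis $e$ (it does not depend on the choice); $\nu_V=0$ if $V=0$. For $\varepsilon>0$, $T_\varepsilon\nu$ is the direct image of $\nu$ by $x\mapsto\varepsilon x$. The polygon of a probability measure $\nu$ on $\mathbb R$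 with bounded support is $P(\nu)(t)=\int_0^t h^*(s)\,ds$, $t\in[0,1]$, where $h(x)=\nu(]x,+\infty[)$ and $h^*(s)=\sup\{x: h(x)>s\}$; write $P_V=P(\nu_V)$. For $f:\mathbb Z_{\ge0}\to\mathbb R_{\ge0}$, a (commutative, $\mathbb Z_{\ge 0}$-)graded $K$-algebra $B=\bigoplus_{n\ge0}B_n$ with an $\mathbb R$-filtration $(B_{n,s})_{s\in\mathbb R}$ of each $B_n$ is $f$-quasi-filtered if there is $n_0\ge0$ such that for all $r\ge1$, all integers $n_1,\dots,n_r\ge n_0$ and all real $s_1,\dots,s_r$ one has $\prod_iB_{n_i,s_i}\subset B_{N,S}$ with $N=\sum_in_i$, $S=\sum_i(s_i-f(n_i))$. \textbf{Theorem.} Let $f:\mathbb Z_{\ge0}\to\mathbb R_{\ge0}$ satisfy $f(n)/n\to0$, and let $B=\bigoplus_{n\ge0}B_n$ be a graded $K$-algebra of finite type which is an integral domain. Suppose that either (a) $B$ is generated by $B_1$ as a $K$-algebra and $\dim B>0$, or (b) $B_n$ is finite-dimensional over $K$ for every $n\ge1$, and $B_n\ne0$ for all sufficiently large $n$. Suppose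 the $B_n$ are equipped with $\mathbb R$-filtrations, separated, exhaustive and left continuous for $n\ge1$, making $B$ an $f$-quasi-filtered graded algebra, and that $$\limsup_{n\to\infty}\ \sup_{0\ne a\in B_n}\frac{\lambda(a)}{n}<+\infty .$$ For $n\ge1$ put $\nu_n=T_{1/n}\nu_{B_n}$. Then: 1) if $B$ is generated by $B_1$ as a $K$-algebra, then for every $n\ge1$ the minimum $\min_{a\in B_n}\lambda(a)$ exists and is a real number, and $\lim_{n\to\infty}\frac1n\min_{a\in B_n}\lambda(a)$ exists in $\mathbb R$; 2) the supports of the $\nu_n$ ($n\ge1$) are contained in a common bounded interval, and there is a Borel probability measure $\nu$ on $\mathbb R$ such that $\nu_n\to\nu$ vaguely, i.e. $\int g\,d\nu_n\to\int g\,d\nu$ for every $g\in C_c(\mathbb R)$; 3) the polygons $P(\nu_n)=\frac1nP_{B_n}$ (defined for all large $n$) converge uniformly on $[0,1]$ to a concave function. -/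

import Mathlib

open Set Filter Topology MeasureTheory
open scoped NNReal ENNReal CompactlySupported

/-- A decreasing `ℝ`-filtration of a `K`-vector space `V`. -/
structure RFiltration (K : Type*) (V : Type*) [Field K] [AddCommGroup V] [Module K V] where
  /-- The subspace `𝓕_r V`. -/
  sub : ℝ → Submodule K V
  antitone_sub : Antitone sub

namespace RFiltration

section

variable {K : Type*} {V : Type*} [Field K] [AddCommGroup V] [Module K V]

/-- The filtration is separated: `⋂ r, 𝓕_r V = {0}`. -/
def IsSeparated (F : RFiltration K V) : Prop :=
  ⨅ r : ℝ, F.sub r = ⊥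

/-- The filtration is exhaustive: `⋃ r, 𝓕_r V = V`. -/
def IsExhaustive (F : RFiltration K V) : Prop :=
  ⋃ r : ℝ, (F.sub r : Set V) = Set.univ

/-- The filtration is left continuous: `𝓕_r V = ⋂ s < r, 𝓕_s V` for every `r`. -/
def IsLeftContinuous (F : RFiltration K V) : Prop :=
  ∀ r : ℝ, F.sub r = ⨅ s : ℝ, ⨅ _ : s < r, F.sub s

/-- The index `λ(x) = sup {r ∈ ℝ | x ∈ 𝓕_r V}`, in `[-∞, +∞]`, with `sup ∅ = -∞`. -/
noncomputable def index (F : RFiltration K V) (x : V) : EReal :=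
  ⨆ r : ℝ, ⨆ _ : x ∈ F.sub r, (r : EReal)

end

end RFiltration

/-- `ν₁` is on the right of `ν₂`: every bounded increasing function has a larger
integral against `ν₁` than against `ν₂`. -/
def IsOnTheRightOf (ν₁ ν₂ : Measure ℝ) : Prop :=
  ∀ g : ℝ → ℝ, Monotone g → (∃ C : ℝ, ∀ x, |g x| ≤ C) → ∫ x, g x ∂ν₂ ≤ ∫ x, g x ∂ν₁

namespace RFiltration

section

variable {K : Type*} {V : Type*} [Field K] [AddCommGroup V] [Module K V]

/-- The measure `(1/n) ∑ᵢ δ_{λ(eᵢ)}` associated to a basis `e₁, …, eₙ` of `V`. The indices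
of the basis vectors are real numbers when the filtration is separated and exhaustive. -/
noncomputable def basisMeasure (F : RFiltration K V)
    (e : Module.Basis (Fin (Module.finrank K V)) K V) : Measure ℝ :=
  (Module.finrank K V : ℝ≥0∞)⁻¹ • ∑ i, Measure.dirac (F.index (e i)).toReal

/-- A basis is maximal if its measure is on the right of the measure of every basis. -/
def IsMaximalBasis (F : RFiltration K V)
    (e : Module.Basis (Fin (Module.finrank K V)) K V) : Prop :=
  ∀ e' : Module.Basis (Fin (Module.finrank K V)) K V,
    IsOnTheRightOf (F.basisMeasure e) (F.basisMeasure e')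

open Classical in
/-- The measure `ν_V` associated to a (separated and exhaustive) filtration of a
finite-dimensional space: the measure of a maximal basis. It does not depend on the maximal
basis, and it is the zero measure when `V = 0` (the sum over the empty basis). -/
noncomputable def measure (F : RFiltration K V) : Measure ℝ :=
  if h : ∃ e : Module.Basis (Fin (Module.finrank K V)) K V, F.IsMaximalBasis e then
    F.basisMeasure h.choose
  else 0

end

end RFiltration

/-- The dilation `T_ε ν`: the direct image of `ν` by `x ↦ ε x`. -/
noncomputable def dilate (ε : ℝ) (ν : Measure ℝ) : Measure ℝ :=
  ν.map (fun x => ε * x)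

/-- Vague convergence of a sequence of measures on `ℝ`. -/
def ConvergesVaguely (ν : ℕ → Measure ℝ) (μ : Measure ℝ) : Prop :=
  ∀ g : C_c(ℝ, ℝ), Tendsto (fun n => ∫ x, g x ∂(ν n)) atTop (𝓝 (∫ x, g x ∂μ))

/-- The quasi-inverse `t ↦ sup {x | h(x) > t}` of a decreasing function `h`. -/
noncomputable def quasiInverse (h : ℝ → ℝ) (t : ℝ) : ℝ :=
  sSup {x : ℝ | t < h x}

/-- The polygon `P(ν)(t) = ∫₀ᵗ h^*(s) ds` associated to a probability measure `ν`, where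
`h(x) = ν(]x, +∞[)` and `h^*` is the quasi-inverse of `h`. -/
noncomputable def polygon (ν : Measure ℝ) (t : ℝ) : ℝ :=
  ∫ s in (0 : ℝ)..t, quasiInverse (fun x => ν.real (Set.Ioi x)) s

/-- The graded algebra `B = ⨁ Bₙ`, with a filtration `(B_{n,s})_s` of each `Bₙ`, is
`f`-quasi-filtered: for some `n₀`, the product of elements of `B_{n₁,s₁}, …, B_{n_r,s_r}`
with all `nᵢ ≥ n₀` lies in `B_{N,S}`, where `N = ∑ nᵢ` and `S = ∑ (sᵢ - f(nᵢ))`. -/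
def IsQuasiFiltered {K : Type*} {B : Type*} [Field K] [CommRing B] [Algebra K B]
    (𝒜 : ℕ → Submodule K B) (f : ℕ → ℝ≥0) (F : ∀ n, RFiltration K (𝒜 n)) : Prop :=
  ∃ n₀ : ℕ, ∀ r : ℕ, 0 < r → ∀ (n : Fin r → ℕ) (s : Fin r → ℝ), (∀ i, n₀ ≤ n i) →
    ∀ a : ∀ i, 𝒜 (n i), (∀ i, a i ∈ (F (n i)).sub (s i)) →
      ∏ i, (a i : B) ∈
        ((F (∑ i, n i)).sub (∑ i, (s i - (f (n i) : ℝ)))).map (𝒜 (∑ i, n i)).subtype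

/-! Away from finitely many atoms, the tail of `ν_n` at `x` is `dim B_{n,nx} / dim B_n`
(`RFiltration.exists_measure_eq`). Everything about measures and polygons follows once the integrals
of this ratio over `[a, c]` converge, for one fixed `a` and every `c ≥ a`. Indeed, convergence of
the primitives of decreasing functions forces convergence almost everywhere
(`ae_exists_tendsto_of_tendsto_integral`), hence convergence of the quantile functions on `(0, 1)`.
Dominated convergence there gives both the vague limit and the uniform limit of the polygons
(`exists_limit_of_ae_tendsto`).

The quasi-filtration is first made multiplicative. Its `envelope`, spanned by products with index
corrected by `f`, lies within a shift `f(n) = o(n)` of it. Finite generation gives a linear lower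
bound for the indices. Shifting by that slope and truncating at slope `c` leaves a multiplicative
filtration with indices in `[0, M n]`, and the integral of its dimensions measures the mean index.

That mean is handled by an Okounkov-type argument at a generic point, valid over any field.
Homogeneous Noether normalization supplies algebraically independent `x_0, …, x_e` of a common
degree `N`. Dividing by powers of `x_0` moves the degrees divisible by `N` into a domain `E`, finite
of some rank `r` over `L = K(y_1, …, y_e)`. Elements of `E` are written in an `L`-basis and their
coordinates Taylor expanded by `y_i ↦ y_i + t_i`. The coefficients of leading exponent `α` of a
subspace form an `L`-subspace of `E`. These spaces multiply (`mul_mem_lead`), and their dimensions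
account for almost all of the `K`-dimension (`sum_finrank_lead_le`, `IsPolyModule.tendsto_finrank`).
So, up to lower order, the dimension of the `s`-th step is `r` times the number of exponents of
index at least `s`.

As `E` is a domain, the index of an exponent is superadditive. Its mean over all exponents of degree
at most `n` is superadditive in `n`, because the uniform laws on two simplices can be coupled so
that the sum is again uniform (`mean_add_le_mean`). Fekete's lemma then gives the limit along
multiples of `N`, and monotonicity extends it to all degrees.

For generation in degree one, the minimal index is the largest level at which the filtration is all
of `B_n`. Since `B_{p+s} = B_p B_s`, it is superadditive up to `f`, and Fekete's lemma applies
directly. -/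

/-! ### Leading coefficients of subspaces and dimension counts -/

section Leaf

variable {k Λ E Γ : Type*} [Field k] [AddCommGroup Λ] [Module k Λ] [AddCommGroup E] [Module k E]
  [LinearOrder Γ]

/-- The vectors all of whose coefficients before `α` vanish. -/
def vanishBelow (co : Γ → Λ →ₗ[k] E) (α : Γ) : Submodule k Λ :=
  ⨅ β : Γ, ⨅ _ : β < α, LinearMap.ker (co β)

/-- The space of leading coefficients of exponent `α` of a subspace. -/
def leaf (co : Γ → Λ →ₗ[k] E) (V : Submodule k Λ) (α : Γ) : Submodule k E :=
  (V ⊓ vanishBelow co α).map (co α)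

theorem mem_vanishBelow {co : Γ → Λ →ₗ[k] E} {α : Γ} {u : Λ} :
    u ∈ vanishBelow co α ↔ ∀ β < α, co β u = 0 := by
  simp [vanishBelow]

theorem mem_leaf {co : Γ → Λ →ₗ[k] E} {V : Submodule k Λ} {α : Γ} {x : E} :
    x ∈ leaf co V α ↔ ∃ u ∈ V, (∀ β < α, co β u = 0) ∧ co α u = x := by
  simp [leaf, mem_vanishBelow, and_assoc]

theorem leaf_mono (co : Γ → Λ →ₗ[k] E) {U V : Submodule k Λ} (h : U ≤ V) (α : Γ) :
    leaf co U α ≤ leaf co V α :=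
  Submodule.map_mono (inf_le_inf_right _ h)

/-- At the least exponent `α` carrying a nonzero coefficient, `co α` maps all of `V` onto its leaf.
The kernel in `V` has a smaller dimension and the same leaves at every other exponent, so induction
on the dimension applies. Finitely many exponents carry all the dimension. -/
theorem exists_sum_finrank_leaf_eq [WellFoundedLT Γ] (co : Γ → Λ →ₗ[k] E)
    (hco : ∀ u, (∀ α, co α u = 0) → u = 0) (V : Submodule k Λ) [FiniteDimensional k V] :
    ∃ T : Finset Γ, ∀ T', T ⊆ T' →
      ∑ α ∈ T', Module.finrank k (leaf co V α) = Module.finrank k V := by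
  classical
  induction hn : Module.finrank k V using Nat.strong_induction_on generalizing V with
  | _ n ih =>
  by_cases hV : V = ⊥
  · subst hV
    refine ⟨∅, fun T' _ => ?_⟩
    rw [← hn, finrank_bot]
    refine Finset.sum_eq_zero fun α _ => ?_
    rw [show leaf co ⊥ α = ⊥ by simp [leaf], finrank_bot]
  · have hne : {α : Γ | ∃ u ∈ V, co α u ≠ 0}.Nonempty := by
      obtain ⟨u, hu, hu0⟩ := Submodule.exists_mem_ne_zero_of_ne_bot hV
      by_contra hcon
      refine hu0 (hco u fun α => ?_)
      by_contra hα
      exact hcon ⟨α, u, hu, hα⟩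
    obtain ⟨α, ⟨u, hu, hα⟩, hmin⟩ := WellFounded.has_min (wellFounded_lt (α := Γ)) _ hne
    have hbelow : ∀ v ∈ V, ∀ β < α, co β v = 0 := by
      intro v hv β hβ
      by_contra h
      exact hmin β ⟨v, hv, h⟩ hβ
    set V' : Submodule k Λ := V ⊓ LinearMap.ker (co α) with hV'
    have hleafα : leaf co V α = V.map (co α) := by
      rw [leaf, inf_eq_left.2]
      exact fun v hv => mem_vanishBelow.2 (hbelow v hv)
    have hdim : Module.finrank k (leaf co V α) + Module.finrank k V' = Module.finrank k V := by
      rw [hleafα]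
      have := LinearMap.finrank_range_add_finrank_ker ((co α).domRestrict V)
      rw [← this]
      congr 1
      · rw [LinearMap.range_domRestrict]
      · rw [LinearMap.ker_domRestrict]
        exact (LinearEquiv.finrank_eq (Submodule.comapSubtypeEquivOfLe
          (inf_le_left : V ⊓ LinearMap.ker (co α) ≤ V))).symm.trans (by
            rw [Submodule.comap_inf, Submodule.comap_subtype_self, top_inf_eq])
    have hpos : 0 < Module.finrank k (leaf co V α) := by
      have : Nontrivial (leaf co V α) := by
        rw [Submodule.nontrivial_iff_ne_bot, Submodule.ne_bot_iff]
        exact ⟨co α u, by rw [hleafα]; exact Submodule.mem_map_of_mem hu, hα⟩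
      have : Module.Finite k (leaf co V α) := by rw [hleafα]; infer_instance
      exact Module.finrank_pos
    have : FiniteDimensional k V' := Submodule.finiteDimensional_of_le inf_le_left
    obtain ⟨T, hT⟩ := ih _ (by omega) V' rfl
    refine ⟨insert α T, fun T' hT' => ?_⟩
    have h1 : ∀ β, β ≠ α → leaf co V β = leaf co V' β := by
      intro β hβ
      refine le_antisymm (fun x hx => ?_) (leaf_mono co inf_le_left β)
      obtain ⟨v, hv, hv0, rfl⟩ := mem_leaf.1 hx
      rcases lt_or_gt_of_ne hβ with h | h
      · rw [hbelow v hv β h]; exact zero_mem _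
      · exact mem_leaf.2 ⟨v, ⟨hv, hv0 α h⟩, hv0, rfl⟩
    have h2 : leaf co V' α = ⊥ := by
      rw [eq_bot_iff]
      intro x hx
      obtain ⟨v, hv, -, rfl⟩ := mem_leaf.1 hx
      exact hv.2
    have hα' : α ∈ T' := hT' (Finset.mem_insert_self _ _)
    have h3 := hT T' ((Finset.subset_insert _ _).trans hT')
    rw [← Finset.add_sum_erase _ _ hα'] at h3 ⊢
    rw [h2, finrank_bot, zero_add] at h3
    rw [Finset.sum_congr rfl (fun β hβ => by rw [h1 β (Finset.ne_of_mem_erase hβ)]), h3]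
    omega

/-- For either space, the dimension minus the sum over `T` counts the leaves outside `T`, and those
of `U` lie inside those of `V`. The statement is arranged to avoid subtraction. -/
theorem finrank_add_sum_leaf_le [WellFoundedLT Γ] (co : Γ → Λ →ₗ[k] E) [FiniteDimensional k E]
    (hco : ∀ u, (∀ α, co α u = 0) → u = 0) {U V : Submodule k Λ} [FiniteDimensional k V]
    (h : U ≤ V) (T : Finset Γ) :
    Module.finrank k U + ∑ α ∈ T, Module.finrank k (leaf co V α) ≤
      Module.finrank k V + ∑ α ∈ T, Module.finrank k (leaf co U α) := by
  classical
  have : FiniteDimensional k U := Submodule.finiteDimensional_of_le h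
  obtain ⟨T₁, h₁⟩ := exists_sum_finrank_leaf_eq co hco U
  obtain ⟨T₂, h₂⟩ := exists_sum_finrank_leaf_eq co hco V
  have e₁ := h₁ (T ∪ (T₁ ∪ T₂)) (by intro x; simp; tauto)
  have e₂ := h₂ (T ∪ (T₁ ∪ T₂)) (by intro x; simp; tauto)
  have hs : T ⊆ T ∪ (T₁ ∪ T₂) := Finset.subset_union_left
  rw [← Finset.sum_sdiff hs] at e₁ e₂
  have := Finset.sum_le_sum (s := (T ∪ (T₁ ∪ T₂)) \ T) (fun α _ =>
    Submodule.finrank_mono (leaf_mono co h α))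
  omega

end Leaf

/-! ### Taylor expansion at the generic point -/

section Taylor

variable {K : Type*} [Field K] {e : ℕ}

variable (K e) in
/-- The field of rational functions in `e` variables. -/
abbrev RatFun := FractionRing (MvPolynomial (Fin e) K)

variable (K e) in
/-- The Taylor expansion of polynomials at the generic point. -/
noncomputable def taylorPoly : MvPolynomial (Fin e) K →ₐ[K] MvPowerSeries (Fin e) (RatFun K e) :=
  MvPolynomial.aeval fun i =>
    MvPowerSeries.C (algebraMap (MvPolynomial (Fin e) K) (RatFun K e) (MvPolynomial.X i)) +
      MvPowerSeries.X i

theorem constantCoeff_taylorPoly (p : MvPolynomial (Fin e) K) :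
    MvPowerSeries.constantCoeff (taylorPoly K e p) = algebraMap _ (RatFun K e) p := by
  have : (MvPowerSeries.constantCoeff (σ := Fin e) (R := RatFun K e)).comp
      (taylorPoly K e : MvPolynomial (Fin e) K →+* _) = algebraMap _ _ := by
    apply MvPolynomial.ringHom_ext
    · intro r
      simp [taylorPoly, MvPowerSeries.algebraMap_apply, MvPolynomial.algebraMap_eq,
        IsScalarTower.algebraMap_apply K (MvPolynomial (Fin e) K) (RatFun K e)]
    · intro i
      simp [taylorPoly]
  exact congrArg (fun f : _ →+* _ => f p) this

variable (K e) in
/-- The Taylor expansion of rational functions at the generic point. -/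
noncomputable def taylor : RatFun K e →+* MvPowerSeries (Fin e) (RatFun K e) :=
  IsLocalization.lift (M := nonZeroDivisors (MvPolynomial (Fin e) K))
    (g := (taylorPoly K e : MvPolynomial (Fin e) K →+* _)) fun p => by
      -- The constant term of the expansion of `p` is `p` itself, a nonzero rational function.
      rw [MvPowerSeries.isUnit_iff_constantCoeff]
      have := constantCoeff_taylorPoly (p : MvPolynomial (Fin e) K)
      rw [AlgHom.coe_toRingHom, this]
      exact IsLocalization.map_units _ p

theorem taylor_algebraMap (p : MvPolynomial (Fin e) K) :
    taylor K e (algebraMap _ _ p) = taylorPoly K e p :=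
  IsLocalization.lift_eq _ _

theorem constantCoeff_taylor (x : RatFun K e) :
    MvPowerSeries.constantCoeff (taylor K e x) = x := by
  have : (MvPowerSeries.constantCoeff (σ := Fin e) (R := RatFun K e)).comp (taylor K e) =
      RingHom.id _ := by
    apply IsFractionRing.ringHom_ext (A := MvPolynomial (Fin e) K)
    intro p
    simp [taylor_algebraMap, constantCoeff_taylorPoly]
  exact congrArg (fun f : _ →+* _ => f x) this

theorem taylor_algebraMap_field (c : K) (x : RatFun K e) :
    taylor K e (c • x) = c • taylor K e x := by
  rw [Algebra.smul_def, map_mul, IsScalarTower.algebraMap_apply K (MvPolynomial (Fin e) K),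
    taylor_algebraMap, AlgHom.commutes, Algebra.smul_def]

variable {E : Type*} [CommRing E] [Algebra (RatFun K e) E]
  {ι : Type*} [Fintype ι]

/-- The coefficient of exponent `α` of an expansion. -/
noncomputable def taylorCoeff (b : Module.Basis ι (RatFun K e) E) (α : Lex (Fin e →₀ ℕ)) :
    (ι → MvPowerSeries (Fin e) (RatFun K e)) →ₗ[RatFun K e] E :=
  ∑ i, ((MvPowerSeries.coeff (ofLex α)).comp (LinearMap.proj i)).smulRight (b i)

theorem taylorCoeff_apply (b : Module.Basis ι (RatFun K e) E) (α : Lex (Fin e →₀ ℕ))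
    (u : ι → MvPowerSeries (Fin e) (RatFun K e)) :
    taylorCoeff b α u = ∑ i, MvPowerSeries.coeff (ofLex α) (u i) • b i := by
  simp [taylorCoeff]

theorem taylorCoeff_eq_zero_iff (b : Module.Basis ι (RatFun K e) E) (α : Lex (Fin e →₀ ℕ))
    (u : ι → MvPowerSeries (Fin e) (RatFun K e)) :
    taylorCoeff b α u = 0 ↔ ∀ i, MvPowerSeries.coeff (ofLex α) (u i) = 0 := by
  rw [taylorCoeff_apply]
  refine ⟨fun h i => ?_, fun h => by simp [h]⟩
  exact Fintype.linearIndependent_iff.1 b.linearIndependent _ h i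

theorem eq_zero_of_taylorCoeff (b : Module.Basis ι (RatFun K e) E)
    (u : ι → MvPowerSeries (Fin e) (RatFun K e)) (h : ∀ α, taylorCoeff b α u = 0) : u = 0 := by
  ext i α
  exact (taylorCoeff_eq_zero_iff b (toLex α) u).1 (h _) i

/-- The product of expansions. -/
noncomputable def taylorMul (b : Module.Basis ι (RatFun K e) E) :
    (ι → MvPowerSeries (Fin e) (RatFun K e)) →ₗ[RatFun K e]
      (ι → MvPowerSeries (Fin e) (RatFun K e)) →ₗ[RatFun K e]
        (ι → MvPowerSeries (Fin e) (RatFun K e)) :=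
  LinearMap.mk₂ (RatFun K e)
    (fun u v l => ∑ i, ∑ j, u i * v j * taylor K e (b.repr (b i * b j) l))
    (fun u u' v => by ext1 l; simp [add_mul, Finset.sum_add_distrib])
    (fun c u v => by ext1 l; simp [Finset.smul_sum])
    (fun u v v' => by ext1 l; simp [mul_add, add_mul, Finset.sum_add_distrib])
    (fun c u v => by ext1 l; simp [Finset.smul_sum])

theorem taylorMul_apply (b : Module.Basis ι (RatFun K e) E)
    (u v : ι → MvPowerSeries (Fin e) (RatFun K e)) (l : ι) :
    taylorMul b u v l = ∑ i, ∑ j, u i * v j * taylor K e (b.repr (b i * b j) l) := rfl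

/-- Lowest coefficients multiply. -/
theorem MvPowerSeries.coeff_mul_of_vanish {R : Type*} [CommRing R] {f g : MvPowerSeries (Fin e) R}
    {α β : Lex (Fin e →₀ ℕ)}
    (hf : ∀ α' < α, MvPowerSeries.coeff (ofLex α') f = 0)
    (hg : ∀ β' < β, MvPowerSeries.coeff (ofLex β') g = 0) :
    (∀ γ < α + β, MvPowerSeries.coeff (ofLex γ) (f * g) = 0) ∧
    MvPowerSeries.coeff (ofLex (α + β)) (f * g) =
      MvPowerSeries.coeff (ofLex α) f * MvPowerSeries.coeff (ofLex β) g := by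
  classical
  have key : ∀ p q : Fin e →₀ ℕ, toLex p < α ∨ toLex q < β →
      MvPowerSeries.coeff p f * MvPowerSeries.coeff q g = 0 := by
    rintro p q (h | h)
    · rw [show MvPowerSeries.coeff p f = 0 from hf _ h, zero_mul]
    · rw [show MvPowerSeries.coeff q g = 0 from hg _ h, mul_zero]
  constructor
  · intro γ hγ
    rw [MvPowerSeries.coeff_mul]
    refine Finset.sum_eq_zero fun p hp => key _ _ ?_
    rw [Finset.HasAntidiagonal.mem_antidiagonal] at hp
    by_contra! hcon
    have : α + β ≤ toLex (p.1 + p.2) := by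
      rw [toLex_add]; exact add_le_add hcon.1 hcon.2
    rw [hp] at this
    exact absurd hγ (not_lt.2 this)
  · rw [MvPowerSeries.coeff_mul]
    refine Finset.sum_eq_single_of_mem (ofLex α, ofLex β) (by simp) fun p hp hne => key _ _ ?_
    rw [Finset.HasAntidiagonal.mem_antidiagonal] at hp
    have hp' : toLex p.1 + toLex p.2 = α + β := by rw [← toLex_add, hp]; rfl
    rcases trichotomy_of_add_eq_add hp' with h | h | h
    · exact absurd (Prod.ext h.1 h.2) hne
    · exact Or.inl h
    · exact Or.inr h

/-- The structure constants of `b` enter `taylorMul` through their expansions, but only their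
constant terms reach the lowest exponent, and these are the structure constants themselves. So
leading coefficients multiply as in `E`. Expanding only coordinates requires no separability of `E`
over the rational functions. -/
theorem taylorMul_lowest (b : Module.Basis ι (RatFun K e) E)
    {u v : ι → MvPowerSeries (Fin e) (RatFun K e)} {α β : Lex (Fin e →₀ ℕ)}
    (hu : ∀ α' < α, taylorCoeff b α' u = 0) (hv : ∀ β' < β, taylorCoeff b β' v = 0) :
    (∀ γ < α + β, taylorCoeff b γ (taylorMul b u v) = 0) ∧
    taylorCoeff b (α + β) (taylorMul b u v) = taylorCoeff b α u * taylorCoeff b β v := by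
  have hu' : ∀ i, ∀ α' < α, MvPowerSeries.coeff (ofLex α') (u i) = 0 :=
    fun i α' h => (taylorCoeff_eq_zero_iff b α' u).1 (hu α' h) i
  have hv' : ∀ i, ∀ β' < β, MvPowerSeries.coeff (ofLex β') (v i) = 0 :=
    fun i β' h => (taylorCoeff_eq_zero_iff b β' v).1 (hv β' h) i
  have h3 : ∀ i j l, (∀ γ < α + β, MvPowerSeries.coeff (ofLex γ)
      (u i * v j * taylor K e (b.repr (b i * b j) l)) = 0) ∧
      MvPowerSeries.coeff (ofLex (α + β)) (u i * v j * taylor K e (b.repr (b i * b j) l)) =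
      MvPowerSeries.coeff (ofLex α) (u i) * MvPowerSeries.coeff (ofLex β) (v j) *
        b.repr (b i * b j) l := by
    intro i j l
    have h1 := MvPowerSeries.coeff_mul_of_vanish (hu' i) (hv' j)
    have h0 : ∀ γ : Lex (Fin e →₀ ℕ), ¬ γ < 0 := fun γ => not_lt.2 (by
      have : toLex (0 : Fin e →₀ ℕ) ≤ toLex (ofLex γ) := Finsupp.toLex_monotone zero_le
      exact this)
    have h2 := MvPowerSeries.coeff_mul_of_vanish (β := 0)
      (g := taylor K e (b.repr (b i * b j) l)) h1.1 (fun γ h => absurd h (h0 γ))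
    rw [add_zero] at h2
    refine ⟨h2.1, ?_⟩
    rw [h2.2, h1.2]
    congr 1
    exact constantCoeff_taylor _
  constructor
  · intro γ hγ
    rw [taylorCoeff_eq_zero_iff]
    intro l
    rw [taylorMul_apply]
    simp only [map_sum]
    exact Finset.sum_eq_zero fun i _ => Finset.sum_eq_zero fun j _ => (h3 i j l).1 γ hγ
  · rw [taylorCoeff_apply, taylorCoeff_apply, taylorCoeff_apply, Finset.sum_mul_sum]
    simp only [taylorMul_apply, map_sum, (h3 _ _ _).2, Finset.sum_smul]
    rw [Finset.sum_comm]
    refine Finset.sum_congr rfl fun i _ => ?_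
    rw [Finset.sum_comm]
    refine Finset.sum_congr rfl fun j _ => ?_
    rw [smul_mul_smul_comm]
    conv_rhs => rw [← b.sum_repr (b i * b j), Finset.smul_sum]
    simp only [smul_smul]

variable [Algebra K E] [IsScalarTower K (RatFun K e) E]

/-- The coordinates of an element, expanded at the generic point. -/
noncomputable def taylorVec (b : Module.Basis ι (RatFun K e) E) :
    E →ₗ[K] (ι → MvPowerSeries (Fin e) (RatFun K e)) where
  toFun x i := taylor K e (b.repr x i)
  map_add' x y := by ext1 i; simp
  map_smul' c x := by
    ext1 i
    rw [← algebraMap_smul (RatFun K e) c x, map_smul, Finsupp.smul_apply, algebraMap_smul,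
      taylor_algebraMap_field]
    rfl

theorem taylorCoeff_zero_taylorVec (b : Module.Basis ι (RatFun K e) E) (x : E) :
    taylorCoeff b 0 (taylorVec b x) = x := by
  rw [taylorCoeff_apply]
  conv_rhs => rw [← b.sum_repr x]
  refine Finset.sum_congr rfl fun i _ => ?_
  congr 1
  exact constantCoeff_taylor _

theorem taylorMul_taylorVec (b : Module.Basis ι (RatFun K e) E)
    (x y : E) :
    taylorMul b (taylorVec b x) (taylorVec b y) = taylorVec b (x * y) := by
  ext1 l
  rw [taylorMul_apply]
  change _ = taylor K e (b.repr (x * y) l)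
  conv_rhs => rw [← b.sum_repr x, ← b.sum_repr y]
  rw [Finset.sum_mul_sum]
  simp only [map_sum, Finsupp.coe_finsetSum, Finset.sum_apply]
  refine Finset.sum_congr rfl fun i _ => Finset.sum_congr rfl fun j _ => ?_
  rw [smul_mul_smul_comm, map_smul, Finsupp.smul_apply, smul_eq_mul, map_mul (taylor K e),
    map_mul (taylor K e)]
  rfl

/-- The leading coefficients of the expansions of the elements of a `K`-subspace. -/
noncomputable def lead (b : Module.Basis ι (RatFun K e) E) (V : Submodule K E)
    (α : Fin e →₀ ℕ) : Submodule (RatFun K e) E :=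
  leaf (taylorCoeff b) (Submodule.span (RatFun K e) (taylorVec b '' V)) (toLex α)

theorem lead_mono (b : Module.Basis ι (RatFun K e) E) {U V : Submodule K E} (h : U ≤ V)
    (α : Fin e →₀ ℕ) : lead b U α ≤ lead b V α :=
  leaf_mono _ (Submodule.span_mono (Set.image_mono h)) _

theorem lead_bot (b : Module.Basis ι (RatFun K e) E) (α : Fin e →₀ ℕ) : lead b ⊥ α = ⊥ := by
  simp [lead, leaf]

/-- Expansion is multiplicative and `taylorMul` is bilinear over the rational functions, so products
of elements of the two spans stay in the span attached to `W`; then lowest coefficients multiply. -/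
theorem mul_mem_lead (b : Module.Basis ι (RatFun K e) E)
    {U V W : Submodule K E} (hUV : ∀ x ∈ U, ∀ y ∈ V, x * y ∈ W) {α β : Fin e →₀ ℕ} {x y : E}
    (hx : x ∈ lead b U α) (hy : y ∈ lead b V β) : x * y ∈ lead b W (α + β) := by
  obtain ⟨u, hu, hu0, rfl⟩ := mem_leaf.1 hx
  obtain ⟨v, hv, hv0, rfl⟩ := mem_leaf.1 hy
  have h := taylorMul_lowest b hu0 hv0
  refine mem_leaf.2 ⟨taylorMul b u v, ?_, h.1, h.2⟩
  refine LinearMap.BilinMap.apply_apply_mem_of_mem_span _ _ _ (taylorMul b) ?_ u v hu hv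
  rintro _ ⟨x, hx, rfl⟩ _ ⟨y, hy, rfl⟩
  rw [taylorMul_taylorVec]
  exact Submodule.subset_span ⟨_, hUV x hx y hy, rfl⟩

/-- The constant term of the expansion of `x` is `x`, and no exponent is below `0`. -/
theorem le_lead_zero (b : Module.Basis ι (RatFun K e) E) (V : Submodule K E) :
    (V : Set E) ⊆ lead b V 0 := by
  intro x hx
  refine mem_leaf.2 ⟨taylorVec b x, Submodule.subset_span ⟨x, hx, rfl⟩, fun γ h => ?_,
    taylorCoeff_zero_taylorVec b x⟩
  exact absurd h (not_lt.2 (Finsupp.toLex_monotone zero_le))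

end Taylor

/-! ### Polynomials of bounded degree and their leading exponents -/

section PolyLE

variable (K : Type*) [Field K] (e : ℕ) (E : Type*) [CommRing E] [Algebra (RatFun K e) E]
  [Algebra K E] [IsScalarTower K (RatFun K e) E]

/-- Polynomials as elements of an algebra over the rational functions. -/
noncomputable def polyHom : MvPolynomial (Fin e) K →ₐ[K] E :=
  (IsScalarTower.toAlgHom K (RatFun K e) E).comp
    (IsScalarTower.toAlgHom K (MvPolynomial (Fin e) K) (RatFun K e))

/-- The space of polynomials of degree at most `n`. -/
noncomputable def polyLE (n : ℕ) : Submodule K E :=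
  (MvPolynomial.restrictTotalDegree (Fin e) K n).map (polyHom K e E).toLinearMap

variable {K e E}

theorem polyHom_apply (p : MvPolynomial (Fin e) K) :
    polyHom K e E p = algebraMap (RatFun K e) E (algebraMap _ _ p) := rfl

theorem polyHom_mem_polyLE {p : MvPolynomial (Fin e) K} {n : ℕ} (h : p.totalDegree ≤ n) :
    polyHom K e E p ∈ polyLE K e E n :=
  Submodule.mem_map_of_mem ((MvPolynomial.mem_restrictTotalDegree _ _ _).2 h)

theorem mem_polyLE {x : E} {n : ℕ} :
    x ∈ polyLE K e E n ↔ ∃ p : MvPolynomial (Fin e) K, p.totalDegree ≤ n ∧ polyHom K e E p = x := by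
  simp [polyLE, MvPolynomial.mem_restrictTotalDegree]

theorem polyLE_mono {m n : ℕ} (h : m ≤ n) : polyLE K e E m ≤ polyLE K e E n := by
  intro x hx
  obtain ⟨p, hp, rfl⟩ := mem_polyLE.1 hx
  exact polyHom_mem_polyLE (hp.trans h)

theorem mul_mem_polyLE {x y : E} {m n : ℕ} (hx : x ∈ polyLE K e E m) (hy : y ∈ polyLE K e E n) :
    x * y ∈ polyLE K e E (m + n) := by
  obtain ⟨p, hp, rfl⟩ := mem_polyLE.1 hx
  obtain ⟨q, hq, rfl⟩ := mem_polyLE.1 hy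
  rw [← map_mul]
  exact polyHom_mem_polyLE ((MvPolynomial.totalDegree_mul _ _).trans (add_le_add hp hq))

variable {ι : Type*} [Fintype ι]

/-- The expansion of `X i` minus `y` times that of `1`, where `y` is the rational function `X i`
taken as a scalar, equals the series variable `X i` times the expansion of `1`. Passing to the span
over the rational functions is what makes this combination available. -/
theorem one_mem_lead_single (b : Module.Basis ι (RatFun K e) E) (i : Fin e) :
    1 ∈ lead b (polyLE K e E 1) (Finsupp.single i 1) := by
  classical
  set y : RatFun K e := algebraMap (MvPolynomial (Fin e) K) _ (MvPolynomial.X i) with hy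
  have hu : taylorVec b (polyHom K e E (MvPolynomial.X i)) - y • taylorVec b (1 : E) =
      fun l => MvPowerSeries.X i * taylor K e (b.repr 1 l) := by
    ext1 l
    have h1 : taylorVec b (polyHom K e E (MvPolynomial.X i)) l =
        taylor K e y * taylor K e (b.repr 1 l) := by
      rw [← map_mul, ← smul_eq_mul, ← Finsupp.smul_apply, ← map_smul, Algebra.smul_def, mul_one]
      rfl
    have h2 : taylor K e y = MvPowerSeries.C y + MvPowerSeries.X i := by
      rw [hy, taylor_algebraMap, taylorPoly, MvPolynomial.aeval_X]
    rw [Pi.sub_apply, h1, h2, add_mul, Pi.smul_apply, MvPowerSeries.smul_eq_C_mul,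
      add_sub_assoc, add_comm, sub_add_eq_add_sub]
    change _ + _ - MvPowerSeries.C y * taylor K e (b.repr 1 l) = _
    ring
  refine mem_leaf.2 ⟨taylorVec b (polyHom K e E (MvPolynomial.X i)) - y • taylorVec b (1 : E),
    sub_mem (Submodule.subset_span ⟨_, polyHom_mem_polyLE (MvPolynomial.totalDegree_X i).le, rfl⟩)
      (Submodule.smul_mem _ _ (Submodule.subset_span ⟨1, ?_, rfl⟩)), ?_, ?_⟩
  · rw [← map_one (polyHom K e E)]
    exact polyHom_mem_polyLE (by simp)
  · intro γ hγ
    rw [hu, taylorCoeff_eq_zero_iff]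
    intro l
    rw [MvPowerSeries.X, MvPowerSeries.coeff_monomial_mul, if_neg]
    intro hle
    exact absurd hγ (not_lt.2 (Finsupp.toLex_monotone hle))
  · rw [hu]
    conv_rhs => rw [← taylorCoeff_zero_taylorVec b (1 : E)]
    rw [taylorCoeff_apply, taylorCoeff_apply]
    refine Finset.sum_congr rfl fun l _ => ?_
    congr 1
    rw [MvPowerSeries.X, MvPowerSeries.coeff_monomial_mul]
    simp
    rfl

theorem one_mem_lead_polyLE (b : Module.Basis ι (RatFun K e) E) (n : ℕ) (α : Fin e →₀ ℕ)
    (h : α.degree ≤ n) : 1 ∈ lead b (polyLE K e E n) α := by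
  refine lead_mono b (polyLE_mono h) α ?_
  clear h
  induction α using Finsupp.induction_linear with
  | zero =>
    refine le_lead_zero b _ ?_
    rw [← map_one (polyHom K e E)]
    exact polyHom_mem_polyLE (by simp)
  | add α β hα hβ =>
    rw [map_add, ← mul_one 1]
    exact mul_mem_lead b (fun x hx y hy => mul_mem_polyLE hx hy) hα hβ
  | single i m =>
    induction m with
    | zero =>
      rw [Finsupp.single_zero]
      refine le_lead_zero b _ ?_
      rw [← map_one (polyHom K e E)]
      exact polyHom_mem_polyLE (by simp)
    | succ m ih =>
      rw [Finsupp.single_add, map_add]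
      have h1 : 1 ∈ lead b (polyLE K e E (Finsupp.single i 1 : Fin e →₀ ℕ).degree)
          (Finsupp.single i 1) := by
        simpa using one_mem_lead_single b i
      simpa using mul_mem_lead b (fun x hx y hy => mul_mem_polyLE hx hy) ih h1

/-- Multiply `1`, a leading coefficient of exponent `α` of the polynomials, by the elements of `V`,
seen at exponent `0`. The result contains `V` and is a subspace over the rational functions, hence
everything. -/
theorem lead_eq_top (b : Module.Basis ι (RatFun K e) E) {V W : Submodule K E} {n : ℕ}
    (hV : Submodule.span (RatFun K e) (V : Set E) = ⊤)
    (hW : ∀ x ∈ polyLE K e E n, ∀ y ∈ V, x * y ∈ W) {α : Fin e →₀ ℕ} (h : α.degree ≤ n) :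
    lead b W α = ⊤ := by
  rw [eq_top_iff, ← hV, Submodule.span_le]
  intro y hy
  rw [← one_mul y, ← add_zero α]
  exact mul_mem_lead b hW (one_mem_lead_polyLE b n α h) (le_lead_zero b V hy)

theorem finiteDimensional_span_image {k Λ V : Type*} [Field k] [AddCommGroup Λ] [Module K Λ]
    [AddCommGroup V] [Module K V] [Algebra K k] [Module k Λ] [IsScalarTower K k Λ]
    (f : V →ₗ[K] Λ) (U : Submodule K V) [FiniteDimensional K U] :
    FiniteDimensional k (Submodule.span k (f '' U)) ∧
    Module.finrank k (Submodule.span k (f '' U)) ≤ Module.finrank K U := by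
  let c := Module.finBasis K U
  have h : Submodule.span k (f '' U) = Submodule.span k (range fun i => f (c i)) := by
    refine le_antisymm (Submodule.span_le.2 ?_) (Submodule.span_mono ?_)
    · rintro _ ⟨x, hx, rfl⟩
      have hx' := congrArg (fun y : U => f y) (c.sum_repr ⟨x, hx⟩)
      simp only [AddSubmonoidClass.coe_finsetSum, map_sum, Submodule.coe_smul, map_smul] at hx'
      rw [← hx']
      refine sum_mem fun i _ => ?_
      rw [← algebraMap_smul k]
      exact Submodule.smul_mem _ _ (Submodule.subset_span ⟨i, rfl⟩)
    · rintro _ ⟨i, rfl⟩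
      exact ⟨c i, (c i).2, rfl⟩
  rw [h]
  refine ⟨FiniteDimensional.span_of_finite _ (finite_range _), ?_⟩
  exact (finrank_range_le_card _).trans_eq (Fintype.card_fin _)

/-- A complement of `U` in `W` spans, over the larger field, a space of dimension at most its
`K`-dimension. So the codimension can only drop. -/
theorem finrank_span_image_le {k Λ V : Type*} [Field k] [AddCommGroup Λ] [Module K Λ]
    [AddCommGroup V] [Module K V] [Algebra K k] [Module k Λ] [IsScalarTower K k Λ]
    (f : V →ₗ[K] Λ) {U W : Submodule K V} [FiniteDimensional K W] (h : U ≤ W) :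
    Module.finrank K U + Module.finrank k (Submodule.span k (f '' W)) ≤
      Module.finrank K W + Module.finrank k (Submodule.span k (f '' U)) := by
  obtain ⟨D, hD⟩ := Submodule.exists_isCompl U
  have hsup : U ⊔ D ⊓ W = W := by rw [← sup_inf_assoc_of_le D h, hD.sup_eq_top, top_inf_eq]
  have : FiniteDimensional K U := Submodule.finiteDimensional_of_le h
  have : FiniteDimensional K (D ⊓ W : Submodule K V) :=
    Submodule.finiteDimensional_of_le inf_le_right
  have h1 := Submodule.finrank_sup_add_finrank_inf_eq U (D ⊓ W)
  rw [hsup, ← inf_assoc, hD.inf_eq_bot, bot_inf_eq, finrank_bot, add_zero] at h1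
  obtain ⟨_, -⟩ := finiteDimensional_span_image (k := k) f U
  obtain ⟨_, h2⟩ := finiteDimensional_span_image (k := k) f (D ⊓ W)
  have h3 : Submodule.span k (f '' W) ≤
      Submodule.span k (f '' U) ⊔ Submodule.span k (f '' (D ⊓ W : Submodule K V)) := by
    rw [Submodule.span_le]
    rintro _ ⟨x, hx, rfl⟩
    rw [SetLike.mem_coe, ← hsup] at hx
    obtain ⟨y, hy, z, hz, rfl⟩ := Submodule.mem_sup.1 hx
    rw [map_add]
    exact Submodule.add_mem_sup (Submodule.subset_span ⟨y, hy, rfl⟩)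
      (Submodule.subset_span ⟨z, hz, rfl⟩)
  have h4 := (Submodule.finrank_mono h3).trans (Submodule.finrank_add_le_finrank_add_finrank _ _)
  omega

/-- The part of the `K`-dimension not seen by leading exponents in `T` grows with the subspace. For
a large space where this defect is negligible, it is therefore negligible for every step of a
filtration. -/
theorem sum_finrank_lead_le (b : Module.Basis ι (RatFun K e) E) {U V : Submodule K E}
    [FiniteDimensional K V] (h : U ≤ V) (T : Finset (Fin e →₀ ℕ)) :
    Module.finrank K U + ∑ α ∈ T, Module.finrank (RatFun K e) (lead b V α) ≤
      Module.finrank K V + ∑ α ∈ T, Module.finrank (RatFun K e) (lead b U α) := by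
  classical
  have h1 := finrank_span_image_le (k := RatFun K e) (taylorVec b) h
  obtain ⟨_, -⟩ := finiteDimensional_span_image (k := RatFun K e) (taylorVec b) V
  have : FiniteDimensional (RatFun K e) E := Module.Basis.finiteDimensional_of_finite b
  have h2 := finrank_add_sum_leaf_le (taylorCoeff b) (eq_zero_of_taylorCoeff b)
    (Submodule.span_mono (R := RatFun K e) (image_mono (f := taylorVec b) h)) (T.map toLex.toEmbedding)
  simp only [Finset.sum_map, Equiv.coe_toEmbedding] at h2
  change _ + ∑ α ∈ T, Module.finrank _ (lead b V α) ≤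
    _ + ∑ α ∈ T, Module.finrank _ (lead b U α) at h2
  omega

/-- The exponents of the monomials of degree `n` in `e + 1` variables. -/
def simplexExp (e n : ℕ) : Finset (Fin (e + 1) →₀ ℕ) := Finset.univ.finsuppAntidiag n

theorem mem_simplexExp {n : ℕ} {γ : Fin (e + 1) →₀ ℕ} : γ ∈ simplexExp e n ↔ ∑ i, γ i = n := by
  simp [simplexExp]

theorem finrank_restrictTotalDegree_le (n : ℕ) :
    FiniteDimensional K (MvPolynomial.restrictTotalDegree (Fin e) K n) ∧
    Module.finrank K (MvPolynomial.restrictTotalDegree (Fin e) K n) ≤ (simplexExp e n).card := by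
  -- An exponent of degree at most `n` is homogenized by the extra coordinate that completes its
  -- degree to `n`.
  have hinj : Function.Injective (fun s : {s : Fin e →₀ ℕ | s.sum (fun _ m => m) ≤ n} =>
      (⟨Finsupp.cons (n - s.1.sum (fun _ m => m)) s.1, by
        have := s.2
        rw [mem_simplexExp, Fin.sum_univ_succ, Finsupp.cons_zero]
        simp only [Finsupp.cons_succ]
        rw [mem_ofPred_eq, Finsupp.sum_fintype _ _ (fun _ => rfl)] at this
        rw [Finsupp.sum_fintype _ _ (fun _ => rfl)]
        omega⟩ : simplexExp e n)) := by
    intro s t hst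
    have := congrArg (fun x => Finsupp.tail x.1) hst
    simpa [Subtype.ext_iff] using this
  have : Finite {s : Fin e →₀ ℕ | s.sum (fun _ m => m) ≤ n} := Finite.of_injective _ hinj
  let c := MvPolynomial.basisRestrictSupport K {s : Fin e →₀ ℕ | s.sum (fun _ m => m) ≤ n}
  refine ⟨Module.Basis.finiteDimensional_of_finite c, ?_⟩
  have h1 := Module.finrank_eq_nat_card_basis c
  have h2 := Nat.card_le_card_of_injective _ hinj
  rw [Nat.card_eq_fintype_card (α := simplexExp e n), Fintype.card_coe] at h2
  exact h1.trans_le h2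

/-- A common denominator `g` of the coordinates of a basis of `W₀` turns them into polynomials of
degree at most some `c`. Multiplying coordinates by `g` then embeds the product space into vectors
of polynomials of degree at most `n + c`. -/
theorem exists_finrank_polyLE_mul_le (b : Module.Basis ι (RatFun K e) E) (W₀ : Submodule K E)
    [FiniteDimensional K W₀] : ∃ c : ℕ, ∀ n,
    FiniteDimensional K (polyLE K e E n * W₀ : Submodule K E) ∧
    Module.finrank K (polyLE K e E n * W₀ : Submodule K E) ≤
      Fintype.card ι * (simplexExp e (n + c)).card := by
  classical
  let η := Module.finBasis K W₀
  obtain ⟨g, hg⟩ := IsLocalization.exist_integer_multiples_of_finset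
    (nonZeroDivisors (MvPolynomial (Fin e) K))
    (Finset.univ.image fun x : Fin (Module.finrank K W₀) × ι => b.repr (η x.1 : E) x.2)
  have hg' : ∀ j i, ∃ p : MvPolynomial (Fin e) K,
      algebraMap _ (RatFun K e) p = (g : MvPolynomial (Fin e) K) • b.repr (η j : E) i :=
    fun j i => hg _ (Finset.mem_image.2 ⟨(j, i), Finset.mem_univ _, rfl⟩)
  choose p hp using hg'
  set c : ℕ := Finset.univ.sup fun x : Fin (Module.finrank K W₀) × ι => (p x.1 x.2).totalDegree
  have hc : ∀ j i, (p j i).totalDegree ≤ c := fun j i =>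
    Finset.le_sup (f := fun x : Fin (Module.finrank K W₀) × ι => (p x.1 x.2).totalDegree)
      (Finset.mem_univ (j, i))
  let R (n : ℕ) : Submodule K (RatFun K e) := (MvPolynomial.restrictTotalDegree (Fin e) K n).map
    (IsScalarTower.toAlgHom K (MvPolynomial (Fin e) K) (RatFun K e)).toLinearMap
  let ψ : E →ₗ[K] (ι → RatFun K e) :=
    { toFun := fun v i => algebraMap (MvPolynomial (Fin e) K) (RatFun K e) g * b.repr v i
      map_add' := fun v w => by ext1 i; simp [mul_add]
      map_smul' := fun a v => by
        ext1 i
        rw [← algebraMap_smul (RatFun K e) a v, map_smul, Finsupp.smul_apply, algebraMap_smul,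
          mul_smul_comm]
        rfl }
  have hψ : Function.Injective ψ := by
    intro v w hvw
    apply b.repr.injective
    ext1 i
    have hg0 : algebraMap (MvPolynomial (Fin e) K) (RatFun K e) g ≠ 0 :=
      (IsLocalization.map_units (RatFun K e) g).ne_zero
    exact mul_left_cancel₀ hg0 (congrFun hvw i)
  have hW : ∀ w ∈ W₀, ∀ i, ψ w i ∈ R c := by
    intro w hw i
    have h := congrArg (fun y : W₀ => ψ y i) (η.sum_repr ⟨w, hw⟩)
    simp only [AddSubmonoidClass.coe_finsetSum, map_sum, Submodule.coe_smul, map_smul,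
      Finset.sum_apply, Pi.smul_apply] at h
    rw [← h]
    refine sum_mem fun j _ => Submodule.smul_mem _ _ ?_
    refine ⟨p j i, (MvPolynomial.mem_restrictTotalDegree _ _ _).2 (hc j i), ?_⟩
    exact (hp j i).trans (Algebra.smul_def _ _)
  refine ⟨c, fun n => ?_⟩
  obtain ⟨_, hfr⟩ := finrank_restrictTotalDegree_le (K := K) (e := e) (n + c)
  let Φ : (ι → MvPolynomial.restrictTotalDegree (Fin e) K (n + c)) →ₗ[K] (ι → RatFun K e) :=
    LinearMap.pi fun i => ((IsScalarTower.toAlgHom K (MvPolynomial (Fin e) K)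
      (RatFun K e)).toLinearMap.comp (Submodule.subtype _)).comp (LinearMap.proj i)
  have hle : (polyLE K e E n * W₀ : Submodule K E) ≤ (LinearMap.range Φ).comap ψ := by
    rw [Submodule.mul_le]
    intro x hx w hw
    obtain ⟨q, hq, rfl⟩ := mem_polyLE.1 hx
    choose r hr hr' using hW w hw
    refine ⟨fun i => ⟨q * r i, (MvPolynomial.mem_restrictTotalDegree _ _ _).2 ?_⟩, ?_⟩
    · exact (MvPolynomial.totalDegree_mul _ _).trans
        (add_le_add hq ((MvPolynomial.mem_restrictTotalDegree _ _ _).1 (hr i)))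
    · ext1 i
      change algebraMap _ (RatFun K e) (q * r i) =
        algebraMap (MvPolynomial (Fin e) K) (RatFun K e) g * b.repr (polyHom K e E q * w) i
      have h1 : algebraMap _ (RatFun K e) (r i) =
        algebraMap (MvPolynomial (Fin e) K) (RatFun K e) g * b.repr w i := hr' i
      rw [polyHom_apply, ← Algebra.smul_def (algebraMap _ (RatFun K e) q) w, map_smul, Finsupp.smul_apply, map_mul, h1,
        smul_eq_mul]
      ring
  have hle' := Submodule.map_le_iff_le_comap.2 hle
  have hfin : FiniteDimensional K ((polyLE K e E n * W₀ : Submodule K E).map ψ) :=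
    Submodule.finiteDimensional_of_le hle'
  have heq := (Submodule.equivMapOfInjective ψ hψ (polyLE K e E n * W₀ : Submodule K E))
  refine ⟨Module.Finite.equiv heq.symm, ?_⟩
  rw [heq.finrank_eq]
  refine (Submodule.finrank_mono hle').trans ((LinearMap.finrank_range_le Φ).trans ?_)
  rw [Module.finrank_pi_fintype, Finset.sum_const, Finset.card_univ, smul_eq_mul]
  exact Nat.mul_le_mul_left _ hfr

end PolyLE

/-! ### Averages over simplices of exponents -/

section Simplex

variable {e : ℕ}

theorem sum_simplexExp_prod_coeff {R : Type*} [CommRing R] (f : Fin (e + 1) → PowerSeries R)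
    (n : ℕ) : ∑ γ ∈ simplexExp e n, ∏ i, PowerSeries.coeff (γ i) (f i) =
      PowerSeries.coeff n (∏ i, f i) :=
  (PowerSeries.coeff_prod f n Finset.univ).symm

theorem card_simplexExp (e n : ℕ) : (simplexExp e n).card = (e + n).choose e := by
  have h := sum_simplexExp_prod_coeff (e := e) (fun _ => (PowerSeries.mk 1 : PowerSeries ℤ)) n
  rw [Finset.prod_const, Finset.card_univ, Fintype.card_fin, PowerSeries.mk_one_pow_eq_mk_choose_add]
    at h
  simp only [PowerSeries.coeff_mk, Pi.one_apply, Finset.prod_const_one, Finset.sum_const,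
    nsmul_eq_mul, mul_one] at h
  exact_mod_cast h

theorem card_simplexExp_pos (e n : ℕ) : 0 < (simplexExp e n).card := by
  rw [card_simplexExp]; exact Nat.choose_pos (by omega)

theorem add_mem_simplexExp {n m : ℕ} {α β : Fin (e + 1) →₀ ℕ} (hα : α ∈ simplexExp e n)
    (hβ : β ∈ simplexExp e m) : α + β ∈ simplexExp e (n + m) := by
  rw [mem_simplexExp] at *
  simp [Finset.sum_add_distrib, hα, hβ]

/-- Both sides are the coefficient of degree `m` in `∏ (1 - X)^{-(α i + 1)} = (1 - X)^{-(n + e +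
1)}`. The point is that the sum does not depend on `α`. -/
theorem sum_prod_choose_add {n m : ℕ} {α : Fin (e + 1) →₀ ℕ} (hα : α ∈ simplexExp e n) :
    ∑ β ∈ simplexExp e m, ∏ i, (α i + β i).choose (α i) = (n + e + m).choose (n + e) := by
  have h := sum_simplexExp_prod_coeff (e := e)
    (fun i => (PowerSeries.mk 1 : PowerSeries ℤ) ^ (α i + 1)) m
  rw [Finset.prod_pow_eq_pow_sum, Finset.sum_add_distrib, mem_simplexExp.1 hα] at h
  simp only [Finset.sum_const, Finset.card_univ, Fintype.card_fin, smul_eq_mul, mul_one] at h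
  rw [← add_assoc, PowerSeries.mk_one_pow_eq_mk_choose_add] at h
  simp only [PowerSeries.mk_one_pow_eq_mk_choose_add, PowerSeries.coeff_mk] at h
  exact_mod_cast h

/-- Vandermonde's identity, read off from `∏ (1 + X)^{γ i} = (1 + X)^m`. -/
theorem sum_prod_choose {n m : ℕ} {γ : Fin (e + 1) →₀ ℕ} (hγ : γ ∈ simplexExp e m) :
    ∑ α ∈ simplexExp e n, ∏ i, (γ i).choose (α i) = m.choose n := by
  have h := sum_simplexExp_prod_coeff (e := e)
    (fun i => (((1 + Polynomial.X) ^ (γ i) : Polynomial ℤ) : PowerSeries ℤ)) n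
  simp only [Polynomial.coe_pow] at h
  rw [Finset.prod_pow_eq_pow_sum, mem_simplexExp.1 hγ] at h
  simp only [← Polynomial.coe_pow, Polynomial.coeff_coe, Polynomial.coeff_one_add_X_pow] at h
  exact_mod_cast h

theorem sum_sum_prod_choose_mul (n m : ℕ) (ψ : (Fin (e + 1) →₀ ℕ) → ℝ) :
    ∑ α ∈ simplexExp e n, ∑ β ∈ simplexExp e m,
      ((∏ i, (α i + β i).choose (α i) : ℕ) : ℝ) * ψ (α + β) =
    ((n + m).choose n : ℝ) * ∑ γ ∈ simplexExp e (n + m), ψ γ := by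
  have h1 : ∀ α ∈ simplexExp e n, ∑ β ∈ simplexExp e m,
      ((∏ i, (α i + β i).choose (α i) : ℕ) : ℝ) * ψ (α + β) =
      ∑ γ ∈ simplexExp e (n + m), ((∏ i, (γ i).choose (α i) : ℕ) : ℝ) * ψ γ := by
    intro α hα
    refine Finset.sum_of_injOn (fun β => α + β) (fun _ _ _ _ h => add_left_cancel h)
      (fun β hβ => add_mem_simplexExp hα hβ) ?_ (fun β _ => by simp)
    intro γ hγ hγ'
    have : ∃ i, γ i < α i := by
      by_contra! hcon
      refine hγ' ⟨γ - α, ?_, ?_⟩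
      · rw [mem_simplexExp] at hα hγ
        rw [Finset.mem_coe, mem_simplexExp]
        simp only [Finsupp.coe_tsub, Pi.sub_apply]
        rw [Finset.sum_tsub_distrib _ (fun i _ => hcon i)]
        omega
      · exact add_tsub_cancel_of_le hcon
    obtain ⟨i, hi⟩ := this
    rw [Finset.prod_eq_zero (Finset.mem_univ i) (Nat.choose_eq_zero_of_lt hi), Nat.cast_zero,
      zero_mul]
  rw [Finset.sum_congr rfl h1, Finset.sum_comm, Finset.mul_sum]
  refine Finset.sum_congr rfl fun γ hγ => ?_
  rw [← Finset.sum_mul, ← Nat.cast_sum, sum_prod_choose hγ]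

/-- The mean of a superadditive family of functions on the simplices of exponents is
superadditive. -/
theorem mean_add_le_mean {n m : ℕ} {φ₁ φ₂ φ₃ : (Fin (e + 1) →₀ ℕ) → ℝ}
    (h : ∀ α ∈ simplexExp e n, ∀ β ∈ simplexExp e m, φ₁ α + φ₂ β ≤ φ₃ (α + β)) :
    (∑ α ∈ simplexExp e n, φ₁ α) / (simplexExp e n).card +
      (∑ β ∈ simplexExp e m, φ₂ β) / (simplexExp e m).card ≤
      (∑ γ ∈ simplexExp e (n + m), φ₃ γ) / (simplexExp e (n + m)).card := by
  -- Up to normalization, these weights are a joint law of `(α, β)` under which `α`, `β` and `α + β`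
  -- are each uniform on their simplices. Averaging the hypothesis against it compares the three
  -- means.
  set w : (Fin (e + 1) →₀ ℕ) → (Fin (e + 1) →₀ ℕ) → ℝ :=
    fun α β => ((∏ i, (α i + β i).choose (α i) : ℕ) : ℝ) with hw
  have h1 : ∑ α ∈ simplexExp e n, ∑ β ∈ simplexExp e m, w α β * (φ₁ α + φ₂ β) ≤
      ((n + m).choose n : ℝ) * ∑ γ ∈ simplexExp e (n + m), φ₃ γ := by
    rw [← sum_sum_prod_choose_mul]
    exact Finset.sum_le_sum fun α hα => Finset.sum_le_sum fun β hβ =>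
      mul_le_mul_of_nonneg_left (h α hα β hβ) (Nat.cast_nonneg _)
  have h2 : ∑ α ∈ simplexExp e n, ∑ β ∈ simplexExp e m, w α β * (φ₁ α + φ₂ β) =
      ((n + e + m).choose (n + e) : ℝ) * ∑ α ∈ simplexExp e n, φ₁ α +
      ((m + e + n).choose (m + e) : ℝ) * ∑ β ∈ simplexExp e m, φ₂ β := by
    simp only [mul_add, Finset.sum_add_distrib]
    congr 1
    · rw [Finset.mul_sum]
      refine Finset.sum_congr rfl fun α hα => ?_
      rw [← Finset.sum_mul, ← Nat.cast_sum, sum_prod_choose_add hα]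
    · rw [Finset.sum_comm, Finset.mul_sum]
      refine Finset.sum_congr rfl fun β hβ => ?_
      rw [← Finset.sum_mul, ← Nat.cast_sum, ← sum_prod_choose_add hβ]
      congr 3
      ext α
      refine Finset.prod_congr rfl fun i _ => ?_
      rw [add_comm, Nat.choose_symm_add]
  rw [h2] at h1
  -- The total mass of the weights, computed from the marginal on `α` and from the marginal on `α +
  -- β`.
  have key : ∀ n m : ℕ, ((e + n).choose e : ℝ) * ((n + e + m).choose (n + e) : ℝ) =
      ((e + (n + m)).choose e : ℝ) * ((n + m).choose n : ℝ) := by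
    intro n m
    have := Nat.choose_mul (n := n + e + m) (k := n + e) (s := e) (by omega)
    rw [show n + e + m - e = n + m by omega, show n + e - e = n by omega,
      show n + e + m = e + (n + m) by omega, show n + e = e + n by omega] at this
    rw [show n + e + m = e + (n + m) by omega, show n + e = e + n by omega]
    rw [mul_comm]
    exact_mod_cast this
  have k1 := key n m
  have k2 := key m n
  rw [show m + n = n + m by omega, show (n + m).choose m = (n + m).choose n from
    (Nat.choose_symm_add).symm] at k2
  simp only [card_simplexExp]
  have p1 : (0 : ℝ) < ((e + n).choose e : ℝ) := by exact_mod_cast Nat.choose_pos (by omega)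
  have p2 : (0 : ℝ) < ((e + m).choose e : ℝ) := by exact_mod_cast Nat.choose_pos (by omega)
  have p3 : (0 : ℝ) < ((e + (n + m)).choose e : ℝ) := by exact_mod_cast Nat.choose_pos (by omega)
  have p4 : (0 : ℝ) < ((n + m).choose n : ℝ) := by exact_mod_cast Nat.choose_pos (by omega)
  have p5 : (0 : ℝ) < ((n + e + m).choose (n + e) : ℝ) := by
    exact_mod_cast Nat.choose_pos (by omega)
  have p6 : (0 : ℝ) < ((m + e + n).choose (m + e) : ℝ) := by
    exact_mod_cast Nat.choose_pos (by omega)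
  rw [← mul_div_mul_left _ _ p5.ne', mul_comm _ ((e + n).choose e : ℝ), k1,
    ← mul_div_mul_left (∑ β ∈ simplexExp e m, φ₂ β) _ p6.ne', mul_comm _ ((e + m).choose e : ℝ),
    k2, ← add_div, ← mul_div_mul_left (∑ γ ∈ simplexExp e (n + m), φ₃ γ) _ p4.ne',
    mul_comm ((n + m).choose n : ℝ) ((e + (n + m)).choose e : ℝ)]
  gcongr

end Simplex

/-- A variant of Fekete's lemma for sequences which are superadditive up to small errors. -/
theorem exists_tendsto_div_of_superadditive {a b : ℕ → ℝ} {n₀ : ℕ} (hn₀ : 0 < n₀)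
    (hab : ∀ p ≥ n₀, ∀ s ≥ n₀, ∀ q : ℕ, q * b p + b s ≤ a (q * p + s))
    (hdiff : Tendsto (fun n : ℕ => (a n - b n) / n) atTop (𝓝 0)) {M : ℝ}
    (hM : ∀ᶠ n : ℕ in atTop, a n ≤ M * n) :
    ∃ l : ℝ, Tendsto (fun n : ℕ => a n / n) atTop (𝓝 l) := by
  -- Write `n = q p + s` with `n₀ ≤ s < n₀ + p`. The remainder takes finitely many values, so its
  -- contribution is bounded and the lower limit of `a n / n` is at least `b p / p`.
  have low : ∀ p ≥ n₀, ∀ x < b p / p, ∀ᶠ n : ℕ in atTop, x < a n / n := by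
    intro p hp x hx
    have hp0 : (0 : ℝ) < p := by exact_mod_cast lt_of_lt_of_le hn₀ hp
    obtain ⟨C, hC⟩ : ∃ C : ℝ, ∀ s ∈ Finset.Ico n₀ (n₀ + p), C ≤ b s - s * (b p / p) := by
      obtain ⟨C, hC⟩ := ((Finset.Ico n₀ (n₀ + p)).image
        fun s : ℕ => b s - s * (b p / p)).finite_toSet.bddBelow
      exact ⟨C, fun s hs => hC (Finset.mem_coe.2 (Finset.mem_image_of_mem _ hs))⟩
    have h1 : Tendsto (fun n : ℕ => (n : ℝ) * (b p / p - x) + C) atTop atTop :=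
      tendsto_atTop_add_const_right _ _
        (tendsto_natCast_atTop_atTop.atTop_mul_const (sub_pos.2 hx))
    filter_upwards [eventually_ge_atTop n₀, h1.eventually_gt_atTop 0] with n hn hn'
    have hnpos : (0 : ℝ) < n := by exact_mod_cast lt_of_lt_of_le hn₀ hn
    have hmod := Nat.mod_lt (n - n₀) (lt_of_lt_of_le hn₀ hp)
    have hdm := Nat.div_add_mod (n - n₀) p
    set q := (n - n₀) / p
    set s := n₀ + (n - n₀) % p
    have hqs : q * p + s = n := by rw [mul_comm]; omega
    have h2 := hab p hp s (by omega) q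
    have h3 := hC s (Finset.mem_Ico.2 ⟨by omega, by omega⟩)
    rw [hqs] at h2
    have h4 : (q : ℝ) * p + s = n := by exact_mod_cast hqs
    rw [lt_div_iff₀ hnpos]
    have h5 : (q : ℝ) * b p = (q * p) * (b p / p) := by field_simp
    rw [← h4] at hn' ⊢
    nlinarith
  have hbM : ∀ p ≥ n₀, b p / p ≤ M := by
    intro p hp
    by_contra! hcon
    obtain ⟨n, h1, h2, h3⟩ := ((low p hp M hcon).and
      (hM.and (eventually_ge_atTop n₀))).exists
    have hnpos : (0 : ℝ) < n := by exact_mod_cast lt_of_lt_of_le hn₀ h3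
    rw [lt_div_iff₀ hnpos] at h1
    linarith
  set S : Set ℝ := (fun p : ℕ => b p / p) '' Set.Ici n₀
  have hne : S.Nonempty := ⟨_, n₀, Set.mem_Ici.2 le_rfl, rfl⟩
  have hbdd : BddAbove S := ⟨M, by rintro _ ⟨p, hp, rfl⟩; exact hbM p hp⟩
  -- The limit is the supremum of `b p / p`; the upper bound for `a` comes from `a - b = o(n)`.
  refine ⟨sSup S, tendsto_order.2 ⟨fun x hx => ?_, fun x hx => ?_⟩⟩
  · obtain ⟨_, ⟨p, hp, rfl⟩, hxp⟩ := exists_lt_of_lt_csSup hne hx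
    exact low p hp x hxp
  · filter_upwards [eventually_ge_atTop n₀,
      (tendsto_order.1 hdiff).2 (x - sSup S) (sub_pos.2 hx)] with n hn hn'
    have h1 : b n / n ≤ sSup S := le_csSup hbdd ⟨n, hn, rfl⟩
    rw [sub_div] at hn'
    linarith

/-! ### Subexponential growth of the number of exponents -/

section Growth

theorem tendsto_card_simplexExp_add (e c : ℕ) :
    Tendsto (fun n => ((simplexExp e (n + c)).card : ℝ) / (simplexExp e n).card) atTop (𝓝 1) := by
  have h1 : Tendsto (fun n => ((simplexExp e (n + 1)).card : ℝ) / (simplexExp e n).card) atTop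
      (𝓝 1) := by
    have : (fun n : ℕ => ((simplexExp e (n + 1)).card : ℝ) / (simplexExp e n).card) =
        fun n : ℕ => 1 + (e : ℝ) / ((n : ℝ) + 1) := by
      ext n
      have hp : (0 : ℝ) < (simplexExp e n).card := by exact_mod_cast card_simplexExp_pos e n
      have h := Nat.add_one_mul_choose_eq (e + n) n
      have h' : ((e + n + 1 : ℕ) : ℝ) * (simplexExp e n).card =
          (simplexExp e (n + 1)).card * ((n + 1 : ℕ) : ℝ) := by
        rw [card_simplexExp, card_simplexExp, Nat.choose_symm_add, Nat.choose_symm_add]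
        exact_mod_cast h
      have hn : (0 : ℝ) < (n : ℝ) + 1 := by positivity
      push_cast at h'
      field_simp
      linarith
    rw [this]
    have := (tendsto_const_nhds (x := (e : ℝ)) (f := atTop (α := ℕ))).div_atTop
      (tendsto_atTop_add_const_right _ 1 tendsto_natCast_atTop_atTop)
    simpa using this.const_add 1
  induction c with
  | zero =>
    refine tendsto_const_nhds.congr fun n => ?_
    rw [add_zero, div_self]
    exact_mod_cast (card_simplexExp_pos e n).ne'
  | succ c ih =>
    have := (h1.comp (tendsto_add_atTop_nat c)).mul ih
    rw [one_mul] at this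
    refine this.congr fun n => ?_
    have hp : ((simplexExp e (n + c)).card : ℝ) ≠ 0 := by
      exact_mod_cast (card_simplexExp_pos e (n + c)).ne'
    simp only [Function.comp_apply]
    rw [div_mul_div_cancel₀ hp]
    rfl

end Growth

/-! ### Dimensions of modules over the polynomial ring -/

section Model

variable {K : Type*} [Field K] {e : ℕ} {E : Type*} [CommRing E]
  [Algebra (RatFun K e) E] [Algebra K E] [IsScalarTower K (RatFun K e) E]

/-- A sequence of subspaces which behaves like the graded pieces, dehomogenized, of a graded
module generated in degrees at most `m₀` over the polynomial ring. -/
structure IsPolyModule (W : ℕ → Submodule K E) (m₀ : ℕ) : Prop where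
  one_mem : 1 ∈ W 0
  mul_mem : ∀ {m n : ℕ} {x y : E}, x ∈ polyLE K e E m → y ∈ W n → x * y ∈ W (m + n)
  finite : FiniteDimensional K (W m₀)
  span_eq_top : Submodule.span (RatFun K e) (W m₀ : Set E) = ⊤
  le_mul : ∀ n, W n ≤ polyLE K e E n * W m₀

namespace IsPolyModule

variable {W : ℕ → Submodule K E} {m₀ : ℕ}

theorem polyLE_le (h : IsPolyModule (e := e) W m₀) (n : ℕ) : polyLE K e E n ≤ W n := by
  intro x hx
  rw [← mul_one x]
  exact h.mul_mem hx h.one_mem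

theorem lead_eq_top (h : IsPolyModule (e := e) W m₀) {ι : Type*} [Fintype ι]
    (b : Module.Basis ι (RatFun K e) E) {n : ℕ} {α : Fin e →₀ ℕ} (hα : α.degree ≤ n) :
    lead b (W (n + m₀)) α = ⊤ :=
  _root_.lead_eq_top b h.span_eq_top (fun _ hx _ hy => h.mul_mem hx hy) hα

theorem one_mem_lead (h : IsPolyModule (e := e) W m₀) {ι : Type*} [Fintype ι]
    (b : Module.Basis ι (RatFun K e) E) {n : ℕ} {α : Fin e →₀ ℕ} (hα : α.degree ≤ n) :
    1 ∈ lead b (W n) α :=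
  lead_mono b (h.polyLE_le n) α (one_mem_lead_polyLE b n α hα)

theorem finiteDimensional (h : IsPolyModule (e := e) W m₀) : FiniteDimensional (RatFun K e) E := by
  have := h.finite
  obtain ⟨h1, -⟩ := finiteDimensional_span_image (k := RatFun K e) (LinearMap.id : E →ₗ[K] E) (W m₀)
  rw [LinearMap.id_coe, image_id] at h1
  rw [h.span_eq_top] at h1
  exact Module.Finite.equiv (Submodule.topEquiv)

end IsPolyModule

/-- Forgetting coordinate `0` identifies `simplexExp e n` with the exponents in `e` variables of
degree at most `n`. This passes between the symmetric form used for averages and the affine form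
used for expansions. -/
theorem degree_tail_le {n : ℕ} {γ : Fin (e + 1) →₀ ℕ} (h : γ ∈ simplexExp e n) :
    γ.tail.degree ≤ n := by
  rw [mem_simplexExp, Fin.sum_univ_succ] at h
  rw [Finsupp.degree_eq_sum]
  simp only [Finsupp.tail_apply]
  omega

theorem tail_injOn_simplexExp (e n : ℕ) : Set.InjOn Finsupp.tail (simplexExp e n : Set (Fin (e + 1) →₀ ℕ)) := by
  intro γ hγ γ' hγ' h
  rw [Finset.mem_coe, mem_simplexExp, Fin.sum_univ_succ] at hγ hγ'
  have h1 : ∀ i : Fin e, γ i.succ = γ' i.succ := fun i => DFunLike.congr_fun h i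
  rw [← Finsupp.cons_tail γ, ← Finsupp.cons_tail γ', h]
  simp only [h1] at hγ
  congr 1
  omega

theorem image_tail_subset (e n c : ℕ) :
    (simplexExp e n).image Finsupp.tail ⊆ (simplexExp e (n + c)).image Finsupp.tail := by
  intro α hα
  obtain ⟨γ, hγ, rfl⟩ := Finset.mem_image.1 hα
  refine Finset.mem_image.2 ⟨Finsupp.cons (γ 0 + c) γ.tail, ?_, Finsupp.tail_cons _ _⟩
  rw [mem_simplexExp, Fin.sum_univ_succ] at *
  simp only [Finsupp.cons_zero, Finsupp.cons_succ, Finsupp.tail_apply]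
  omega

namespace IsPolyModule

variable {W : ℕ → Submodule K E} {m₀ : ℕ}

variable {ι : Type*} [Fintype ι]

theorem exists_finrank_le (h : IsPolyModule (e := e) W m₀) : ∃ c : ℕ,
    ∀ n, FiniteDimensional K (W n) ∧ Module.finrank K (W n) ≤
      Module.finrank (RatFun K e) E * (simplexExp e (n + c)).card := by
  have := h.finite
  have := h.finiteDimensional
  obtain ⟨c, hc⟩ := exists_finrank_polyLE_mul_le (Module.finBasis (RatFun K e) E) (W m₀)
  refine ⟨c, fun n => ?_⟩
  have := (hc n).1
  refine ⟨Submodule.finiteDimensional_of_le (h.le_mul n), ?_⟩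
  exact (Submodule.finrank_mono (h.le_mul n)).trans ((hc n).2.trans_eq (by rw [Fintype.card_fin]))

theorem finiteDimensional_apply (h : IsPolyModule (e := e) W m₀) (n : ℕ) :
    FiniteDimensional K (W n) := (h.exists_finrank_le.choose_spec n).1

/-- Every exponent of degree at most `n` has the whole of `E` as leading space in degree `n + m₀`.
-/
theorem le_sum_finrank_lead (h : IsPolyModule (e := e) W m₀) (b : Module.Basis ι (RatFun K e) E)
    (n : ℕ) : Module.finrank (RatFun K e) E * (simplexExp e n).card ≤
      ∑ γ ∈ simplexExp e (n + m₀), Module.finrank (RatFun K e) (lead b (W (n + m₀)) γ.tail) := by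
  classical
  rw [← Finset.sum_image (tail_injOn_simplexExp e (n + m₀))
    (f := fun α => Module.finrank (RatFun K e) (lead b (W (n + m₀)) α))]
  refine le_trans ?_ (Finset.sum_le_sum_of_subset (image_tail_subset e n m₀))
  rw [Finset.sum_image (tail_injOn_simplexExp e n)]
  rw [Finset.sum_congr rfl (fun γ hγ => by rw [h.lead_eq_top b (degree_tail_le hγ), finrank_top])]
  rw [Finset.sum_const, smul_eq_mul, mul_comm]

theorem finrank_pos [Nontrivial E] (h : IsPolyModule (e := e) W m₀) :
    0 < Module.finrank (RatFun K e) E := by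
  have := h.finiteDimensional
  exact Module.finrank_pos

theorem sum_simplexExp_finrank_lead_le (b : Module.Basis ι (RatFun K e) E) {U V : Submodule K E}
    [FiniteDimensional K V] (hUV : U ≤ V) (n : ℕ) :
    Module.finrank K U + ∑ γ ∈ simplexExp e n, Module.finrank (RatFun K e) (lead b V γ.tail) ≤
      Module.finrank K V +
        ∑ γ ∈ simplexExp e n, Module.finrank (RatFun K e) (lead b U γ.tail) := by
  classical
  have := sum_finrank_lead_le b hUV ((simplexExp e n).image Finsupp.tail)
  rwa [Finset.sum_image (tail_injOn_simplexExp e n), Finset.sum_image (tail_injOn_simplexExp e n)]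
    at this

theorem sum_simplexExp_finrank_lead_le_finrank (b : Module.Basis ι (RatFun K e) E)
    (V : Submodule K E) [FiniteDimensional K V] (n : ℕ) :
    ∑ γ ∈ simplexExp e n, Module.finrank (RatFun K e) (lead b V γ.tail) ≤ Module.finrank K V := by
  have := sum_simplexExp_finrank_lead_le b (U := ⊥) (V := V) bot_le n
  have h0 : ∑ γ ∈ simplexExp e n,
      Module.finrank (RatFun K e) (lead b (⊥ : Submodule K E) γ.tail) = 0 :=
    Finset.sum_eq_zero fun γ _ => by
      have h1 : lead b (⊥ : Submodule K E) γ.tail = ⊥ := lead_bot b _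
      rw [h1, finrank_bot]
  rw [h0, finrank_bot, zero_add, add_zero] at this
  exact this

theorem finrank_lower (h : IsPolyModule (e := e) W m₀) (n : ℕ) :
    Module.finrank (RatFun K e) E * (simplexExp e n).card ≤ Module.finrank K (W (n + m₀)) := by
  have := h.finiteDimensional_apply (n + m₀)
  have := h.finiteDimensional
  exact (h.le_sum_finrank_lead (Module.finBasis (RatFun K e) E) n).trans
    (sum_simplexExp_finrank_lead_le_finrank _ _ _)

/-- Exponents with full leading space bound the dimension below; clearing denominators bounds it
above. The two bounds differ by a bounded shift of the degree, which the simplex count does not feel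
asymptotically. -/
theorem tendsto_finrank [Nontrivial E] (h : IsPolyModule (e := e) W m₀) :
    Tendsto (fun n => (Module.finrank K (W n) : ℝ) /
      (Module.finrank (RatFun K e) E * (simplexExp e n).card)) atTop (𝓝 1) := by
  obtain ⟨c, h2⟩ := h.exists_finrank_le
  have hr : (0 : ℝ) < Module.finrank (RatFun K e) E := by exact_mod_cast h.finrank_pos
  have hd : ∀ n, (0 : ℝ) < (simplexExp e n).card := fun n => by
    exact_mod_cast card_simplexExp_pos e n
  rw [← tendsto_add_atTop_iff_nat m₀]
  have hlow := (tendsto_card_simplexExp_add e m₀).inv₀ one_ne_zero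
  have hup := (tendsto_card_simplexExp_add e c).comp (tendsto_add_atTop_nat m₀)
  rw [inv_one] at hlow
  refine tendsto_of_tendsto_of_tendsto_of_le_of_le hlow hup (fun n => ?_) (fun n => ?_)
  · have h3 : (Module.finrank (RatFun K e) E : ℝ) * (simplexExp e n).card ≤
      Module.finrank K (W (n + m₀)) := by exact_mod_cast h.finrank_lower n
    simp only [inv_div]
    rw [div_le_div_iff₀ (hd _) (mul_pos hr (hd _))]
    nlinarith [hd (n + m₀)]
  · have h3 : (Module.finrank K (W (n + m₀)) : ℝ) ≤
        Module.finrank (RatFun K e) E * (simplexExp e (n + m₀ + c)).card := by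
      exact_mod_cast (h2 (n + m₀)).2
    simp only [Function.comp_apply]
    rw [div_le_div_iff₀ (mul_pos hr (hd _)) (hd _)]
    nlinarith [hd (n + m₀)]

end IsPolyModule

end Model

theorem intervalIntegral_indicator_Iic {δ T : ℝ} (h0 : 0 ≤ δ) (hT : δ ≤ T) (c : ℝ) :
    ∫ s in (0 : ℝ)..T, {s | s ≤ δ}.indicator (fun _ => c) s = c * δ := by
  rw [intervalIntegral.integral_indicator ⟨h0, hT⟩]
  simp [mul_comm]

theorem intervalIntegrable_indicator_Iic (δ T c : ℝ) :
    IntervalIntegrable ({s : ℝ | s ≤ δ}.indicator fun _ => c) volume 0 T :=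
  ⟨(intervalIntegrable_const (c := c)).1.indicator measurableSet_Iic,
    (intervalIntegrable_const (c := c)).2.indicator measurableSet_Iic⟩

theorem intervalIntegral_sum_indicator_Iic {κ : Type*} (S : Finset κ) {δ : κ → ℝ} {T : ℝ}
    (h0 : ∀ i ∈ S, 0 ≤ δ i) (hT : ∀ i ∈ S, δ i ≤ T) (c : ℝ) :
    IntervalIntegrable (fun t => ∑ i ∈ S, {s | s ≤ δ i}.indicator (fun _ => c) t) volume 0 T ∧
    ∫ t in (0 : ℝ)..T, ∑ i ∈ S, {s | s ≤ δ i}.indicator (fun _ => c) t = c * ∑ i ∈ S, δ i := by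
  have h : ∀ i ∈ S, IntervalIntegrable ({s | s ≤ δ i}.indicator fun _ => c) volume 0 T :=
    fun i _ => intervalIntegrable_indicator_Iic _ _ _
  refine ⟨?_, ?_⟩
  · have := IntervalIntegrable.sum S h
    refine this.congr fun t _ => ?_
    simp
  · rw [intervalIntegral.integral_finsetSum h, Finset.mul_sum]
    exact Finset.sum_congr rfl fun i hi => intervalIntegral_indicator_Iic (h0 i hi) (hT i hi) c

/-! ### Convergence of the mean index of a multiplicative filtration -/

section Core

variable {K : Type*} [Field K] {e : ℕ} {E : Type*} [CommRing E]
  [Algebra (RatFun K e) E] [Algebra K E] [IsScalarTower K (RatFun K e) E]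

/-- A multiplicative decreasing filtration of a sequence of subspaces of an algebra, in
degrees at least `n₀`, with indices in `[0, M n]`. -/
structure IsMulFiltration (W : ℕ → Submodule K E) (F : ℕ → ℝ → Submodule K E) (n₀ : ℕ)
    (M : ℝ) : Prop where
  antitone : ∀ n, Antitone (F n)
  le : ∀ n s, F n s ≤ W n
  eq_of_nonpos : ∀ n ≥ n₀, ∀ s ≤ 0, F n s = W n
  eq_bot : ∀ n ≥ n₀, ∀ s > M * n, F n s = ⊥
  mul_mem : ∀ m ≥ n₀, ∀ n ≥ n₀, ∀ s t : ℝ, ∀ x ∈ F m s, ∀ y ∈ F n t, x * y ∈ F (m + n) (s + t)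

variable {ι : Type*} [Fintype ι]

/-- The largest index at which an exponent is a leading exponent. -/
noncomputable def leadIndex (b : Module.Basis ι (RatFun K e) E) (F : ℝ → Submodule K E)
    (α : Fin e →₀ ℕ) : ℝ := sSup {s | lead b (F s) α ≠ ⊥}

namespace IsMulFiltration

variable {W : ℕ → Submodule K E} {m₀ : ℕ} {F : ℕ → ℝ → Submodule K E} {n₀ : ℕ} {M : ℝ}

theorem intervalIntegrable (hF : IsMulFiltration W F n₀ M) (hW : ∀ n, FiniteDimensional K (W n))
    (n : ℕ) (a c : ℝ) :
    IntervalIntegrable (fun s => (Module.finrank K (F n s) : ℝ)) volume a c := by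
  refine Antitone.intervalIntegrable fun s t hst => ?_
  have := hW n
  have : FiniteDimensional K (F n s) := Submodule.finiteDimensional_of_le (hF.le n s)
  exact_mod_cast Submodule.finrank_mono (hF.antitone n hst)

theorem bddAbove (hF : IsMulFiltration W F n₀ M) (b : Module.Basis ι (RatFun K e) E) {n : ℕ}
    (hn : n₀ ≤ n) (α : Fin e →₀ ℕ) : BddAbove {s | lead b (F n s) α ≠ ⊥} := by
  refine ⟨M * n, fun s hs => ?_⟩
  by_contra! hcon
  refine hs ?_
  rw [hF.eq_bot n hn s hcon]
  exact lead_bot b α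

theorem lead_eq_bot_of_lt (hF : IsMulFiltration W F n₀ M) (b : Module.Basis ι (RatFun K e) E)
    {n : ℕ} (hn : n₀ ≤ n) {α : Fin e →₀ ℕ} {s : ℝ} (hs : leadIndex b (F n) α < s) :
    lead b (F n s) α = ⊥ := by
  by_contra h
  exact absurd (le_csSup (hF.bddAbove b hn α) h) (not_le.2 hs)

variable [IsDomain E]

theorem zero_mem (hF : IsMulFiltration W F n₀ M) (h : IsPolyModule (e := e) W m₀)
    (b : Module.Basis ι (RatFun K e) E) {n : ℕ} (hn : n₀ ≤ n) {α : Fin e →₀ ℕ}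
    (hα : α.degree ≤ n) : lead b (F n 0) α ≠ ⊥ := by
  rw [hF.eq_of_nonpos n hn 0 le_rfl, Submodule.ne_bot_iff]
  exact ⟨1, h.one_mem_lead b hα, one_ne_zero⟩

theorem lead_ne_bot_of_lt (hF : IsMulFiltration W F n₀ M) (h : IsPolyModule (e := e) W m₀)
    (b : Module.Basis ι (RatFun K e) E) {n : ℕ} (hn : n₀ ≤ n) {α : Fin e →₀ ℕ}
    (hα : α.degree ≤ n) {s : ℝ} (hs : s < leadIndex b (F n) α) : lead b (F n s) α ≠ ⊥ := by
  obtain ⟨t, ht, hst⟩ := exists_lt_of_lt_csSup ⟨0, hF.zero_mem h b hn hα⟩ hs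
  intro hbot
  exact ht (le_bot_iff.1 (hbot ▸ lead_mono b (hF.antitone n hst.le) α))

theorem leadIndex_nonneg (hF : IsMulFiltration W F n₀ M) (h : IsPolyModule (e := e) W m₀)
    (b : Module.Basis ι (RatFun K e) E) {n : ℕ} (hn : n₀ ≤ n) {α : Fin e →₀ ℕ}
    (hα : α.degree ≤ n) : 0 ≤ leadIndex b (F n) α :=
  le_csSup (hF.bddAbove b hn α) (hF.zero_mem h b hn hα)

theorem leadIndex_le (hF : IsMulFiltration W F n₀ M) (h : IsPolyModule (e := e) W m₀)
    (b : Module.Basis ι (RatFun K e) E) {n : ℕ} (hn : n₀ ≤ n) {α : Fin e →₀ ℕ}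
    (hα : α.degree ≤ n) : leadIndex b (F n) α ≤ M * n := by
  refine csSup_le ⟨0, hF.zero_mem h b hn hα⟩ fun s hs => ?_
  by_contra! hcon
  refine hs ?_
  rw [hF.eq_bot n hn s hcon]
  exact lead_bot b α

/-- Nonzero leading coefficients of exponents `α` and `β` have a product of exponent `α + β`,
nonzero because `E` is a domain. -/
theorem leadIndex_add_le (hF : IsMulFiltration W F n₀ M) (h : IsPolyModule (e := e) W m₀)
    (b : Module.Basis ι (RatFun K e) E) {m n : ℕ} (hm : n₀ ≤ m) (hn : n₀ ≤ n)
    {α β : Fin e →₀ ℕ} (hα : α.degree ≤ m) (hβ : β.degree ≤ n) :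
    leadIndex b (F m) α + leadIndex b (F n) β ≤ leadIndex b (F (m + n)) (α + β) := by
  refine le_of_forall_lt fun x hx => ?_
  -- The suprema need not be attained: backing off by `d` twice still leaves a sum above `x`.
  set d := (leadIndex b (F m) α + leadIndex b (F n) β - x) / 3 with hd
  have hd0 : 0 < d := by rw [hd]; linarith
  obtain ⟨u, hu, hu0⟩ := Submodule.exists_mem_ne_zero_of_ne_bot
    (hF.lead_ne_bot_of_lt h b hm hα (sub_lt_self (leadIndex b (F m) α) hd0))
  obtain ⟨v, hv, hv0⟩ := Submodule.exists_mem_ne_zero_of_ne_bot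
    (hF.lead_ne_bot_of_lt h b hn hβ (sub_lt_self (leadIndex b (F n) β) hd0))
  have huv := mul_mem_lead b (hF.mul_mem m hm n hn _ _) hu hv
  have := le_csSup (hF.bddAbove b (hm.trans (Nat.le_add_right m n)) (α + β))
    (show lead b (F (m + n) (leadIndex b (F m) α - d + (leadIndex b (F n) β - d))) (α + β) ≠ ⊥ from
      (Submodule.ne_bot_iff _).2 ⟨_, huv, mul_ne_zero hu0 hv0⟩)
  refine lt_of_lt_of_le ?_ this
  linarith

/-- The mean of the indices of the exponents. -/
noncomputable def meanIndex (b : Module.Basis ι (RatFun K e) E) (F : ℕ → ℝ → Submodule K E)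
    (n : ℕ) : ℝ :=
  (∑ γ ∈ simplexExp e n, leadIndex b (F n) γ.tail) / (simplexExp e n).card

theorem meanIndex_add_le (hF : IsMulFiltration W F n₀ M) (h : IsPolyModule (e := e) W m₀)
    (b : Module.Basis ι (RatFun K e) E) {m n : ℕ} (hm : n₀ ≤ m) (hn : n₀ ≤ n) :
    meanIndex b F m + meanIndex b F n ≤ meanIndex b F (m + n) := by
  refine mean_add_le_mean fun α hα β hβ => ?_
  have htail : (α + β).tail = α.tail + β.tail := by ext i; rfl
  rw [htail]
  exact hF.leadIndex_add_le h b hm hn (degree_tail_le hα) (degree_tail_le hβ)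

theorem meanIndex_le (hF : IsMulFiltration W F n₀ M) (h : IsPolyModule (e := e) W m₀)
    (b : Module.Basis ι (RatFun K e) E) {n : ℕ} (hn : n₀ ≤ n) : meanIndex b F n ≤ M * n := by
  have hp : (0 : ℝ) < (simplexExp e n).card := by exact_mod_cast card_simplexExp_pos e n
  rw [meanIndex, div_le_iff₀ hp, mul_comm, ← nsmul_eq_mul]
  exact Finset.sum_le_card_nsmul _ _ _ fun γ hγ => hF.leadIndex_le h b hn (degree_tail_le hγ)

theorem exists_tendsto_meanIndex (hF : IsMulFiltration W F n₀ M)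
    (h : IsPolyModule (e := e) W m₀) (b : Module.Basis ι (RatFun K e) E) :
    ∃ l : ℝ, Tendsto (fun n : ℕ => meanIndex b F n / n) atTop (𝓝 l) := by
  refine exists_tendsto_div_of_superadditive (b := meanIndex b F) (n₀ := n₀ + 1) (M := M)
    (Nat.succ_pos _) (fun p hp s hs q => ?_) (by simp) ?_
  · induction q with
    | zero => simp
    | succ q ih =>
      have := hF.meanIndex_add_le h b (m := p) (n := q * p + s) (by omega) (by
        have := Nat.zero_le (q * p); omega)
      rw [show p + (q * p + s) = (q + 1) * p + s by ring] at this
      push_cast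
      linarith
  · filter_upwards [eventually_ge_atTop n₀] with n hn using hF.meanIndex_le h b hn

/-- At level `s` only exponents of index at least `s` have a nonzero leading space, of dimension at
most `r`. What they miss is at most the defect `η` of the whole space. Integrating in `s` turns the
count of exponents into the sum of their indices. -/
theorem integral_le (hF : IsMulFiltration W F n₀ M) (h : IsPolyModule (e := e) W m₀)
    (b : Module.Basis ι (RatFun K e) E) {n : ℕ} (hn : n₀ ≤ n + m₀) (hM : 0 ≤ M) :
    ∫ s in (0 : ℝ)..M * (n + m₀ : ℕ), (Module.finrank K (F (n + m₀) s) : ℝ) ≤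
      Module.finrank (RatFun K e) E * (simplexExp e (n + m₀)).card * meanIndex b F (n + m₀) +
      M * (n + m₀ : ℕ) * (Module.finrank K (W (n + m₀)) -
        Module.finrank (RatFun K e) E * (simplexExp e n).card) := by
  have := h.finiteDimensional
  set N := n + m₀ with hN
  set r : ℕ := Module.finrank (RatFun K e) E with hr
  have hWN := h.finiteDimensional_apply N
  set η : ℝ := Module.finrank K (W N) - r * (simplexExp e n).card with hη
  have hT : 0 ≤ M * (N : ℝ) := by positivity
  have hp : (0 : ℝ) < (simplexExp e N).card := by exact_mod_cast card_simplexExp_pos e N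
  have key : ∀ s, (Module.finrank K (F N s) : ℝ) ≤ (∑ γ ∈ simplexExp e N,
      {s | s ≤ leadIndex b (F N) γ.tail}.indicator (fun _ => (r : ℝ)) s) + η := by
    intro s
    have h1 := IsPolyModule.sum_simplexExp_finrank_lead_le b (hF.le N s) N
    have h2 := h.le_sum_finrank_lead b n
    have h3 : ∀ γ ∈ simplexExp e N, (Module.finrank (RatFun K e) (lead b (F N s) γ.tail) : ℝ) ≤
        {s | s ≤ leadIndex b (F N) γ.tail}.indicator (fun _ => (r : ℝ)) s := by
      intro γ _
      by_cases hs : s ≤ leadIndex b (F N) γ.tail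
      · rw [Set.indicator_of_mem (show s ∈ {s | s ≤ leadIndex b (F N) γ.tail} from hs)]
        exact Nat.cast_le.2 (Submodule.finrank_le _)
      · rw [Set.indicator_of_notMem (show s ∉ {s | s ≤ leadIndex b (F N) γ.tail} from hs)]
        have h0 := hF.lead_eq_bot_of_lt b hn (not_le.1 hs)
        rw [h0, finrank_bot, Nat.cast_zero]
    have h4 := Finset.sum_le_sum h3
    have h5 : (Module.finrank K (F N s) : ℝ) + r * (simplexExp e n).card ≤
        Module.finrank K (W N) +
          ∑ γ ∈ simplexExp e N, (Module.finrank (RatFun K e) (lead b (F N s) γ.tail) : ℝ) := by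
      exact_mod_cast (add_le_add_right h2 _).trans h1
    rw [hη]
    linarith
  have hint := intervalIntegral_sum_indicator_Iic (simplexExp e N)
    (δ := fun γ => leadIndex b (F N) γ.tail) (T := M * N)
    (fun γ hγ => hF.leadIndex_nonneg h b hn (degree_tail_le hγ))
    (fun γ hγ => hF.leadIndex_le h b hn (degree_tail_le hγ)) (r : ℝ)
  have hmono := intervalIntegral.integral_mono hT
    (hF.intervalIntegrable h.finiteDimensional_apply N 0 (M * N))
    (hint.1.add intervalIntegrable_const) key
  refine hmono.trans (le_of_eq ?_)
  rw [intervalIntegral.integral_add hint.1 intervalIntegrable_const, hint.2,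
    intervalIntegral.integral_const, sub_zero, smul_eq_mul, meanIndex]
  congr 1
  field_simp

/-- One nonzero leading coefficient is enough to get a full leading space: multiply it by all of
`E`, the leading space at exponent `0` of `F (n₀ + m₀) 0`. The price is only the bounded degree
shift `n₀ + m₀`. -/
theorem le_integral (hF : IsMulFiltration W F n₀ M) (h : IsPolyModule (e := e) W m₀)
    (b : Module.Basis ι (RatFun K e) E) {n : ℕ} (hn : n₀ ≤ n) (hM : 0 ≤ M) :
    Module.finrank (RatFun K e) E * (simplexExp e n).card * meanIndex b F n ≤
    ∫ s in (0 : ℝ)..M * (n + (n₀ + m₀) : ℕ),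
      (Module.finrank K (F (n + (n₀ + m₀)) s) : ℝ) := by
  have := h.finiteDimensional
  set N := n + (n₀ + m₀) with hN
  set r : ℕ := Module.finrank (RatFun K e) E with hr
  have hWN := h.finiteDimensional_apply N
  have hnN : M * (n : ℝ) ≤ M * N := by
    refine mul_le_mul_of_nonneg_left ?_ hM
    exact_mod_cast Nat.le_add_right n _
  have hT : 0 ≤ M * (N : ℝ) := by positivity
  have hp : (0 : ℝ) < (simplexExp e n).card := by exact_mod_cast card_simplexExp_pos e n
  have key : ∀ᵐ s : ℝ, (∑ γ ∈ simplexExp e n,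
      {s | s ≤ leadIndex b (F n) γ.tail}.indicator (fun _ => (r : ℝ)) s) ≤
      (Module.finrank K (F N s) : ℝ) := by
    -- When `s` equals an index, the leading space may already vanish; these finitely many levels
    -- are negligible.
    have hae : ∀ᵐ s : ℝ, ∀ γ ∈ simplexExp e n, s ≠ leadIndex b (F n) γ.tail := by
      rw [Filter.eventually_all_finset]
      intro γ _
      exact Measure.ae_ne volume _
    filter_upwards [hae] with s hs
    have hfd : FiniteDimensional K (F N s) := Submodule.finiteDimensional_of_le (hF.le N s)
    have h1 := IsPolyModule.sum_simplexExp_finrank_lead_le_finrank b (F N s) n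
    refine le_trans (Finset.sum_le_sum fun γ hγ => ?_) ((Nat.cast_sum _ _).symm.trans_le (Nat.cast_le.2 h1))
    by_cases hsγ : s ≤ leadIndex b (F n) γ.tail
    · rw [Set.indicator_of_mem (show s ∈ {s | s ≤ leadIndex b (F n) γ.tail} from hsγ)]
      obtain ⟨x, hx, hx0⟩ := Submodule.exists_mem_ne_zero_of_ne_bot
        (hF.lead_ne_bot_of_lt h b hn (degree_tail_le hγ) (lt_of_le_of_ne hsγ (hs γ hγ)))
      have hx' : ∀ y, x * y ∈ lead b (F N s) γ.tail := by
        intro y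
        have hy : y ∈ lead b (F (n₀ + m₀) 0) 0 := by
          rw [hF.eq_of_nonpos _ (Nat.le_add_right _ _) 0 le_rfl,
            h.lead_eq_top b (by simp)]
          trivial
        have := mul_mem_lead b (hF.mul_mem n hn (n₀ + m₀) (Nat.le_add_right _ _) s 0) hx hy
        rwa [add_zero, add_zero] at this
      have h2 : LinearMap.range (LinearMap.mulLeft (RatFun K e) x) ≤ lead b (F N s) γ.tail := by
        rintro _ ⟨y, rfl⟩
        exact hx' y
      have h3 := LinearMap.finrank_range_of_inj (f := LinearMap.mulLeft (RatFun K e) x)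
        (fun y z hyz => mul_left_cancel₀ hx0 hyz)
      have h4 := Submodule.finrank_mono h2
      rw [h3] at h4
      exact_mod_cast h4
    · rw [Set.indicator_of_notMem (show s ∉ {s | s ≤ leadIndex b (F n) γ.tail} from hsγ)]
      exact Nat.cast_nonneg _
  have hint := intervalIntegral_sum_indicator_Iic (simplexExp e n)
    (δ := fun γ => leadIndex b (F n) γ.tail) (T := M * N)
    (fun γ hγ => hF.leadIndex_nonneg h b hn (degree_tail_le hγ))
    (fun γ hγ => (hF.leadIndex_le h b hn (degree_tail_le hγ)).trans hnN) (r : ℝ)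
  have hmono := intervalIntegral.integral_mono_ae hT hint.1
    (hF.intervalIntegrable h.finiteDimensional_apply N 0 (M * N)) key
  refine le_trans (le_of_eq ?_) hmono
  rw [hint.2, meanIndex]
  field_simp

/-- The mean of the indices of a multiplicative filtration, divided by the degree, converges. -/
theorem exists_tendsto_integral (hF : IsMulFiltration W F n₀ M)
    (h : IsPolyModule (e := e) W m₀) (hM : 0 ≤ M) :
    ∃ l : ℝ, Tendsto (fun n : ℕ => (∫ s in (0 : ℝ)..M * n, (Module.finrank K (F n s) : ℝ)) /
      (n * Module.finrank K (W n))) atTop (𝓝 l) := by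
  have := h.finiteDimensional
  let b := Module.finBasis (RatFun K e) E
  obtain ⟨l, hl⟩ := hF.exists_tendsto_meanIndex h b
  refine ⟨l, ?_⟩
  have hdim := h.tendsto_finrank
  set r : ℝ := (Module.finrank (RatFun K e) E : ℝ) with hr
  have hr0 : 0 < r := by rw [hr]; exact_mod_cast h.finrank_pos
  set d : ℕ → ℝ := fun n => (simplexExp e n).card with hd
  have hd0 : ∀ n, 0 < d n := fun n => by
    exact Nat.cast_pos.2 (card_simplexExp_pos e n)
  set I : ℕ → ℝ := fun n => ∫ s in (0 : ℝ)..M * n, (Module.finrank K (F n s) : ℝ) with hI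
  -- With `r d n` in place of `dim W n`, the two integral bounds differ only by bounded degree
  -- shifts. The defect term tends to `M (1 - 1) = 0`.
  have main : Tendsto (fun n : ℕ => I n / (n * (r * d n))) atTop (𝓝 l) := by
    have up : Tendsto (fun n : ℕ => meanIndex b F (n + m₀) / (n + m₀ : ℕ) +
        M * (Module.finrank K (W (n + m₀)) / (r * d (n + m₀)) - (d (n + m₀) / d n)⁻¹)) atTop
        (𝓝 (l + M * (1 - 1⁻¹))) :=
      (hl.comp (tendsto_add_atTop_nat m₀)).add (((hdim.comp (tendsto_add_atTop_nat m₀)).sub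
        ((tendsto_card_simplexExp_add e m₀).inv₀ one_ne_zero)).const_mul M)
    rw [inv_one, sub_self, mul_zero, add_zero] at up
    have low : Tendsto (fun n : ℕ => meanIndex b F n / n * ((n : ℝ) / (n + (n₀ + m₀ : ℕ) : ℝ)) *
        (d (n + (n₀ + m₀)) / d n)⁻¹) atTop (𝓝 (l * 1 * 1⁻¹)) :=
      (hl.mul (tendsto_natCast_div_add_atTop ((n₀ + m₀ : ℕ) : ℝ))).mul
        ((tendsto_card_simplexExp_add e (n₀ + m₀)).inv₀ one_ne_zero)
    rw [inv_one, mul_one, mul_one] at low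
    refine tendsto_order.2 ⟨fun x hx => ?_, fun x hx => ?_⟩
    · rw [← map_add_atTop_eq_nat (n₀ + m₀), eventually_map]
      filter_upwards [(tendsto_order.1 low).1 x hx, eventually_ge_atTop n₀,
        eventually_gt_atTop 0] with n h1 h2 h3
      refine h1.trans_le ?_
      have h4 := hF.le_integral h b h2 hM
      have hn0 : (0 : ℝ) < n := by exact_mod_cast h3
      have hN : (0 : ℝ) < ((n + (n₀ + m₀) : ℕ) : ℝ) := by exact_mod_cast Nat.add_pos_left h3 _
      rw [le_div_iff₀ (mul_pos hN (mul_pos hr0 (hd0 _)))]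
      refine le_trans (le_of_eq ?_) h4
      have := hd0 n
      have := hd0 (n + (n₀ + m₀))
      change _ = r * d n * meanIndex b F n
      push_cast at hN ⊢
      field_simp
    · rw [← map_add_atTop_eq_nat m₀, eventually_map]
      filter_upwards [(tendsto_order.1 up).2 x hx, eventually_ge_atTop n₀,
        eventually_gt_atTop 0] with n h1 h2 h3
      refine lt_of_le_of_lt ?_ h1
      have h4 := hF.integral_le h b (h2.trans (Nat.le_add_right n m₀)) hM
      have hN : (0 : ℝ) < ((n + m₀ : ℕ) : ℝ) := by exact_mod_cast Nat.add_pos_left h3 _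
      rw [div_le_iff₀ (mul_pos hN (mul_pos hr0 (hd0 _)))]
      refine h4.trans (le_of_eq ?_)
      have := hd0 n
      have := hd0 (n + m₀)
      change r * d (n + m₀) * meanIndex b F (n + m₀) +
        M * (n + m₀ : ℕ) * (Module.finrank K (W (n + m₀)) - r * d n) = _
      field_simp
  have := main.mul (hdim.inv₀ one_ne_zero)
  rw [inv_one, mul_one] at this
  refine this.congr fun n => ?_
  rw [inv_div, ← div_div]
  have h1 := hd0 n
  change _ = I n / _
  change I n / n / (r * d n) * ((r * d n) / _) = _
  rw [div_mul_div_cancel₀ (mul_pos hr0 h1).ne', div_div]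

end IsMulFiltration

end Core

/-! ### Homogeneous Noether normalization -/

section HomogeneousNoether

variable {K B : Type*} [Field K] [CommRing B] [Algebra K B]
  (𝒜 : ℕ → Submodule K B) [GradedAlgebra 𝒜]

open HomogeneousIdeal

variable {𝒜}

theorem isHomogeneous_of_mem_minimalPrimes {I p : Ideal B} (hI : I.IsHomogeneous 𝒜)
    (hp : p ∈ I.minimalPrimes) : p.IsHomogeneous 𝒜 := by
  have h1 : (p.homogeneousCore 𝒜).toIdeal.IsPrime := hp.1.1.homogeneousCore
  have h2 : I ≤ (p.homogeneousCore 𝒜).toIdeal :=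
    hI.toIdeal_homogeneousCore_eq_self.symm.trans_le (Ideal.homogeneousCore_mono _ hp.1.2)
  have h3 := hp.2 ⟨h1, h2⟩ (Ideal.toIdeal_homogeneousCore_le 𝒜 p)
  rw [le_antisymm h3 (Ideal.toIdeal_homogeneousCore_le 𝒜 p)]
  exact HomogeneousIdeal.isHomogeneous _

theorem exists_homogeneous_notMem {I J : Ideal B} (hI : I.IsHomogeneous 𝒜) (h : ¬ I ≤ J) :
    ∃ n, ∃ x ∈ 𝒜 n, x ∈ I ∧ x ∉ J := by
  classical
  by_contra! hcon
  refine h fun x hx => ?_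
  rw [← DirectSum.sum_support_decompose 𝒜 x]
  exact sum_mem fun n _ => hcon n _ (SetLike.coe_mem _) (hI n hx)

theorem le_irrelevant (h0 : ∀ a ∈ 𝒜 0, a ≠ 0 → IsUnit a) {I : Ideal B}
    (hI : I.IsHomogeneous 𝒜) (hI' : I ≠ ⊤) : I ≤ (irrelevant 𝒜).toIdeal := by
  intro x hx
  change x ∈ irrelevant 𝒜
  rw [mem_irrelevant_iff]
  by_contra hx0
  exact hI' (Ideal.eq_top_of_isUnit_mem I (hI 0 hx) (h0 _ (SetLike.coe_mem _) hx0))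

/-- Homogeneous prime avoidance for an antichain of homogeneous primes. -/
theorem exists_homogeneous_avoid (T : Finset (Ideal B)) (hprime : ∀ p ∈ T, p.IsPrime)
    (hhom : ∀ p ∈ T, p.IsHomogeneous 𝒜) (hanti : ∀ p ∈ T, ∀ q ∈ T, q ≤ p → q = p)
    (hirr : ∀ p ∈ T, ¬ (irrelevant 𝒜).toIdeal ≤ p) :
    ∃ n > 0, ∃ f ∈ 𝒜 n, ∀ p ∈ T, f ∉ p := by
  classical
  -- For each `p`, a homogeneous element outside `p` but inside every other prime of `T`; the factor
  -- `t` makes its degree positive.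
  have step : ∀ p ∈ T, ∃ d > 0, ∃ f ∈ 𝒜 d, f ∉ p ∧ ∀ q ∈ T, q ≠ p → f ∈ q := by
    intro p hp
    obtain ⟨m, t, htm, hti, htp⟩ := exists_homogeneous_notMem
      (HomogeneousIdeal.isHomogeneous (irrelevant 𝒜)) (hirr p hp)
    have hm : 0 < m := by
      rcases Nat.eq_zero_or_pos m with rfl | h
      · exfalso
        have h1 : t ∈ irrelevant 𝒜 := hti
        rw [mem_irrelevant_iff, GradedRing.proj_apply, DirectSum.decompose_of_mem_same _ htm] at h1
        exact htp (h1 ▸ zero_mem _)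
      · exact h
    have : ∀ q ∈ T.erase p, ∃ n, ∃ x ∈ 𝒜 n, x ∈ q ∧ x ∉ p := fun q hq =>
      exists_homogeneous_notMem (hhom q (Finset.mem_of_mem_erase hq)) fun hle =>
        Finset.ne_of_mem_erase hq (hanti p hp q (Finset.mem_of_mem_erase hq) hle)
    choose! n x hx hxq hxp using this
    have hpp := hprime p hp
    refine ⟨m + ∑ q ∈ T.erase p, n q, by omega, t * ∏ q ∈ T.erase p, x q,
      SetLike.mul_mem_graded htm (SetLike.prod_mem_graded _ _ _ hx), ?_, ?_⟩
    · intro h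
      rcases hpp.mem_or_mem h with h | h
      · exact htp h
      · obtain ⟨q, hq, hq'⟩ := (Ideal.IsPrime.prod_mem_iff).1 h
        exact hxp q hq hq'
    · intro q hq hqp
      have hq' := Finset.mem_erase.2 ⟨hqp, hq⟩
      exact Ideal.mul_mem_left _ _ (Ideal.mem_of_dvd _ (Finset.dvd_prod_of_mem x hq') (hxq q hq'))
  choose! d hd f hf hfp hfq using step
  have hk : ∀ p ∈ T, (∏ q ∈ T.erase p, d q) * d p = ∏ q ∈ T, d q :=
    fun p hp => Finset.prod_erase_mul _ _ hp
  -- The powers bring all summands to the same degree. Modulo each `p` exactly one summand survives,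
  -- so no scalars have to be chosen and finite fields cause no trouble.
  refine ⟨∏ q ∈ T, d q, Finset.prod_pos hd, ∑ p ∈ T, f p ^ (∏ q ∈ T.erase p, d q), ?_, ?_⟩
  · refine sum_mem fun p hp => ?_
    have := SetLike.pow_mem_graded (∏ q ∈ T.erase p, d q) (hf p hp)
    rwa [smul_eq_mul, hk p hp] at this
  · intro p hp h
    have hpp := hprime p hp
    rw [← Finset.add_sum_erase _ _ hp] at h
    have h2 : ∑ q ∈ T.erase p, f q ^ (∏ r ∈ T.erase q, d r) ∈ p := sum_mem fun q hq =>
      Ideal.pow_mem_of_mem _ (hfq q (Finset.mem_of_mem_erase hq) p hp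
        (Finset.ne_of_mem_erase hq).symm) _ (Finset.prod_pos fun r hr =>
          hd r (Finset.mem_of_mem_erase hr))
    exact hfp p hp (hpp.mem_of_pow_mem _ ((Ideal.add_mem_iff_left _ h2).1 h))

/-- Choose a homogeneous `f` outside every minimal prime of `I` other than the irrelevant ideal. A
minimal prime of `I + (f)` is then irrelevant or strictly larger than one of those, so its coheight
has dropped, and induction on `d` applies. -/
theorem exists_homogeneous_irrelevant_le_radical [IsNoetherianRing B]
    (h0 : ∀ a ∈ 𝒜 0, a ≠ 0 → IsUnit a) (d : ℕ) (I : Ideal B) (hI : I.IsHomogeneous 𝒜)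
    (hd : ∀ p ∈ I.minimalPrimes, p = (irrelevant 𝒜).toIdeal ∨
      ∀ hp : p.IsPrime, Order.coheight (⟨p, hp⟩ : PrimeSpectrum B) ≤ d) :
    ∃ f : Fin d → B, (∀ i, ∃ n > 0, f i ∈ 𝒜 n) ∧
      (irrelevant 𝒜).toIdeal ≤ (I ⊔ Ideal.span (range f)).radical := by
  classical
  have hle : ∀ {I : Ideal B}, I.IsHomogeneous 𝒜 → ∀ p ∈ I.minimalPrimes,
      p ≤ (irrelevant 𝒜).toIdeal := fun hI p hp =>
    le_irrelevant h0 (isHomogeneous_of_mem_minimalPrimes hI hp) hp.1.1.ne_top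
  induction d generalizing I with
  | zero =>
    refine ⟨Fin.elim0, fun i => i.elim0, ?_⟩
    refine le_trans ?_ (Ideal.radical_mono le_sup_left)
    rw [← Ideal.sInf_minimalPrimes]
    refine le_sInf fun p hp => ?_
    rcases hd p hp with h | h
    · exact h.ge
    · have h1 := h hp.1.1
      have h2 : IsMax (⟨p, hp.1.1⟩ : PrimeSpectrum B) := by
        rw [← Order.coheight_eq_zero]
        exact le_antisymm (by simpa using h1) zero_le
      have h3 := (PrimeSpectrum.isMax_iff).1 h2
      have hne : (irrelevant 𝒜).toIdeal ≠ ⊤ := by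
        intro h
        have h1 : (1 : B) ∈ irrelevant 𝒜 := by
          change (1 : B) ∈ (irrelevant 𝒜).toIdeal
          rw [h]; trivial
        rw [mem_irrelevant_iff, GradedRing.proj_apply,
          DirectSum.decompose_of_mem_same _ (SetLike.GradedOne.one_mem)] at h1
        exact hp.1.1.ne_top ((Ideal.eq_top_iff_one p).2 (h1 ▸ zero_mem p))
      exact (h3.eq_of_le hne (hle hI p hp)).ge
  | succ d ih =>
    set T : Finset (Ideal B) :=
      (Ideal.finite_minimalPrimes_of_isNoetherianRing B I).toFinset.filter
        (fun p => p ≠ (irrelevant 𝒜).toIdeal) with hT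
    have hmem : ∀ p, p ∈ T ↔ p ∈ I.minimalPrimes ∧ p ≠ (irrelevant 𝒜).toIdeal := by
      intro p
      rw [hT, Finset.mem_filter, Set.Finite.mem_toFinset]
    obtain ⟨n, hn, f, hf, hfT⟩ := exists_homogeneous_avoid (𝒜 := 𝒜) T
      (fun p hp => ((hmem p).1 hp).1.1.1)
      (fun p hp => isHomogeneous_of_mem_minimalPrimes hI ((hmem p).1 hp).1)
      (fun p hp q hq hqp => le_antisymm hqp
        (((hmem p).1 hp).1.2 ((hmem q).1 hq).1.1 hqp))
      (fun p hp h => ((hmem p).1 hp).2 (le_antisymm (hle hI p ((hmem p).1 hp).1) h))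
    have hI' : (I ⊔ Ideal.span {f}).IsHomogeneous 𝒜 :=
      hI.sup (Ideal.homogeneous_span 𝒜 _ (by rintro _ rfl; exact ⟨n, hf⟩))
    obtain ⟨g, hg, hg'⟩ := ih (I ⊔ Ideal.span {f}) hI' (fun q hq => by
      have hqp := hq.1.1
      obtain ⟨p, hp, hpq⟩ := Ideal.exists_minimalPrimes_le (I := I) (J := q)
        (le_sup_left.trans hq.1.2)
      by_cases hpi : p = (irrelevant 𝒜).toIdeal
      · left
        exact le_antisymm (hle hI' q hq) (hpi ▸ hpq)
      · right
        intro hq'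
        have hpd := (hd p hp).resolve_left hpi hp.1.1
        have hfq : f ∈ q := hq.1.2 (Ideal.mem_sup_right (Ideal.mem_span_singleton_self f))
        have hlt : (⟨p, hp.1.1⟩ : PrimeSpectrum B) < ⟨q, hq'⟩ := by
          refine lt_of_le_of_ne hpq fun h => ?_
          have : p = q := congrArg PrimeSpectrum.asIdeal h
          exact hfT p ((hmem p).2 ⟨hp, hpi⟩) (this ▸ hfq)
        have := (Order.coheight_add_one_le hlt).trans hpd
        push_cast at this
        exact (ENat.add_le_add_iff_right (by simp)).1 this)
    refine ⟨Fin.cons f g, fun i => ?_, hg'.trans (Ideal.radical_mono ?_)⟩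
    · refine Fin.cases ⟨n, hn, hf⟩ (fun i => ?_) i
      simpa using hg i
    · rw [Fin.range_cons, Set.insert_eq, Ideal.span_union, sup_assoc]

theorem exists_sum_mul_of_mem_span {ι : Type*} [Fintype ι] {x : ι → B} {d : ι → ℕ}
    (hx : ∀ i, x i ∈ 𝒜 (d i)) {n : ℕ} {b : B} (hb : b ∈ 𝒜 n) (h : b ∈ Ideal.span (range x)) :
    ∃ c : ι → B, (∀ i, c i ∈ 𝒜 (n - d i)) ∧ (∀ i, n < d i → c i = 0) ∧ b = ∑ i, x i * c i := by
  classical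
  obtain ⟨a, ha⟩ := (Ideal.mem_span_range_iff_exists_fun).1 h
  -- Only the component of degree `n - d i` of each coefficient contributes; the test excludes
  -- truncated subtraction.
  refine ⟨fun i => if d i ≤ n then DirectSum.decompose 𝒜 (a i) (n - d i) else 0, fun i => ?_,
    fun i hi => if_neg (not_le.2 hi), ?_⟩
  · beta_reduce
    split_ifs
    · exact SetLike.coe_mem _
    · exact zero_mem _
  · have h1 := DirectSum.decompose_of_mem_same 𝒜 hb
    rw [← h1, ← ha, DirectSum.decompose_sum, DFinsupp.finsetSum_apply,
      AddSubmonoidClass.coe_finsetSum]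
    refine Finset.sum_congr rfl fun i _ => ?_
    rw [DirectSum.coe_decompose_mul_of_right_mem 𝒜 n (hx i)]
    beta_reduce
    split_ifs
    · rw [mul_comm]
    · rw [mul_zero]

/-- The irrelevant ideal has finitely many homogeneous generators. With `D` above their degrees, an
element of degree at least `k D` allows `k` generators to be split off in succession. -/
theorem exists_forall_mem_pow_irrelevant [IsNoetherianRing B] :
    ∃ D : ℕ, ∀ k n, k * D ≤ n → ∀ b ∈ 𝒜 n, b ∈ (irrelevant 𝒜).toIdeal ^ k := by
  classical
  obtain ⟨S, hS, hS'⟩ := (Submodule.fg_span_iff_fg_span_finset_subset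
    (⋃ i > 0, (𝒜 i : Set B))).1 (IsNoetherian.noetherian (Ideal.span (⋃ i > 0, (𝒜 i : Set B))))
  have hirr : (irrelevant 𝒜).toIdeal = Ideal.span (S : Set B) :=
    (irrelevant_eq_span 𝒜).trans hS'
  have hd : ∀ g : S, ∃ d > 0, (g : B) ∈ 𝒜 d := fun g => by
    simpa using hS g.2
  choose d hd0 hd using hd
  refine ⟨1 + Finset.univ.sup d, fun k => ?_⟩
  induction k with
  | zero => intro n _ b _; simp
  | succ k ih =>
    intro n hn b hb
    have hbirr : b ∈ Ideal.span (range fun g : S => (g : B)) := by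
      have h1 : b ∈ irrelevant 𝒜 := mem_irrelevant_of_mem 𝒜 (i := n) (by
        rw [add_mul, mul_add] at hn; omega) hb
      have h2 : b ∈ (irrelevant 𝒜).toIdeal := h1
      rw [hirr] at h2
      simpa using h2
    obtain ⟨c, hc, -, rfl⟩ := exists_sum_mul_of_mem_span hd hb hbirr
    refine sum_mem fun g _ => ?_
    rw [pow_succ']
    refine Ideal.mul_mem_mul ?_ (ih _ ?_ _ (hc g))
    · rw [hirr]; exact Ideal.subset_span g.2
    · have := Finset.le_sup (f := d) (Finset.mem_univ g)
      rw [add_mul, one_mul] at hn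
      omega

/-- A graded version of Nakayama's lemma. -/
theorem exists_sum_mul_of_irrelevant_le_radical [IsNoetherianRing B] {ι : Type*} [Fintype ι]
    {x : ι → B} {N : ℕ} (hx : ∀ i, x i ∈ 𝒜 N)
    (h : (irrelevant 𝒜).toIdeal ≤ (Ideal.span (range x)).radical) :
    ∃ D : ℕ, ∀ n ≥ D, ∀ b ∈ 𝒜 n, ∃ c : ι → B, (∀ i, c i ∈ 𝒜 (n - N)) ∧ b = ∑ i, x i * c i := by
  obtain ⟨k, hk⟩ := Ideal.exists_pow_le_of_le_radical_of_fg h (IsNoetherian.noetherian _)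
  obtain ⟨D, hD⟩ := exists_forall_mem_pow_irrelevant (𝒜 := 𝒜)
  refine ⟨k * D, fun n hn b hb => ?_⟩
  obtain ⟨c, hc, -, hb'⟩ := exists_sum_mul_of_mem_span hx hb (hk (hD k n hn b hb))
  exact ⟨c, hc, hb'⟩

theorem mem_span_adjoin_of_sum_mul {ι : Type*} [Fintype ι] {x : ι → B} {N D : ℕ} (hN : 0 < N)
    (h : ∀ n ≥ D, ∀ b ∈ 𝒜 n, ∃ c : ι → B, (∀ i, c i ∈ 𝒜 (n - N)) ∧ b = ∑ i, x i * c i)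
    (n : ℕ) (b : B) (hb : b ∈ 𝒜 n) :
    b ∈ Submodule.span (Algebra.adjoin K (range x)) (⋃ m ≤ D, (𝒜 m : Set B)) := by
  induction n using Nat.strong_induction_on generalizing b with
  | _ n ih =>
  rcases le_or_gt n D with hn | hn
  · exact Submodule.subset_span (mem_iUnion₂.2 ⟨n, hn, hb⟩)
  · obtain ⟨c, hc, rfl⟩ := h n hn.le b hb
    refine sum_mem fun i _ => ?_
    have h1 := ih (n - N) (by omega) (c i) (hc i)
    exact Submodule.smul_mem _ (⟨x i, Algebra.subset_adjoin ⟨i, rfl⟩⟩ :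
      Algebra.adjoin K (range x)) h1

theorem finite_adjoin_of_sum_mul (hfin : ∀ n, FiniteDimensional K (𝒜 n)) {ι : Type*} [Fintype ι]
    {x : ι → B} {N D : ℕ} (hN : 0 < N)
    (h : ∀ n ≥ D, ∀ b ∈ 𝒜 n, ∃ c : ι → B, (∀ i, c i ∈ 𝒜 (n - N)) ∧ b = ∑ i, x i * c i) :
    Module.Finite (Algebra.adjoin K (range x)) B := by
  classical
  have h1 : ∀ m, ∃ S : Finset B, Submodule.span K (S : Set B) = 𝒜 m := fun m =>
    (Submodule.fg_iff_finiteDimensional _).2 (hfin m)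
  choose S hS using h1
  refine ⟨⟨(Finset.range (D + 1)).biUnion S, ?_⟩⟩
  rw [_root_.eq_top_iff]
  intro b _
  rw [← DirectSum.sum_support_decompose 𝒜 b]
  refine sum_mem fun n _ => ?_
  refine Submodule.span_le.2 ?_ (mem_span_adjoin_of_sum_mul hN h n _ (SetLike.coe_mem _))
  intro y hy
  obtain ⟨m, hm, hy⟩ := mem_iUnion₂.1 hy
  rw [SetLike.mem_coe, ← hS m] at hy
  refine Submodule.span_le_restrictScalars K (Algebra.adjoin K (range x)) _
    (Submodule.span_mono ?_ hy)
  intro z hz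
  exact Finset.mem_coe.2 (Finset.mem_biUnion.2 ⟨m, Finset.mem_range.2 (by omega), hz⟩)

theorem ringKrullDim_le_of_isIntegral {A R : Type*} [CommRing A] [CommRing R] [Algebra A R]
    [Algebra.IsIntegral A R] : ringKrullDim R ≤ ringKrullDim A := by
  refine Order.krullDim_le_of_strictMono (fun p => PrimeSpectrum.comap (algebraMap A R) p) ?_
  intro p q hpq
  obtain ⟨x, hx, hx'⟩ := SetLike.exists_of_lt (show p.asIdeal < q.asIdeal from hpq)
  exact Ideal.comap_lt_comap_of_integral_mem_sdiff (show p.asIdeal ≤ q.asIdeal from hpq.le)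
    ⟨hx, hx'⟩ (Algebra.IsIntegral.isIntegral x)

theorem isUnit_of_mem_zero [IsDomain B] [FiniteDimensional K (𝒜 0)] {a : B} (ha : a ∈ 𝒜 0)
    (ha0 : a ≠ 0) : IsUnit a := by
  let φ : 𝒜 0 →ₗ[K] 𝒜 0 := (LinearMap.mulLeft K a).restrict fun y hy => by
    simpa using SetLike.mul_mem_graded ha hy
  have hφ : Function.Injective φ := fun x y h =>
    Subtype.ext (mul_left_cancel₀ ha0 (congrArg Subtype.val h))
  obtain ⟨y, hy⟩ := (LinearMap.injective_iff_surjective.1 hφ) ⟨1, SetLike.GradedOne.one_mem⟩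
  exact IsUnit.of_mul_eq_one (y : B) (congrArg Subtype.val hy)

theorem exists_ringKrullDim_eq_natCast [Nontrivial B] [Algebra.FiniteType K B] :
    ∃ d : ℕ, ringKrullDim B = d := by
  obtain ⟨n, φ, hφ⟩ := Algebra.FiniteType.iff_quotient_mvPolynomial''.1
    (inferInstance : Algebra.FiniteType K B)
  have h1 := ringKrullDim_le_of_surjective φ.toRingHom hφ
  rw [MvPolynomial.ringKrullDim_of_isNoetherianRing, ringKrullDim_eq_zero_of_field] at h1
  have h2 : (0 : WithBot ℕ∞) ≤ ringKrullDim B := ringKrullDim_nonneg_of_nontrivial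
  generalize ringKrullDim B = r at *
  induction r using WithBot.recBotCoe with
  | bot => simp at h2
  | coe r =>
    induction r using ENat.recTopCoe with
    | top =>
      exfalso
      have h3 : ((⊤ : ℕ∞) : WithBot ℕ∞) ≤ ((n : ℕ∞) : WithBot ℕ∞) := by simpa using h1
      exact absurd (top_le_iff.1 (WithBot.coe_le_coe.1 h3)) (ENat.natCast_ne_top n)
    | coe r => exact ⟨r, rfl⟩

/-- A relation would make the subalgebra a proper quotient of a polynomial ring in `d` variables, of
dimension less than `d`. But `B` is integral over it and has dimension `d`. -/
theorem algebraicIndependent_of_finite_adjoin [IsDomain B] {d : ℕ} (hd : ringKrullDim B = d)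
    {x : Fin d → B} (hfin : Module.Finite (Algebra.adjoin K (range x)) B) :
    AlgebraicIndependent K x := by
  rw [algebraicIndependent_iff_injective_aeval, injective_iff_map_eq_zero]
  by_contra! h
  obtain ⟨r, hr, hr0⟩ := h
  have hle : ringKrullDim B ≤ ringKrullDim (Algebra.adjoin K (range x)) :=
    ringKrullDim_le_of_isIntegral
  have hsurj : Function.Surjective (MvPolynomial.aeval x : MvPolynomial (Fin d) K →ₐ[K] B).rangeRestrict :=
    AlgHom.rangeRestrict_surjective _
  have h1 := ringKrullDim_succ_le_of_surjective
    (MvPolynomial.aeval x : MvPolynomial (Fin d) K →ₐ[K] B).rangeRestrict.toRingHom hsurj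
    (mem_nonZeroDivisors_of_ne_zero hr0) (Subtype.ext hr)
  rw [MvPolynomial.ringKrullDim_of_isNoetherianRing, ringKrullDim_eq_zero_of_field] at h1
  rw [Algebra.adjoin_range_eq_range_aeval, hd] at hle
  have h2 := (add_le_add_left hle 1).trans h1
  simp only [Nat.card_eq_fintype_card, Fintype.card_fin, zero_add] at h2
  have h3 : d + 1 ≤ d := by exact_mod_cast h2
  omega

/-- Homogeneous Noether normalization, over an arbitrary field. -/
theorem exists_homogeneous_noether_normalization [IsDomain B] [Algebra.FiniteType K B]
    (hfin : ∀ n, FiniteDimensional K (𝒜 n)) (hne : ∀ᶠ n in atTop, 𝒜 n ≠ ⊥) (n₀ : ℕ) :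
    ∃ (e N D : ℕ) (x : Fin (e + 1) → B), n₀ ≤ N ∧ 0 < N ∧ (∀ i, x i ∈ 𝒜 N) ∧
      AlgebraicIndependent K x ∧ ∀ n ≥ D, ∀ b ∈ 𝒜 n, ∃ c : Fin (e + 1) → B,
        (∀ i, c i ∈ 𝒜 (n - N)) ∧ b = ∑ i, x i * c i := by
  classical
  have : IsNoetherianRing B := Algebra.FiniteType.isNoetherianRing K B
  obtain ⟨d, hd⟩ := exists_ringKrullDim_eq_natCast (K := K) (B := B)
  obtain ⟨f, hf, hf'⟩ := exists_homogeneous_irrelevant_le_radical (𝒜 := 𝒜)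
    (fun a ha ha0 => isUnit_of_mem_zero ha ha0) d ⊥ (Ideal.IsHomogeneous.bot 𝒜)
    (fun p _ => Or.inr fun hp => by
      have := Order.coheight_le_krullDim (⟨p, hp⟩ : PrimeSpectrum B)
      rw [← ringKrullDim, hd] at this
      exact_mod_cast this)
  rw [bot_sup_eq] at hf'
  choose m hm hfm using hf
  -- The exponents equalize the degrees of the `f i ^ k i`, and the factor `n₀ + 1` pushes the
  -- common degree past `n₀`.
  set k : Fin d → ℕ := fun i => (n₀ + 1) * ∏ j ∈ Finset.univ.erase i, m j with hk
  have hk0 : ∀ i, 0 < k i := fun i => Nat.mul_pos (Nat.succ_pos _) (Finset.prod_pos fun j _ => hm j)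
  have hx : ∀ i, f i ^ k i ∈ 𝒜 ((n₀ + 1) * ∏ j, m j) := fun i => by
    have := SetLike.pow_mem_graded (k i) (hfm i)
    rwa [smul_eq_mul, hk, mul_assoc, Finset.prod_erase_mul _ _ (Finset.mem_univ i)] at this
  have hrad : (irrelevant 𝒜).toIdeal ≤ (Ideal.span (range fun i => f i ^ k i)).radical := by
    refine hf'.trans ((Ideal.radical_mono (Ideal.span_le.2 ?_)).trans_eq (Ideal.radical_idem _))
    rintro _ ⟨i, rfl⟩
    exact ⟨k i, Ideal.subset_span ⟨i, rfl⟩⟩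
  have hN : 0 < (n₀ + 1) * ∏ j, m j :=
    Nat.mul_pos (Nat.succ_pos _) (Finset.prod_pos fun j _ => hm j)
  obtain ⟨D, hD⟩ := exists_sum_mul_of_irrelevant_le_radical hx hrad
  have hind := algebraicIndependent_of_finite_adjoin hd (finite_adjoin_of_sum_mul hfin hN hD)
  have hle : n₀ ≤ (n₀ + 1) * ∏ j, m j := by
    have := Nat.le_mul_of_pos_right (n₀ + 1) (Finset.prod_pos fun j (_ : j ∈ Finset.univ) => hm j)
    omega
  rcases d with _ | e
  -- With no parameters, all components of large degree would vanish.
  · exfalso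
    obtain ⟨n, hn, hnD⟩ := (hne.and (eventually_ge_atTop D)).exists
    refine hn ((Submodule.eq_bot_iff _).2 fun b hb => ?_)
    obtain ⟨c, -, hc⟩ := hD n hnD b hb
    simpa using hc
  · exact ⟨e, _, D, _, hle, hN, hx, hind, hD⟩

end HomogeneousNoether

/-! ### Reduction to a finite algebra over the rational functions -/

section GradedPolyModule

variable {K : Type*} [Field K] {e : ℕ} {Q : Type*} [CommRing Q]
  [Algebra (RatFun K e) Q] [Algebra K Q] [IsScalarTower K (RatFun K e) Q]

/-- A multiplicative increasing family of subspaces containing the polynomials and eventually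
generated in degree one over them. -/
structure IsPolyAlgebra (W : ℕ → Submodule K Q) (m₀ : ℕ) : Prop where
  one_mem : 1 ∈ W 0
  one_mem_one : 1 ∈ W 1
  X_mem : ∀ i, polyHom K e Q (MvPolynomial.X i) ∈ W 1
  mul_mem : ∀ {m n : ℕ} {x y : Q}, x ∈ W m → y ∈ W n → x * y ∈ W (m + n)
  finite : ∀ n, FiniteDimensional K (W n)
  le_mul : ∀ n ≥ m₀, W (n + 1) ≤ polyLE K e Q 1 * W n

namespace IsPolyAlgebra

variable {W : ℕ → Submodule K Q} {m₀ : ℕ}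

theorem mono (h : IsPolyAlgebra (e := e) W m₀) : Monotone W :=
  monotone_nat_of_le_succ fun n x hx => by simpa using h.mul_mem hx h.one_mem_one

theorem polyHom_monomial_mem (h : IsPolyAlgebra (e := e) W m₀) (α : Fin e →₀ ℕ) (c : K) :
    polyHom K e Q (MvPolynomial.monomial α c) ∈ W α.degree := by
  have key : ∀ α : Fin e →₀ ℕ, polyHom K e Q (MvPolynomial.monomial α 1) ∈ W α.degree := by
    intro α
    induction α using Finsupp.induction_linear with
    | zero => simpa using h.one_mem
    | add α β hα hβ =>
      rw [map_add, ← mul_one (1 : K), ← MvPolynomial.monomial_mul, map_mul]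
      exact h.mul_mem hα hβ
    | single i k =>
      rw [Finsupp.degree_single, ← MvPolynomial.X_pow_eq_monomial, map_pow]
      induction k with
      | zero => simpa using h.one_mem
      | succ k ih => rw [pow_succ]; exact h.mul_mem ih (h.X_mem i)
  rw [← mul_one c, ← smul_eq_mul, ← MvPolynomial.smul_monomial, map_smul]
  exact Submodule.smul_mem _ _ (key α)

theorem polyLE_le (h : IsPolyAlgebra (e := e) W m₀) (n : ℕ) : polyLE K e Q n ≤ W n := by
  intro x hx
  obtain ⟨p, hp, rfl⟩ := mem_polyLE.1 hx
  rw [p.as_sum, map_sum]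
  refine sum_mem fun α hα => h.mono ?_ (h.polyHom_monomial_mem α _)
  exact (MvPolynomial.le_totalDegree hα).trans hp

theorem le_polyLE_mul (h : IsPolyAlgebra (e := e) W m₀) (n : ℕ) :
    W n ≤ polyLE K e Q n * W m₀ := by
  have hone : ∀ n, (1 : Q) ∈ polyLE K e Q n := fun n => by
    rw [← map_one (polyHom K e Q)]
    exact polyHom_mem_polyLE (by simp)
  rcases le_total n m₀ with hn | hn
  · intro x hx
    rw [← one_mul x]
    exact Submodule.mul_mem_mul (hone n) (h.mono hn hx)
  · induction n, hn using Nat.le_induction with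
    | base =>
      intro x hx
      rw [← one_mul x]
      exact Submodule.mul_mem_mul (hone _) hx
    | succ n hn ih =>
      refine (h.le_mul n hn).trans ((mul_le_mul' le_rfl ih).trans ?_)
      rw [← mul_assoc]
      refine mul_le_mul' (Submodule.mul_le.2 fun x hx y hy => ?_) le_rfl
      rw [add_comm n]
      exact mul_mem_polyLE hx hy

/-- The ambient `Q` may be too large. The span `T` of `W m₀` over the rational functions is closed
under products and contains every `W n`; inside this finite subalgebra the hypotheses of
`IsPolyModule` hold, and dimensions are unchanged. -/
theorem exists_tendsto [IsDomain Q] (h : IsPolyAlgebra (e := e) W m₀) {F : ℕ → ℝ → Submodule K Q} {n₀ : ℕ}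
    {M : ℝ} (hF : IsMulFiltration W F n₀ M) (hM : 0 ≤ M) :
    (∃ l : ℝ, Tendsto (fun n : ℕ => (∫ s in (0 : ℝ)..M * n, (Module.finrank K (F n s) : ℝ)) /
      (n * Module.finrank K (W n))) atTop (𝓝 l)) ∧
    Tendsto (fun n : ℕ => (Module.finrank K (W (n + 1)) : ℝ) / Module.finrank K (W n))
      atTop (𝓝 1) := by
  set T : Submodule (RatFun K e) Q := Submodule.span (RatFun K e) (W m₀ : Set Q) with hT
  have hpoly : ∀ {n : ℕ} {x y : Q}, x ∈ polyLE K e Q n → y ∈ T → x * y ∈ T := by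
    intro n x y hx hy
    obtain ⟨p, hp, rfl⟩ := mem_polyLE.1 hx
    rw [polyHom_apply, ← Algebra.smul_def]
    exact T.smul_mem _ hy
  have hWT : ∀ n, ∀ x ∈ W n, x ∈ T := by
    intro n x hx
    have := h.le_polyLE_mul n hx
    refine Submodule.mul_induction_on this (fun a ha b hb => hpoly ha (Submodule.subset_span hb))
      fun a b ha hb => T.add_mem ha hb
  have hmulT : ∀ x y, x ∈ T → y ∈ T → x * y ∈ T := by
    intro x y hx hy
    have : x * y ∈ T * T := Submodule.mul_mem_mul hx hy
    rw [hT, Submodule.span_mul_span] at this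
    refine Submodule.span_le.2 ?_ this
    rintro _ ⟨a, ha, b, hb, rfl⟩
    exact hWT _ _ (h.mul_mem ha hb)
  let S : Subalgebra (RatFun K e) Q := T.toSubalgebra (hWT 0 _ h.one_mem) hmulT
  let σ : S →ₐ[K] Q := S.val.restrictScalars K
  have hσ : Function.Injective σ := Subtype.val_injective
  have hσp : ∀ p, σ (polyHom K e S p) = polyHom K e Q p := fun p => rfl
  have hσW : ∀ n, ∀ U ≤ W n, (U.comap σ.toLinearMap).map σ.toLinearMap = U := by
    intro n U hU
    refine le_antisymm (Submodule.map_comap_le _ _) fun x hx => ?_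
    exact ⟨⟨x, hWT n x (hU hx)⟩, hx, rfl⟩
  have hfr : ∀ n, ∀ U ≤ W n, Module.finrank K (U.comap σ.toLinearMap) = Module.finrank K U := by
    intro n U hU
    have := (Submodule.equivMapOfInjective σ.toLinearMap hσ (U.comap σ.toLinearMap)).finrank_eq
    rw [this, hσW n U hU]
  have hpolymap : ∀ n, (polyLE K e S n).map σ.toLinearMap = polyLE K e Q n := by
    intro n
    rw [polyLE, polyLE, ← Submodule.map_comp]
    rfl
  have hPM : IsPolyModule (e := e) (fun n => (W n).comap σ.toLinearMap) m₀ := by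
    refine ⟨?_, ?_, ?_, ?_, ?_⟩
    · exact h.one_mem
    · intro m n x y hx hy
      refine h.mul_mem (h.polyLE_le m ?_) hy
      rw [← hpolymap]
      exact Submodule.mem_map_of_mem hx
    · have := h.finite m₀
      have h1 : FiniteDimensional K (((W m₀).comap σ.toLinearMap).map σ.toLinearMap) := by
        rwa [hσW m₀ _ le_rfl]
      exact Module.Finite.equiv (Submodule.equivMapOfInjective σ.toLinearMap hσ _).symm
    · apply Submodule.map_injective_of_injective (f := S.val.toLinearMap) Subtype.val_injective
      rw [Submodule.map_span, Submodule.map_top]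
      have h1 : (S.val.toLinearMap : S → Q) '' ((W m₀).comap σ.toLinearMap : Set S) = W m₀ := by
        have := congrArg (fun U : Submodule K Q => (U : Set Q)) (hσW m₀ _ le_rfl)
        exact this
      rw [h1]
      ext x
      constructor
      · intro hx; exact ⟨⟨x, hx⟩, rfl⟩
      · rintro ⟨y, rfl⟩; exact y.2
    · intro n
      have h2 : ((W n).comap σ.toLinearMap).map σ.toLinearMap ≤
          (polyLE K e S n * (W m₀).comap σ.toLinearMap).map σ.toLinearMap := by
        rw [hσW n _ le_rfl, Submodule.map_mul, hpolymap, hσW m₀ _ le_rfl]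
        exact h.le_polyLE_mul n
      exact (Submodule.map_le_map_iff_of_injective (f := σ.toLinearMap) hσ _ _).1 h2
  have hMF : IsMulFiltration (fun n => (W n).comap σ.toLinearMap)
      (fun n s => (F n s).comap σ.toLinearMap) n₀ M := by
    refine ⟨fun n s t hst => Submodule.comap_mono (hF.antitone n hst),
      fun n s => Submodule.comap_mono (hF.le n s), fun n hn s hs => ?_, fun n hn s hs => ?_,
      fun m hm n hn s t x hx y hy => hF.mul_mem m hm n hn s t _ hx _ hy⟩
    · simp only [hF.eq_of_nonpos n hn s hs]
    · simp only [hF.eq_bot n hn s hs]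
      exact LinearMap.ker_eq_bot.2 hσ
  constructor
  · obtain ⟨l, hl⟩ := hMF.exists_tendsto_integral hPM hM
    refine ⟨l, hl.congr fun n => ?_⟩
    simp only [hfr n _ le_rfl, fun s => hfr n _ (hF.le n s)]
  · have h1 := hPM.tendsto_finrank
    have h2 := tendsto_card_simplexExp_add e 1
    have h3 := ((h1.comp (tendsto_add_atTop_nat 1)).mul h2).div h1 one_ne_zero
    simp only [mul_one, div_one] at h3
    refine h3.congr fun n => ?_
    have hr : (Module.finrank (RatFun K e) S : ℝ) ≠ 0 := by exact_mod_cast hPM.finrank_pos.ne'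
    have hd : ∀ n, ((simplexExp e n).card : ℝ) ≠ 0 := fun n => by
      exact_mod_cast (card_simplexExp_pos e n).ne'
    have := hd n
    have := hd (n + 1)
    simp only [Pi.div_apply, Function.comp, hfr _ _ le_rfl]
    field_simp

end IsPolyAlgebra

end GradedPolyModule

/-! ### Dehomogenization by a parameter -/

section Dehomogenize

variable {K : Type*} [Field K]

/-- Multiplying a relation of degree `n` among the quotients by `x 0 ^ n` gives a homogeneous
relation among the `x i`. Distinct exponents remain distinct, so all coefficients vanish. -/
theorem algebraicIndependent_succ_div {Q : Type*} [Field Q] [Algebra K Q] {e : ℕ}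
    {x : Fin (e + 1) → Q} (hx : AlgebraicIndependent K x) :
    AlgebraicIndependent K (fun i : Fin e => x i.succ / x 0) := by
  classical
  have h0 : x 0 ≠ 0 := hx.ne_zero 0
  rw [algebraicIndependent_iff]
  intro p hp
  set n := p.totalDegree
  set P : MvPolynomial (Fin (e + 1)) K :=
    ∑ α ∈ p.support, MvPolynomial.monomial (Finsupp.cons (n - α.degree) α) (p.coeff α) with hP
  have h1 : MvPolynomial.aeval x P =
      x 0 ^ n * MvPolynomial.aeval (fun i : Fin e => x i.succ / x 0) p := by
    conv_rhs => rw [p.as_sum]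
    rw [hP, map_sum, map_sum, Finset.mul_sum]
    refine Finset.sum_congr rfl fun α hα => ?_
    have hα' : α.degree ≤ n := MvPolynomial.le_totalDegree hα
    rw [MvPolynomial.aeval_monomial, MvPolynomial.aeval_monomial,
      Finsupp.prod_fintype _ _ (fun _ => pow_zero _), Finsupp.prod_fintype _ _ (fun _ => pow_zero _),
      Fin.prod_univ_succ]
    simp only [Finsupp.cons_zero, Finsupp.cons_succ, div_pow, Finset.prod_div_distrib]
    rw [Finset.prod_pow_eq_pow_sum, ← Finsupp.degree_eq_sum]
    have : x 0 ^ n = x 0 ^ (n - α.degree) * x 0 ^ α.degree := by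
      rw [← pow_add, Nat.sub_add_cancel hα']
    rw [this]
    have := pow_ne_zero α.degree h0
    field_simp
  rw [hp, mul_zero] at h1
  have hP0 : P = 0 := (algebraicIndependent_iff.1 hx) P h1
  ext β
  have h2 := congrArg (MvPolynomial.coeff (Finsupp.cons (n - β.degree) β)) hP0
  rw [hP, MvPolynomial.coeff_sum, MvPolynomial.coeff_zero] at h2
  rw [MvPolynomial.coeff_zero, ← h2]
  have hinj : ∀ α : Fin e →₀ ℕ,
      Finsupp.cons (n - α.degree) α = Finsupp.cons (n - β.degree) β ↔ α = β := fun α =>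
    ⟨fun h => by simpa using congrArg Finsupp.tail h, fun h => by rw [h]⟩
  simp only [MvPolynomial.coeff_monomial, hinj, Finset.sum_ite_eq', MvPolynomial.mem_support_iff]
  split_ifs with h
  · rfl
  · exact not_not.1 h

theorem exists_algHom_ratFun {Q : Type*} [Field Q] [Algebra K Q] {e : ℕ}
    {φ : MvPolynomial (Fin e) K →ₐ[K] Q} (hφ : Function.Injective φ) :
    ∃ ψ : RatFun K e →ₐ[K] Q, ∀ p, ψ (algebraMap _ _ p) = φ p := by
  have hφ' : Function.Injective (φ : MvPolynomial (Fin e) K →+* Q) := hφ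
  obtain ⟨ψ, hψ⟩ : ∃ ψ : RatFun K e →+* Q, ∀ p, ψ (algebraMap _ _ p) = φ p :=
    ⟨IsFractionRing.lift hφ', IsFractionRing.lift_algebraMap hφ'⟩
  refine ⟨{ ψ with commutes' := fun c => ?_ }, hψ⟩
  have h1 : ψ (algebraMap K (RatFun K e) c) = algebraMap K Q c := by
    rw [IsScalarTower.algebraMap_apply K (MvPolynomial (Fin e) K) (RatFun K e), hψ, φ.commutes]
  exact h1

variable {B : Type*} [CommRing B] [IsDomain B] [Algebra K B]
  {𝒜 : ℕ → Submodule K B} [GradedAlgebra 𝒜]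

/-- Dividing degree `N m` by `x 0 ^ m` preserves products and dimensions. It makes `x 0` the unit
and the other parameters the variables, so generation over the parameters becomes generation over
polynomials of degree at most one. -/
theorem exists_tendsto_integral_multiples_of_ratFun {Q : Type*} [Field Q] {e : ℕ}
    [Algebra K Q] [Algebra B Q] [IsScalarTower K B Q] [Algebra (RatFun K e) Q]
    [IsScalarTower K (RatFun K e) Q] (hinjQ : Function.Injective (algebraMap B Q))
    (hfin : ∀ n, FiniteDimensional K (𝒜 n)) {N D : ℕ}
    {x : Fin (e + 1) → B} (hN : 0 < N) (hx : ∀ i, x i ∈ 𝒜 N) (hx0 : x 0 ≠ 0)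
    (hX' : ∀ i, polyHom K e Q (MvPolynomial.X i) = algebraMap B Q (x i.succ) / algebraMap B Q (x 0))
    (hgen : ∀ n ≥ D, ∀ b ∈ 𝒜 n, ∃ c : Fin (e + 1) → B, (∀ i, c i ∈ 𝒜 (n - N)) ∧
      b = ∑ i, x i * c i)
    {Φ : ℕ → ℝ → Submodule K B} {n₀ : ℕ} {M : ℝ} (hM : 0 ≤ M) (hΦ : IsMulFiltration 𝒜 Φ n₀ M) :
    (∃ l : ℝ, Tendsto (fun n : ℕ => (∫ s in (0 : ℝ)..M * (N * n : ℕ),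
        (Module.finrank K (Φ (N * n) s) : ℝ)) /
      (n * Module.finrank K (𝒜 (N * n)))) atTop (𝓝 l)) ∧
    Tendsto (fun n : ℕ => (Module.finrank K (𝒜 (N * (n + 1))) : ℝ) /
      Module.finrank K (𝒜 (N * n))) atTop (𝓝 1) := by
  set z : Q := algebraMap B Q (x 0) with hz
  have hz0 : z ≠ 0 := by rwa [hz, Ne, map_eq_zero_iff _ hinjQ]
  let Δ : ℕ → B →ₗ[K] Q := fun m =>
    (LinearMap.mulLeft K ((z ^ m)⁻¹)) ∘ₗ (IsScalarTower.toAlgHom K B Q).toLinearMap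
  have hΔ : ∀ m b, Δ m b = (z ^ m)⁻¹ * algebraMap B Q b := fun m b => rfl
  have hΔinj : ∀ m, Function.Injective (Δ m) := by
    intro m a b h
    rw [hΔ, hΔ] at h
    exact hinjQ (mul_left_cancel₀ (inv_ne_zero (pow_ne_zero m hz0)) h)
  have hΔmul : ∀ m n a b, Δ m a * Δ n b = Δ (m + n) (a * b) := by
    intro m n a b
    rw [hΔ, hΔ, hΔ, map_mul, pow_add, mul_inv]
    ring
  have hfr : ∀ m (U : Submodule K B), Module.finrank K (U.map (Δ m)) = Module.finrank K U :=
    fun m U => (Submodule.equivMapOfInjective (Δ m) (hΔinj m) U).finrank_eq.symm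
  have hX : ∀ i, polyHom K e Q (MvPolynomial.X i) = Δ 1 (x i.succ) := by
    intro i
    rw [hX', hΔ, pow_one, div_eq_inv_mul]
  have hone : Δ 1 (x 0) = 1 := by
    rw [hΔ, pow_one, ← hz, inv_mul_cancel₀ hz0]
  have hPA : IsPolyAlgebra (e := e) (fun m => (𝒜 (N * m)).map (Δ m)) D := by
    refine ⟨⟨1, ?_, ?_⟩, ⟨x 0, by simpa using hx 0, hone⟩,
      fun i => ⟨x i.succ, by simpa using hx i.succ, (hX i).symm⟩, ?_, fun n => ?_, ?_⟩
    · rw [mul_zero]; exact SetLike.GradedOne.one_mem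
    · rw [hΔ]; simp
    · rintro m n _ _ ⟨a, ha, rfl⟩ ⟨b, hb, rfl⟩
      exact ⟨a * b, by rw [mul_add]; exact SetLike.mul_mem_graded ha hb, (hΔmul m n a b).symm⟩
    · have := hfin (N * n)
      infer_instance
    · rintro n hn _ ⟨b, hb, rfl⟩
      have hle : D ≤ N * (n + 1) := by nlinarith
      obtain ⟨c, hc, rfl⟩ := hgen _ hle b hb
      rw [map_sum]
      refine sum_mem fun i _ => ?_
      rw [add_comm n 1, ← hΔmul]
      refine Submodule.mul_mem_mul ?_ ⟨c i, ?_, rfl⟩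
      · refine Fin.cases ?_ (fun j => ?_) i
        · rw [hone, ← map_one (polyHom K e Q)]
          exact polyHom_mem_polyLE (by simp)
        · rw [← hX]
          exact polyHom_mem_polyLE (by simp)
      · have := hc i
        rwa [mul_add, mul_one, Nat.add_sub_cancel] at this
  -- The new degree is the old one divided by `N`, so the slope bound is multiplied by `N`.
  have hF : IsMulFiltration (fun m => (𝒜 (N * m)).map (Δ m))
      (fun m s => (Φ (N * m) s).map (Δ m)) n₀ (M * N) := by
    have hle : ∀ n ≥ n₀, n₀ ≤ N * n := fun n hn => by nlinarith
    refine ⟨fun n s t hst => Submodule.map_mono (hΦ.antitone _ hst),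
      fun n s => Submodule.map_mono (hΦ.le _ s), fun n hn s hs => ?_, fun n hn s hs => ?_, ?_⟩
    · simp only [hΦ.eq_of_nonpos _ (hle n hn) s hs]
    · have : s > M * (N * n : ℕ) := by push_cast; rwa [← mul_assoc]
      simp only [hΦ.eq_bot _ (hle n hn) s this, Submodule.map_bot]
    · rintro m hm n hn s t _ ⟨a, ha, rfl⟩ _ ⟨b, hb, rfl⟩
      refine ⟨a * b, ?_, (hΔmul m n a b).symm⟩
      rw [mul_add]
      exact hΦ.mul_mem _ (hle m hm) _ (hle n hn) s t a ha b hb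
  obtain ⟨⟨l, hl⟩, h2⟩ := hPA.exists_tendsto hF (by positivity)
  simp only [hfr] at hl h2
  refine ⟨⟨l, hl.congr fun n => ?_⟩, h2⟩
  rw [Nat.cast_mul, mul_assoc]

theorem exists_tendsto_integral_multiples_of_injective {Q : Type*} [Field Q] [Algebra K Q]
    [Algebra B Q] [IsScalarTower K B Q] (hinjQ : Function.Injective (algebraMap B Q)) (hfin : ∀ n, FiniteDimensional K (𝒜 n)) {e N D : ℕ}
    {x : Fin (e + 1) → B} (hN : 0 < N) (hx : ∀ i, x i ∈ 𝒜 N) (hxi : AlgebraicIndependent K x)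
    (hgen : ∀ n ≥ D, ∀ b ∈ 𝒜 n, ∃ c : Fin (e + 1) → B, (∀ i, c i ∈ 𝒜 (n - N)) ∧
      b = ∑ i, x i * c i)
    {Φ : ℕ → ℝ → Submodule K B} {n₀ : ℕ} {M : ℝ} (hM : 0 ≤ M) (hΦ : IsMulFiltration 𝒜 Φ n₀ M) :
    (∃ l : ℝ, Tendsto (fun n : ℕ => (∫ s in (0 : ℝ)..M * (N * n : ℕ),
        (Module.finrank K (Φ (N * n) s) : ℝ)) /
      (n * Module.finrank K (𝒜 (N * n)))) atTop (𝓝 l)) ∧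
    Tendsto (fun n : ℕ => (Module.finrank K (𝒜 (N * (n + 1))) : ℝ) /
      Module.finrank K (𝒜 (N * n))) atTop (𝓝 1) := by
  have hxQ : AlgebraicIndependent K (fun i => algebraMap B Q (x i)) :=
    hxi.map' (f := IsScalarTower.toAlgHom K B Q) hinjQ
  have hy := algebraicIndependent_succ_div hxQ
  rw [algebraicIndependent_iff_injective_aeval] at hy
  obtain ⟨ψ, hψ⟩ := exists_algHom_ratFun hy
  let _ : Algebra (RatFun K e) Q := ψ.toRingHom.toAlgebra
  have : IsScalarTower K (RatFun K e) Q :=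
    IsScalarTower.of_algebraMap_eq fun c => (ψ.commutes c).symm
  refine exists_tendsto_integral_multiples_of_ratFun hinjQ hfin hN hx (hxi.ne_zero 0) (fun i => ?_)
    hgen hM hΦ
  exact (hψ _).trans (MvPolynomial.aeval_X _ _)

/-- Convergence of the normalized integrals for a multiplicative filtration of a graded domain,
along the multiples of the degree of a homogeneous system of parameters. -/
theorem exists_tendsto_integral_multiples (hfin : ∀ n, FiniteDimensional K (𝒜 n)) {e N D : ℕ}
    {x : Fin (e + 1) → B} (hN : 0 < N) (hx : ∀ i, x i ∈ 𝒜 N) (hxi : AlgebraicIndependent K x)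
    (hgen : ∀ n ≥ D, ∀ b ∈ 𝒜 n, ∃ c : Fin (e + 1) → B, (∀ i, c i ∈ 𝒜 (n - N)) ∧
      b = ∑ i, x i * c i)
    {Φ : ℕ → ℝ → Submodule K B} {n₀ : ℕ} {M : ℝ} (hM : 0 ≤ M) (hΦ : IsMulFiltration 𝒜 Φ n₀ M) :
    (∃ l : ℝ, Tendsto (fun n : ℕ => (∫ s in (0 : ℝ)..M * (N * n : ℕ),
        (Module.finrank K (Φ (N * n) s) : ℝ)) /
      (n * Module.finrank K (𝒜 (N * n)))) atTop (𝓝 l)) ∧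
    Tendsto (fun n : ℕ => (Module.finrank K (𝒜 (N * (n + 1))) : ℝ) /
      Module.finrank K (𝒜 (N * n))) atTop (𝓝 1) := by
  exact exists_tendsto_integral_multiples_of_injective (IsFractionRing.injective B (FractionRing B))
    hfin hN hx hxi hgen hM hΦ

end Dehomogenize

/-! ### From multiples of a fixed degree to all degrees -/

section Multiples

theorem tendsto_natDiv_add_div {N : ℕ} (hN : 0 < N) (c : ℤ) :
    Tendsto (fun n : ℕ => (((n / N : ℕ) : ℝ) + c) / n) atTop (𝓝 (1 / N)) := by
  have h0 : Tendsto (fun n : ℕ => (1 : ℝ) / n) atTop (𝓝 0) := tendsto_one_div_atTop_nhds_zero_nat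
  have h1 : Tendsto (fun n : ℕ => (1 : ℝ) / N + ((c : ℝ) - 1) * (1 / n)) atTop (𝓝 (1 / N)) := by
    simpa using (h0.const_mul ((c : ℝ) - 1)).const_add (1 / N : ℝ)
  have h2 : Tendsto (fun n : ℕ => (1 : ℝ) / N + (c : ℝ) * (1 / n)) atTop (𝓝 (1 / N)) := by
    simpa using (h0.const_mul (c : ℝ)).const_add (1 / N : ℝ)
  have hN' : (0 : ℝ) < N := by exact_mod_cast hN
  refine tendsto_of_tendsto_of_tendsto_of_le_of_le' h1 h2 ?_ ?_
  · filter_upwards [eventually_gt_atTop 0] with n hn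
    have hn' : (0 : ℝ) < n := by exact_mod_cast hn
    have h3 : (n : ℝ) ≤ N * ((n / N : ℕ) + 1) := by
      exact_mod_cast (Nat.lt_mul_div_succ n hN).le
    rw [le_div_iff₀ hn']
    have h4 : (n : ℝ) / N ≤ (n / N : ℕ) + 1 := by rw [div_le_iff₀ hN']; linarith
    have h5 : ((1 : ℝ) / N + ((c : ℝ) - 1) * (1 / n)) * n = n / N + (c - 1) := by field_simp
    rw [h5]; linarith
  · filter_upwards [eventually_gt_atTop 0] with n hn
    have hn' : (0 : ℝ) < n := by exact_mod_cast hn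
    rw [div_le_iff₀ hn']
    have h4 : ((n / N : ℕ) : ℝ) ≤ n / N := Nat.cast_div_le
    have h5 : ((1 : ℝ) / N + (c : ℝ) * (1 / n)) * n = n / N + c := by field_simp
    rw [h5]; linarith

/-- Degree `n` is squeezed between the multiples `N (n / N - c)` and `N (n / N + c)`. The values of
`d` there have ratio tending to `1`, and `I` and `d` are monotone along these jumps. -/
theorem tendsto_div_of_multiples {I d : ℕ → ℝ} {N J : ℕ} {l : ℝ} (hN : 0 < N)
    (hI0 : ∀ n, 0 ≤ I n) (hI : ∀ n ≥ J, ∀ j ≥ J, I n ≤ I (n + j))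
    (hd0 : ∀ n ≥ J, 0 < d n) (hd : ∀ n ≥ J, ∀ j ≥ J, d n ≤ d (n + j))
    (h1 : Tendsto (fun n : ℕ => I (N * n) / (n * d (N * n))) atTop (𝓝 l))
    (h2 : Tendsto (fun n : ℕ => d (N * (n + 1)) / d (N * n)) atTop (𝓝 1)) :
    Tendsto (fun n : ℕ => I n / (n * d n)) atTop (𝓝 (l / N)) := by
  have hr : ∀ c : ℕ, Tendsto (fun n : ℕ => d (N * (n + c)) / d (N * n)) atTop (𝓝 1) := by
    intro c
    induction c with
    | zero =>
      refine tendsto_const_nhds.congr' ?_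
      filter_upwards [eventually_ge_atTop J] with n hn
      rw [add_zero, div_self (hd0 _ (by nlinarith)).ne']
    | succ c ih =>
      have h3 := (h2.comp (tendsto_add_atTop_nat c)).mul ih
      rw [mul_one] at h3
      refine h3.congr' ?_
      filter_upwards [eventually_ge_atTop J] with n hn
      have := (hd0 (N * (n + c)) (by nlinarith)).ne'
      simp only [Function.comp, ← add_assoc]
      field_simp
  -- Monotonicity is only known for jumps of size at least `J`; this margin guarantees it on both
  -- sides, whatever the remainder of `n`.
  set c := J + 1 with hc
  have hdiv : Tendsto (fun n : ℕ => n / N) atTop atTop := Nat.tendsto_div_const_atTop hN.ne'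
  have hlow : Tendsto (fun n : ℕ => n / N - c) atTop atTop := (tendsto_sub_atTop_nat c).comp hdiv
  have hhigh : Tendsto (fun n : ℕ => n / N + c) atTop atTop := (tendsto_add_atTop_nat c).comp hdiv
  have hL : Tendsto (fun n : ℕ => I (N * (n / N - c)) / (n * d (N * (n / N + c)))) atTop
      (𝓝 (l / N)) := by
    have h3 := ((h1.comp hlow).mul (tendsto_natDiv_add_div hN (-c))).div
      ((hr (2 * c)).comp hlow) one_ne_zero
    rw [div_one, mul_one_div] at h3
    refine h3.congr' ?_
    filter_upwards [hdiv.eventually_ge_atTop (c + J + 1)] with n hn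
    obtain ⟨k, hk⟩ := Nat.exists_eq_add_of_le hn
    have e1 : n / N - c = J + 1 + k := by omega
    have e2 : n / N + c = J + 1 + k + 2 * c := by omega
    have e3 : ((n / N : ℕ) : ℝ) + ((-c : ℤ) : ℝ) = ((J + 1 + k : ℕ) : ℝ) := by
      rw [hk]; push_cast; ring
    simp only [Pi.div_apply, Function.comp, e3, e1, e2]
    have p1 := (hd0 (N * (J + 1 + k)) (by nlinarith)).ne'
    have p2 := (hd0 (N * (J + 1 + k + 2 * c)) (by nlinarith)).ne'
    have p3 : ((J + 1 + k : ℕ) : ℝ) ≠ 0 := by positivity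
    field_simp
  have hH : Tendsto (fun n : ℕ => I (N * (n / N + c)) / (n * d (N * (n / N - c)))) atTop
      (𝓝 (l / N)) := by
    have h3 := ((h1.comp hhigh).mul (tendsto_natDiv_add_div hN c)).mul
      ((hr (2 * c)).comp hlow)
    rw [mul_one, mul_one_div] at h3
    refine h3.congr' ?_
    filter_upwards [hdiv.eventually_ge_atTop (c + J + 1)] with n hn
    obtain ⟨k, hk⟩ := Nat.exists_eq_add_of_le hn
    have e1 : n / N - c = J + 1 + k := by omega
    have e2 : n / N + c = J + 1 + k + 2 * c := by omega
    have e3 : ((n / N : ℕ) : ℝ) + ((c : ℤ) : ℝ) = ((J + 1 + k + 2 * c : ℕ) : ℝ) := by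
      rw [hk]; push_cast; ring
    simp only [Function.comp, e3, e1, e2]
    have p1 := (hd0 (N * (J + 1 + k)) (by nlinarith)).ne'
    have p2 := (hd0 (N * (J + 1 + k + 2 * c)) (by nlinarith)).ne'
    have p3 : ((J + 1 + k + 2 * c : ℕ) : ℝ) ≠ 0 := by positivity
    field_simp
  refine tendsto_of_tendsto_of_tendsto_of_le_of_le' hL hH ?_ ?_
  all_goals
    filter_upwards [hdiv.eventually_ge_atTop (c + J + 1), eventually_gt_atTop (J + N)] with n hn hnJ
    have hn0 : (0 : ℝ) < n := by exact_mod_cast (by omega : 0 < n)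
    have hmod := Nat.div_add_mod n N
    have hlt := Nat.mod_lt n hN
    have hNc : J + N ≤ N * c := by rw [hc]; nlinarith
    have hNm : N * (n / N - c) + N * c = N * (n / N) := by
      rw [← mul_add, Nat.sub_add_cancel (by omega)]
    have hJ : J ≤ N * (n / N - c) := by
      have : J ≤ n / N - c := by omega
      nlinarith
    have u1 : n = N * (n / N - c) + (N * c + n % N) := by omega
    have u2 : N * (n / N + c) = n + (N * c - n % N) := by rw [mul_add]; omega
    have i1 : I (N * (n / N - c)) ≤ I n := by
      conv_rhs => rw [u1]
      exact hI _ hJ _ (by omega)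
    have i2 : d (N * (n / N - c)) ≤ d n := by
      conv_rhs => rw [u1]
      exact hd _ hJ _ (by omega)
    have i3 : I n ≤ I (N * (n / N + c)) := by
      rw [u2]
      exact hI _ (by omega) _ (by omega)
    have i4 : d n ≤ d (N * (n / N + c)) := by
      rw [u2]
      exact hd _ (by omega) _ (by omega)
    have := hd0 _ hJ
    have := hd0 n (by omega)
  · exact div_le_div₀ (hI0 n) i1 (by positivity) (by gcongr)
  · exact div_le_div₀ (hI0 _) i3 (by positivity) (by gcongr)

variable {K : Type*} [Field K] {B : Type*} [CommRing B] [IsDomain B] [Algebra K B]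
  [Algebra.FiniteType K B] {𝒜 : ℕ → Submodule K B} [GradedAlgebra 𝒜]

/-- Convergence of the normalized integrals for a multiplicative filtration of a graded domain
of finite type. -/
theorem IsMulFiltration.exists_tendsto_integral_graded (hfin : ∀ n, FiniteDimensional K (𝒜 n))
    (hne : ∀ᶠ n in atTop, 𝒜 n ≠ ⊥) {Φ : ℕ → ℝ → Submodule K B} {n₀ : ℕ} {M : ℝ} (hM : 0 ≤ M)
    (hΦ : IsMulFiltration 𝒜 Φ n₀ M) :
    ∃ l : ℝ, Tendsto (fun n : ℕ => (∫ s in (0 : ℝ)..M * n, (Module.finrank K (Φ n s) : ℝ)) /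
      (n * Module.finrank K (𝒜 n))) atTop (𝓝 l) := by
  obtain ⟨e, N, D, x, -, hN, hx, hxi, hgen⟩ := exists_homogeneous_noether_normalization hfin hne 0
  obtain ⟨⟨l, hl⟩, h2⟩ := exists_tendsto_integral_multiples hfin hN hx hxi hgen hM hΦ
  obtain ⟨J₀, hJ₀⟩ := eventually_atTop.1 hne
  have hfinΦ : ∀ n s, FiniteDimensional K (Φ n s) := fun n s =>
    have := hfin n
    Submodule.finiteDimensional_of_le (hΦ.le n s)
  -- Multiplication by such a `u` is injective. In degrees at least `n₀` it has level `0`, so it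
  -- also embeds each filtration step into the step of the same level in the higher degree.
  have hmul : ∀ j ≥ max J₀ n₀, ∃ u : B, u ≠ 0 ∧ u ∈ 𝒜 j := fun j hj => by
    obtain ⟨u, hu, hu0⟩ := Submodule.exists_mem_ne_zero_of_ne_bot (hJ₀ j (le_of_max_le_left hj))
    exact ⟨u, hu0, hu⟩
  have hle : ∀ {u : B} (U V : Submodule K B) [FiniteDimensional K V], u ≠ 0 →
      (∀ x ∈ U, u * x ∈ V) → Module.finrank K U ≤ Module.finrank K V := by
    intro u U V _ hu hUV
    refine LinearMap.finrank_le_finrank_of_injective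
      (f := (LinearMap.mulLeft K u).restrict hUV) fun x y hxy => ?_
    exact Subtype.ext (mul_left_cancel₀ hu (Subtype.ext_iff.1 hxy))
  refine ⟨l / N, tendsto_div_of_multiples (J := max J₀ n₀)
    (I := fun n => ∫ s in (0 : ℝ)..M * n, (Module.finrank K (Φ n s) : ℝ))
    (d := fun n => (Module.finrank K (𝒜 n) : ℝ)) hN (fun n => ?_) ?_ ?_ ?_ hl h2⟩
  · exact intervalIntegral.integral_nonneg (by positivity) fun _ _ => by positivity
  · intro n hn j hj
    obtain ⟨u, hu0, hu⟩ := hmul j hj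
    have hint := fun n a c => hΦ.intervalIntegrable hfin n a c
    have h3 : ∫ s in (0 : ℝ)..M * n, (Module.finrank K (Φ n s) : ℝ) ≤
        ∫ s in (0 : ℝ)..M * n, (Module.finrank K (Φ (n + j) s) : ℝ) := by
      refine intervalIntegral.integral_mono_on (by positivity) (hint _ _ _) (hint _ _ _) ?_
      intro s _
      refine Nat.cast_le.2 (hle _ _ hu0 fun x hx => ?_)
      have h4 : u ∈ Φ j 0 := by rwa [hΦ.eq_of_nonpos j (le_of_max_le_right hj) 0 le_rfl]
      have := hΦ.mul_mem j (le_of_max_le_right hj) n (le_of_max_le_right hn) 0 s u h4 x hx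
      rwa [zero_add, add_comm j n] at this
    refine h3.trans ?_
    refine intervalIntegral.integral_mono_interval le_rfl (by positivity) ?_
      (ae_of_all _ fun _ => by positivity) (hint _ _ _)
    push_cast
    nlinarith [mul_nonneg hM (Nat.cast_nonneg (α := ℝ) j)]
  · intro n hn
    have := hfin n
    obtain ⟨u, hu0, hu⟩ := hmul n hn
    have h0 : 𝒜 n ≠ ⊥ := (Submodule.ne_bot_iff _).2 ⟨u, hu, hu0⟩
    exact_mod_cast Submodule.one_le_finrank_iff.2 h0
  · intro n hn j hj
    obtain ⟨u, hu0, hu⟩ := hmul j hj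
    have := hfin (n + j)
    refine Nat.cast_le.2 (hle _ _ hu0 fun x hx => ?_)
    rw [add_comm n j]
    exact SetLike.mul_mem_graded hu hx

end Multiples

/-! ### From quasi-filtrations to multiplicative filtrations -/

section Envelope

variable {K : Type*} [Field K] {B : Type*} [CommRing B] [Algebra K B]

/-- Products of elements of a filtered graded algebra of degrees at least `n₀`, with the
corresponding degree and a lower bound for the sum of the indices corrected by `f`. -/
def IsFiltrationProd (F : ℕ → ℝ → Submodule K B) (f : ℕ → ℝ≥0) (n₀ n : ℕ) (s : ℝ) (b : B) : Prop :=
  ∃ r > 0, ∃ (m : Fin r → ℕ) (t : Fin r → ℝ) (a : Fin r → B),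
    (∀ i, n₀ ≤ m i) ∧ (∀ i, a i ∈ F (m i) (t i)) ∧ ∑ i, m i = n ∧
      s ≤ ∑ i, (t i - (f (m i) : ℝ)) ∧ b = ∏ i, a i

/-- The superadditive envelope of a filtration. -/
def envelope (F : ℕ → ℝ → Submodule K B) (f : ℕ → ℝ≥0) (n₀ n : ℕ) (s : ℝ) : Submodule K B :=
  Submodule.span K {b | IsFiltrationProd F f n₀ n s b}

/-- The family of subspaces is quasi-filtered in degrees at least `n₀`. -/
def QuasiMul (F : ℕ → ℝ → Submodule K B) (f : ℕ → ℝ≥0) (n₀ : ℕ) : Prop :=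
  ∀ r : ℕ, 0 < r → ∀ (n : Fin r → ℕ) (s : Fin r → ℝ), (∀ i, n₀ ≤ n i) → ∀ a : Fin r → B,
    (∀ i, a i ∈ F (n i) (s i)) → ∏ i, a i ∈ F (∑ i, n i) (∑ i, (s i - (f (n i) : ℝ)))

variable {F : ℕ → ℝ → Submodule K B} {f : ℕ → ℝ≥0} {n₀ : ℕ}

theorem IsFiltrationProd.mul {m n : ℕ} {s t : ℝ} {x y : B} (hx : IsFiltrationProd F f n₀ m s x)
    (hy : IsFiltrationProd F f n₀ n t y) : IsFiltrationProd F f n₀ (m + n) (s + t) (x * y) := by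
  obtain ⟨r, hr, m₁, t₁, a₁, h₁, h₁', rfl, hs₁, rfl⟩ := hx
  obtain ⟨q, hq, m₂, t₂, a₂, h₂, h₂', rfl, hs₂, rfl⟩ := hy
  refine ⟨r + q, by omega, Fin.append m₁ m₂, Fin.append t₁ t₂, Fin.append a₁ a₂, ?_, ?_, ?_, ?_, ?_⟩
  · refine Fin.addCases (fun i => ?_) (fun i => ?_) <;> simp [h₁, h₂]
  · refine Fin.addCases (fun i => ?_) (fun i => ?_) <;> simp [h₁', h₂']
  · simp [Fin.sum_univ_add]
  · simp only [Fin.sum_univ_add, Fin.append_left, Fin.append_right]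
    exact add_le_add hs₁ hs₂
  · simp [Fin.prod_univ_add]

theorem envelope_antitone (n : ℕ) : Antitone (envelope F f n₀ n) := by
  intro s t hst
  refine Submodule.span_mono ?_
  rintro b ⟨r, hr, m, u, a, h1, h2, h3, h4, h5⟩
  exact ⟨r, hr, m, u, a, h1, h2, h3, hst.trans h4, h5⟩

theorem envelope_le (hanti : ∀ n, Antitone (F n)) (hq : QuasiMul F f n₀) (n : ℕ) (s : ℝ) :
    envelope F f n₀ n s ≤ F n s := by
  refine Submodule.span_le.2 ?_
  rintro b ⟨r, hr, m, u, a, h1, h2, rfl, h4, rfl⟩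
  exact hanti _ h4 (hq r hr m u h1 a h2)

/-- Products with a single factor suffice. Together with `envelope_le`, this traps the envelope
between `F` and its shift by `f n`. -/
theorem le_envelope {n : ℕ} (hn : n₀ ≤ n) (s : ℝ) : F n (s + f n) ≤ envelope F f n₀ n s := by
  intro x hx
  refine Submodule.subset_span ⟨1, one_pos, fun _ => n, fun _ => s + f n, fun _ => x,
    fun _ => hn, fun _ => hx, by simp, by simp, by simp⟩

theorem mul_mem_envelope {m n : ℕ} {s t : ℝ} {x y : B} (hx : x ∈ envelope F f n₀ m s)
    (hy : y ∈ envelope F f n₀ n t) : x * y ∈ envelope F f n₀ (m + n) (s + t) := by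
  have : x * y ∈ envelope F f n₀ m s * envelope F f n₀ n t := Submodule.mul_mem_mul hx hy
  rw [envelope, envelope, Submodule.span_mul_span] at this
  refine Submodule.span_mono ?_ this
  rintro _ ⟨a, ha, b, hb, rfl⟩
  exact IsFiltrationProd.mul ha hb

variable {𝒜 : ℕ → Submodule K B}

/-- The indices have a linear lower bound: a slope is chosen to serve the finitely many degrees up
to `L`. Beyond them, an element is a combination of the `x i` with coefficients in degree `n - N`,
and the linear bounds add. -/
theorem exists_envelope_eq (hn₀ : 0 < n₀) (hanti : ∀ n, Antitone (F n))
    (hq : QuasiMul F f n₀) (hle : ∀ n s, F n s ≤ 𝒜 n) (hexh : ∀ n ≥ n₀, ∃ t, F n t = 𝒜 n)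
    {e N D : ℕ} {x : Fin (e + 1) → B} (hN : n₀ ≤ N) (hx : ∀ i, x i ∈ 𝒜 N)
    (hgen : ∀ n ≥ D, ∀ b ∈ 𝒜 n, ∃ c : Fin (e + 1) → B, (∀ i, c i ∈ 𝒜 (n - N)) ∧
      b = ∑ i, x i * c i) :
    ∃ a : ℝ, ∀ n ≥ n₀, envelope F f n₀ n (a * n) = 𝒜 n := by
  choose! t ht using hexh
  have h1 : ∀ n ≥ n₀, 𝒜 n ≤ envelope F f n₀ n (t n - f n) := fun n hn => by
    have := le_envelope (F := F) (f := f) hn (t n - f n)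
    rwa [sub_add_cancel, ht n hn] at this
  -- Beyond `L`, the generation hypothesis applies and `n - N` is still at least `n₀`.
  set L := D + N + n₀
  -- As `a ≤ 0` and `n ≥ 1`, `a * n ≤ a`, which is below every `t n - f n` with `n ≤ L`.
  set a : ℝ := -∑ n ∈ Finset.range (L + 1), |t n - f n| with ha
  have ha0 : a ≤ 0 := neg_nonpos.2 (Finset.sum_nonneg fun _ _ => abs_nonneg _)
  have h2 : ∀ n ≤ L, n₀ ≤ n → a * n ≤ t n - f n := by
    intro n hn hn'
    have h3 : |t n - f n| ≤ ∑ n ∈ Finset.range (L + 1), |t n - f n| :=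
      Finset.single_le_sum (f := fun n => |t n - f n|) (fun _ _ => abs_nonneg _)
        (Finset.mem_range.2 (by omega))
    have h4 : (1 : ℝ) ≤ n := by exact_mod_cast (by omega : 1 ≤ n)
    have h5 := neg_abs_le (t n - f n)
    nlinarith
  refine ⟨a, fun n hn => le_antisymm ((envelope_le hanti hq _ _).trans (hle _ _)) ?_⟩
  induction n using Nat.strong_induction_on with
  | _ n ih =>
  rcases le_or_gt n L with hnL | hnL
  · exact (h1 n hn).trans (envelope_antitone n (h2 n hnL hn))
  · intro b hb
    obtain ⟨c, hc, rfl⟩ := hgen n (by omega) b hb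
    refine sum_mem fun i _ => ?_
    have hxi := (h1 N hN).trans (envelope_antitone N (h2 N (by omega) hN)) (hx i)
    have hci := ih (n - N) (by omega) (by omega) (hc i)
    have := mul_mem_envelope hxi hci
    rw [← mul_add, ← Nat.cast_add, Nat.add_sub_cancel' (by omega)] at this
    exact this

/-- A filtration cut off at slope `C`, after a shift by the slope `a`. -/
noncomputable def cutoff (F : ℕ → ℝ → Submodule K B) (a C : ℝ) (n : ℕ) (s : ℝ) : Submodule K B :=
  open Classical in if s ≤ C * n then F n (s + a * n) else ⊥

/-- The truncation bound `C * n` is additive in the degree, so truncating does not destroy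
multiplicativity. -/
theorem isMulFiltration_cutoff (hanti : ∀ n, Antitone (F n)) (hle : ∀ n s, F n s ≤ 𝒜 n)
    (hmul : ∀ m ≥ n₀, ∀ n ≥ n₀, ∀ s t : ℝ, ∀ x ∈ F m s, ∀ y ∈ F n t, x * y ∈ F (m + n) (s + t))
    {a : ℝ} (ha : ∀ n ≥ n₀, F n (a * n) = 𝒜 n) {C : ℝ} (hC : 0 ≤ C) :
    IsMulFiltration 𝒜 (cutoff F a C) n₀ C := by
  classical
  refine ⟨fun n s t hst => ?_, fun n s => ?_, fun n hn s hs => ?_, fun n hn s hs => ?_, ?_⟩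
  · unfold cutoff
    split_ifs with h1 h2
    · exact hanti n (by linarith)
    · exact absurd (hst.trans h1) h2
    · exact bot_le
    · exact le_rfl
  · unfold cutoff
    split_ifs
    · exact hle _ _
    · exact bot_le
  · have : s ≤ C * n := hs.trans (by positivity)
    rw [cutoff, if_pos this]
    refine le_antisymm (hle _ _) ?_
    rw [← ha n hn]
    exact hanti n (by linarith)
  · rw [cutoff, if_neg (not_le.2 hs)]
  · intro m hm n hn s t x hx y hy
    unfold cutoff at hx hy ⊢
    split_ifs at hx hy with h1 h2
    · rw [if_pos (by push_cast; linarith)]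
      have := hmul m hm n hn _ _ x hx y hy
      rwa [show s + a * m + (t + a * n) = s + t + a * ((m + n : ℕ) : ℝ) by push_cast; ring] at this
    · rw [(Submodule.mem_bot K).1 hy, mul_zero]; exact zero_mem _
    · rw [(Submodule.mem_bot K).1 hx, zero_mul]; exact zero_mem _
    · rw [(Submodule.mem_bot K).1 hx, zero_mul]; exact zero_mem _

/-- The shifted integral lives on a translated interval. The overlap cancels, leaving two end
intervals of length `u`, one of which only helps. -/
theorem integral_sub_integral_shift_le {g : ℝ → ℝ} (hg : Antitone g) {d u a c : ℝ} (hu : 0 ≤ u)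
    (hg0 : ∀ x, 0 ≤ g x) (hgd : ∀ x, g x ≤ d) :
    (∫ s in a..c, g s) - ∫ s in a..c, g (s + u) ≤ u * d := by
  have hint : ∀ p q, IntervalIntegrable g volume p q := fun p q => hg.intervalIntegrable
  rw [intervalIntegral.integral_comp_add_right]
  have h1 := intervalIntegral.integral_add_adjacent_intervals (hint a c) (hint c (c + u))
  have h2 := intervalIntegral.integral_add_adjacent_intervals (hint a (a + u)) (hint (a + u) (c + u))
  have h3 : 0 ≤ ∫ s in c..c + u, g s :=
    intervalIntegral.integral_nonneg (by linarith) fun x _ => hg0 x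
  have h4 : ∫ s in a..a + u, g s ≤ ∫ s in a..a + u, d :=
    intervalIntegral.integral_mono_on (by linarith) (hint _ _) (by simp) fun x _ => hgd x
  rw [intervalIntegral.integral_const, smul_eq_mul] at h4
  linarith [show (a + u - a) * d = u * d by ring]

variable [IsDomain B] [Algebra.FiniteType K B] [GradedAlgebra 𝒜]

/-- Each `c` uses its own truncation of the envelope, at slope `c - a` after the shift by `a`.
Replacing the envelope by `F` changes the normalized integral by at most `f n / n`. -/
theorem exists_tendsto_integral_of_quasiMul (hfin : ∀ n, FiniteDimensional K (𝒜 n))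
    (hne : ∀ᶠ n in atTop, 𝒜 n ≠ ⊥) (hn₀ : 0 < n₀) (hanti : ∀ n, Antitone (F n))
    (hq : QuasiMul F f n₀) (hle : ∀ n s, F n s ≤ 𝒜 n) (hexh : ∀ n ≥ n₀, ∃ t, F n t = 𝒜 n)
    (hf : Tendsto (fun n : ℕ => (f n : ℝ) / n) atTop (𝓝 0)) :
    ∃ a : ℝ, (∀ n ≥ n₀, F n (a * n) = 𝒜 n) ∧ ∀ c ≥ a, ∃ l : ℝ,
      Tendsto (fun n : ℕ => ∫ x in a..c, (Module.finrank K (F n (n * x)) : ℝ) /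
        Module.finrank K (𝒜 n)) atTop (𝓝 l) := by
  obtain ⟨e, N, D, x, hN, -, hx, -, hgen⟩ := exists_homogeneous_noether_normalization hfin hne n₀
  obtain ⟨a, ha⟩ := exists_envelope_eq hn₀ hanti hq hle hexh hN hx hgen
  refine ⟨a, fun n hn => le_antisymm (hle _ _) ?_, fun c hc => ?_⟩
  · rw [← ha n hn]; exact envelope_le hanti hq _ _
  have hle' : ∀ n s, envelope F f n₀ n s ≤ 𝒜 n := fun n s =>
    (envelope_le hanti hq _ _).trans (hle _ _)
  have hcut := isMulFiltration_cutoff (n₀ := n₀) (𝒜 := 𝒜) (F := envelope F f n₀) (C := c - a)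
    envelope_antitone hle' (fun m _ n _ s t x hx y hy => mul_mem_envelope hx hy) ha
    (sub_nonneg.2 hc)
  obtain ⟨l, hl⟩ := hcut.exists_tendsto_integral_graded hfin hne (sub_nonneg.2 hc)
  have hfin1 : ∀ n s, FiniteDimensional K (F n s) := fun n s =>
    have := hfin n
    Submodule.finiteDimensional_of_le (hle n s)
  have hfin2 : ∀ n s, FiniteDimensional K (envelope F f n₀ n s) := fun n s =>
    have := hfin n
    Submodule.finiteDimensional_of_le (hle' n s)
  have hg1 : ∀ n, Antitone fun s => (Module.finrank K (F n s) : ℝ) := fun n s t hst =>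
    Nat.cast_le.2 (Submodule.finrank_mono (hanti n hst))
  have hg2 : ∀ n, Antitone fun s => (Module.finrank K (envelope F f n₀ n s) : ℝ) :=
    fun n s t hst => Nat.cast_le.2 (Submodule.finrank_mono (envelope_antitone n hst))
  refine ⟨l, ?_⟩
  have key : ∀ᶠ n : ℕ in atTop,
      (∫ s in (0 : ℝ)..(c - a) * n, (Module.finrank K (cutoff (envelope F f n₀) a (c - a) n s) : ℝ))
        / (n * Module.finrank K (𝒜 n)) ≤ (∫ x in a..c, (Module.finrank K (F n (n * x)) : ℝ) /
        Module.finrank K (𝒜 n)) ∧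
      (∫ x in a..c, (Module.finrank K (F n (n * x)) : ℝ) / Module.finrank K (𝒜 n)) ≤
      (∫ s in (0 : ℝ)..(c - a) * n, (Module.finrank K (cutoff (envelope F f n₀) a (c - a) n s) : ℝ))
        / (n * Module.finrank K (𝒜 n)) + f n / n := by
    filter_upwards [hne, eventually_ge_atTop n₀] with n hn hnn
    have hn' : (0 : ℝ) < n := by exact_mod_cast (by omega : 0 < n)
    have hd : (0 : ℝ) < Module.finrank K (𝒜 n) := by
      have := hfin n
      exact_mod_cast Submodule.one_le_finrank_iff.2 hn
    -- On the interval of integration the truncation has no effect, and only the shift by `a * n`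
    -- remains.
    have e1 : (∫ s in (0 : ℝ)..(c - a) * n,
        (Module.finrank K (cutoff (envelope F f n₀) a (c - a) n s) : ℝ)) =
        ∫ s in (a * n)..(c * n), (Module.finrank K (envelope F f n₀ n s) : ℝ) := by
      have h1 := intervalIntegral.integral_comp_add_right (a := 0) (b := (c - a) * n)
        (fun s => (Module.finrank K (envelope F f n₀ n s) : ℝ)) (a * n)
      rw [zero_add, ← add_mul, sub_add_cancel] at h1
      rw [← h1]
      refine intervalIntegral.integral_congr fun s hs => ?_
      rw [uIcc_of_le (mul_nonneg (sub_nonneg.2 hc) hn'.le)] at hs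
      have h2 : cutoff (envelope F f n₀) a (c - a) n s = envelope F f n₀ n (s + a * n) :=
        if_pos hs.2
      rw [h2]
    have e2 : (∫ x in a..c, (Module.finrank K (F n (n * x)) : ℝ) / Module.finrank K (𝒜 n)) =
        (∫ s in (a * n)..(c * n), (Module.finrank K (F n s) : ℝ)) /
          (n * Module.finrank K (𝒜 n)) := by
      rw [intervalIntegral.integral_div, intervalIntegral.integral_comp_mul_left
        (fun s => (Module.finrank K (F n s) : ℝ)) hn'.ne', smul_eq_mul, mul_comm (n : ℝ) a,
        mul_comm (n : ℝ) c]
      field_simp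
    have hacn : a * n ≤ c * n := mul_le_mul_of_nonneg_right hc hn'.le
    rw [e1, e2]
    constructor
    · gcongr
      refine intervalIntegral.integral_mono_on hacn (hg2 n).intervalIntegrable
        (hg1 n).intervalIntegrable fun s _ => ?_
      exact_mod_cast Submodule.finrank_mono (envelope_le hanti hq n s)
    · have h1 := integral_sub_integral_shift_le (hg1 n) (u := f n) (a := a * n) (c := c * n)
        (d := Module.finrank K (𝒜 n)) (f n).2 (fun _ => by positivity) (fun s => by
          have := hfin n
          exact_mod_cast Submodule.finrank_mono (hle n s))
      have h2 : ∫ s in (a * n)..(c * n), (Module.finrank K (F n (s + f n)) : ℝ) ≤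
          ∫ s in (a * n)..(c * n), (Module.finrank K (envelope F f n₀ n s) : ℝ) := by
        refine intervalIntegral.integral_mono_on hacn ?_ (hg2 n).intervalIntegrable fun s _ => ?_
        · exact Antitone.intervalIntegrable fun s t hst => hg1 n (by linarith)
        · exact_mod_cast Submodule.finrank_mono (le_envelope hnn s)
      rw [div_add_div _ _ (by positivity) hn'.ne', div_le_div_iff₀ (by positivity) (by positivity)]
      have h3 : (∫ s in (a * n)..(c * n), (Module.finrank K (F n s) : ℝ)) ≤
          (∫ s in (a * n)..(c * n), (Module.finrank K (envelope F f n₀ n s) : ℝ)) +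
            f n * Module.finrank K (𝒜 n) := by linarith
      have h4 : (0 : ℝ) ≤ n * Module.finrank K (𝒜 n) * n := by positivity
      nlinarith [mul_le_mul_of_nonneg_right h3 h4]
  refine tendsto_of_tendsto_of_tendsto_of_le_of_le' hl ?_ (key.mono fun n h => h.1)
    (key.mono fun n h => h.2)
  simpa using hl.add hf

end Envelope

/-! ### Adapted bases and the measure of a filtration -/

section AdaptedBasis

variable {K V : Type*} [Field K] [AddCommGroup V] [Module K V]

/-- Among the steps different from `T` there is a largest one. A family adapted to the filtration
induced there extends to a basis of `T`, and stays adapted because every other step is either `T` or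
already inside. -/
theorem exists_adapted_linearIndepOn [FiniteDimensional K V] {ι : Type*} [LinearOrder ι] (T : Submodule K V)
    (F : ι → Submodule K V) (hF : Antitone F) (hT : ∀ r, F r ≤ T) :
    ∃ S : Set V, LinearIndepOn K id S ∧ Submodule.span K S = T ∧
      ∀ r, Submodule.span K (S ∩ F r) = F r := by
  induction hn : Module.finrank K T using Nat.strong_induction_on generalizing T F with
  | _ n ih =>
  subst hn
  by_cases hall : ∀ r, F r = T
  · obtain ⟨S, hST, hS1, hS2⟩ := exists_linearIndependent K (T : Set V)
    rw [Submodule.span_eq] at hS1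
    refine ⟨S, hS2, hS1, fun r => ?_⟩
    rw [hall r, inter_eq_left.2 hST, hS1]
  · push Not at hall
    obtain ⟨r₀, hr₀, hmax⟩ : ∃ r₀, F r₀ ≠ T ∧ ∀ r, F r ≠ T → F r ≤ F r₀ := by
      obtain ⟨_, ⟨r₀, hr₀, rfl⟩, hmax⟩ := (wellFounded_gt (α := Submodule K V)).has_min
        {U | ∃ r, F r ≠ T ∧ F r = U} ⟨_, hall.choose, hall.choose_spec, rfl⟩
      refine ⟨r₀, hr₀, fun r hr => ?_⟩
      rcases le_total r₀ r with h | h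
      · exact hF h
      · by_contra hcon
        exact hmax _ ⟨r, hr, rfl⟩ (lt_of_le_not_ge (hF h) hcon)
    have hlt : F r₀ < T := lt_of_le_of_ne (hT r₀) hr₀
    obtain ⟨S, hS1, hS2, hS3⟩ := ih _ (Submodule.finrank_lt_finrank_of_lt hlt) (F r₀)
      (fun r => F r ⊓ F r₀) (fun r s h => inf_le_inf_right _ (hF h)) (fun r => inf_le_right) rfl
    have hST : S ⊆ (T : Set V) := fun x hx =>
      hlt.le (hS2 ▸ Submodule.subset_span hx)
    obtain ⟨S', hS'T, hSS', hTS', hS'⟩ := exists_linearIndepOn_id_extension hS1 hST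
    have hspan : Submodule.span K S' = T :=
      le_antisymm (Submodule.span_le.2 hS'T) (fun x hx => hTS' hx)
    refine ⟨S', hS', hspan, fun r => ?_⟩
    by_cases hr : F r = T
    · rw [hr, inter_eq_left.2 hS'T, hspan]
    · refine le_antisymm (Submodule.span_le.2 inter_subset_right) ?_
      have h1 := hS3 r
      rw [inf_eq_left.2 (hmax r hr)] at h1
      conv_lhs => rw [← h1]
      exact Submodule.span_mono (inter_subset_inter_left _ hSS')

namespace RFiltration

variable {F : RFiltration K V}

theorem IsSeparated.exists_sub_eq_bot [FiniteDimensional K V] (h : F.IsSeparated) :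
    ∃ r, F.sub r = ⊥ := by
  by_contra! hcon
  obtain ⟨r₀, hr₀⟩ : ∃ r₀, ∀ r, r₀ ≤ r → F.sub r = F.sub r₀ := by
    have hex : ∃ m, ∃ r, Module.finrank K (F.sub r) = m := ⟨_, 0, rfl⟩
    classical
    obtain ⟨r₀, hr₀⟩ := Nat.find_spec hex
    refine ⟨r₀, fun r hr => Submodule.eq_of_le_of_finrank_le (F.antitone_sub hr) ?_⟩
    rw [hr₀]
    exact Nat.find_min' hex ⟨r, rfl⟩
  refine hcon r₀ (le_bot_iff.1 (le_of_le_of_eq (le_iInf fun r => ?_) h))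
  rcases le_total r₀ r with hr | hr
  · exact (hr₀ r hr).ge
  · exact F.antitone_sub hr

theorem IsExhaustive.exists_mem (h : F.IsExhaustive) (x : V) : ∃ r, x ∈ F.sub r := by
  have : x ∈ ⋃ r : ℝ, (F.sub r : Set V) := by rw [h]; trivial
  simpa using this

theorem IsExhaustive.exists_sub_eq_top [FiniteDimensional K V] (h : F.IsExhaustive) :
    ∃ r, F.sub r = ⊤ := by
  obtain ⟨S, hS⟩ := (Module.Finite.fg_top : (⊤ : Submodule K V).FG)
  choose r hr using h.exists_mem
  obtain ⟨M, hM⟩ := (S.image r).bddBelow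
  refine ⟨M, top_le_iff.1 ?_⟩
  rw [← hS, Submodule.span_le]
  intro x hx
  exact F.antitone_sub (hM (Finset.mem_coe.2 (Finset.mem_image_of_mem r hx))) (hr x)

/-- Left continuity makes the supremum attained; separatedness and exhaustiveness make it finite. -/
theorem exists_index_eq [FiniteDimensional K V] (hs : F.IsSeparated) (he : F.IsExhaustive)
    (hl : F.IsLeftContinuous) {x : V} (hx : x ≠ 0) :
    ∃ l : ℝ, F.index x = l ∧ ∀ r, x ∈ F.sub r ↔ r ≤ l := by
  obtain ⟨R, hR⟩ := hs.exists_sub_eq_bot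
  have hne : {r | x ∈ F.sub r}.Nonempty := he.exists_mem x
  have hbdd : BddAbove {r | x ∈ F.sub r} := ⟨R, fun r hr => by
    by_contra! h
    have := F.antitone_sub h.le hr
    rw [hR] at this
    exact hx this⟩
  have key : ∀ r, x ∈ F.sub r ↔ r ≤ sSup {r | x ∈ F.sub r} := by
    intro r
    refine ⟨fun h => le_csSup hbdd h, fun h => F.antitone_sub h ?_⟩
    rw [hl]
    simp only [Submodule.mem_iInf]
    intro s hs
    obtain ⟨t, ht, hst⟩ := exists_lt_of_lt_csSup hne hs
    exact F.antitone_sub hst.le ht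
  refine ⟨_, le_antisymm ?_ ?_, key⟩
  · exact iSup₂_le fun r hr => EReal.coe_le_coe_iff.2 ((key r).1 hr)
  · exact le_iSup₂ (f := fun (r : ℝ) (_ : x ∈ F.sub r) => (r : EReal)) _ ((key _).2 le_rfl)

end RFiltration

theorem integral_smul_sum_dirac {ι : Type*} [Fintype ι] (c : ℝ≥0∞) (l : ι → ℝ) (g : ℝ → ℝ) :
    ∫ x, g x ∂(c • ∑ i, Measure.dirac (l i)) = c.toReal * ∑ i, g (l i) := by
  rw [integral_smul_measure, integral_finsetSum_measure fun i _ => integrable_dirac (by simp)]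
  simp [integral_dirac]

/-- Hall's theorem matches each `j` injectively with some `i` such that `l' j ≤ l i`. Hall's
condition for a set `J` is the counting hypothesis at the minimum of `l'` on `J`. -/
theorem sum_le_sum_of_card_filter_le {n : ℕ} {l l' : Fin n → ℝ}
    (h : ∀ x, (Finset.univ.filter fun i => x ≤ l' i).card ≤
      (Finset.univ.filter fun i => x ≤ l i).card) {g : ℝ → ℝ} (hg : Monotone g) :
    ∑ i, g (l' i) ≤ ∑ i, g (l i) := by
  classical
  obtain ⟨σ, hσ, hσ'⟩ := (Finset.all_card_le_biUnion_card_iff_exists_injective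
    (fun j => Finset.univ.filter fun i => l' j ≤ l i)).1 fun J => by
      rcases J.eq_empty_or_nonempty with rfl | hJ
      · simp
      · obtain ⟨j₀, hj₀, hmin⟩ := J.exists_min_image l' hJ
        refine (Finset.card_le_card fun j hj => ?_).trans ((h (l' j₀)).trans
          (Finset.card_le_card (Finset.subset_biUnion_of_mem (fun j => Finset.univ.filter
            fun i => l' j ≤ l i) hj₀)))
        exact Finset.mem_filter.2 ⟨Finset.mem_univ _, hmin j hj⟩
  rw [← (Equiv.ofBijective σ (Finite.injective_iff_bijective.1 hσ)).sum_comp fun i => g (l i)]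
  exact Finset.sum_le_sum fun j _ => hg (Finset.mem_filter.1 (hσ' j)).2

namespace RFiltration

variable {F : RFiltration K V} [FiniteDimensional K V]

/-- The real indices of the vectors of a basis. -/
theorem exists_basis_index (hs : F.IsSeparated) (he : F.IsExhaustive) (hl : F.IsLeftContinuous)
    (e : Module.Basis (Fin (Module.finrank K V)) K V) :
    ∃ l : Fin (Module.finrank K V) → ℝ, (∀ i, F.index (e i) = l i) ∧
      (∀ i r, e i ∈ F.sub r ↔ r ≤ l i) ∧
      F.basisMeasure e = (Module.finrank K V : ℝ≥0∞)⁻¹ • ∑ i, Measure.dirac (l i) := by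
  choose l hl1 hl2 using fun i => exists_index_eq hs he hl (e.ne_zero i)
  refine ⟨l, hl1, hl2, ?_⟩
  simp [basisMeasure, hl1]

theorem card_filter_le_finrank {l : Fin (Module.finrank K V) → ℝ}
    {e : Module.Basis (Fin (Module.finrank K V)) K V} (h : ∀ i r, e i ∈ F.sub r ↔ r ≤ l i)
    (x : ℝ) : (Finset.univ.filter fun i => x ≤ l i).card ≤ Module.finrank K (F.sub x) := by
  classical
  have h1 : LinearIndependent K (fun i : {i // x ≤ l i} => (⟨e i, (h i x).2 i.2⟩ : F.sub x)) := by
    refine LinearIndependent.of_comp (F.sub x).subtype ?_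
    exact e.linearIndependent.comp _ Subtype.val_injective
  have := h1.fintype_card_le_finrank
  rwa [Fintype.card_subtype] at this

theorem exists_adapted_basis (F : RFiltration K V) :
    ∃ e : Module.Basis (Fin (Module.finrank K V)) K V, ∀ x,
      Module.finrank K (F.sub x) ≤ Nat.card {i // e i ∈ F.sub x} := by
  classical
  obtain ⟨S, hS1, hS2, hS3⟩ := exists_adapted_linearIndepOn ⊤ F.sub F.antitone_sub fun _ => le_top
  let b : Module.Basis S K V := Module.Basis.mk (v := ((↑) : S → V)) hS1 (by simp [hS2])
  have hb : ∀ s, b s = s := fun s => Module.Basis.mk_apply _ _ s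
  have : Fintype S := FiniteDimensional.fintypeBasisIndex b
  let σ : S ≃ Fin (Module.finrank K V) :=
    Fintype.equivFinOfCardEq (Module.finrank_eq_card_basis b).symm
  refine ⟨b.reindex σ, fun x => ?_⟩
  have h1 : Module.finrank K (Submodule.span K (S ∩ F.sub x)) ≤ (S ∩ F.sub x).toFinset.card :=
    finrank_span_le_card _
  rw [hS3] at h1
  refine h1.trans_eq ?_
  rw [← Nat.card_eq_card_toFinset]
  refine Nat.card_congr ⟨fun y => ⟨σ ⟨y, y.2.1⟩, ?_⟩, fun i => ⟨σ.symm i, (σ.symm i).2, ?_⟩, ?_, ?_⟩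
  · have := y.2.2
    simpa [hb] using this
  · have := i.2
    simpa [hb] using this
  · intro y; simp
  · intro i; simp

/-- The measure of a filtration: it is the normalized counting measure of real numbers whose
distribution function is given by the dimensions of the filtration. -/
theorem exists_measure_eq (hs : F.IsSeparated) (he : F.IsExhaustive) (hl : F.IsLeftContinuous) :
    ∃ (e : Module.Basis (Fin (Module.finrank K V)) K V) (l : Fin (Module.finrank K V) → ℝ),
      (∀ i, F.index (e i) = l i) ∧
      F.measure = (Module.finrank K V : ℝ≥0∞)⁻¹ • ∑ i, Measure.dirac (l i) ∧
      ∀ x, (Finset.univ.filter fun i => x ≤ l i).card = Module.finrank K (F.sub x) := by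
  classical
  obtain ⟨e, hcard⟩ := exists_adapted_basis F
  obtain ⟨l, hl1, hl2, hl3⟩ := exists_basis_index hs he hl e
  have hle : ∀ x, Module.finrank K (F.sub x) ≤ (Finset.univ.filter fun i => x ≤ l i).card := by
    intro x
    refine (hcard x).trans_eq ?_
    simp only [hl2, Nat.card_eq_fintype_card, Fintype.card_subtype]
  have hmax : F.IsMaximalBasis e := by
    intro e' g hg _
    obtain ⟨l', -, hl2', hl3'⟩ := exists_basis_index hs he hl e'
    rw [hl3, hl3', integral_smul_sum_dirac, integral_smul_sum_dirac]
    refine mul_le_mul_of_nonneg_left (sum_le_sum_of_card_filter_le (fun x => ?_) hg)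
      ENNReal.toReal_nonneg
    exact (card_filter_le_finrank hl2' x).trans (hle x)
  have hex : ∃ e, F.IsMaximalBasis e := ⟨e, hmax⟩
  -- The measure is defined through an arbitrary maximal basis, so the count is needed for that
  -- basis rather than for the adapted one.
  obtain ⟨l₀, hl1', hl2', hl3'⟩ := exists_basis_index hs he hl hex.choose
  refine ⟨hex.choose, l₀, hl1', ?_, fun x => le_antisymm (card_filter_le_finrank hl2' x) ?_⟩
  · rw [measure, dif_pos hex, hl3']
  · rcases Nat.eq_zero_or_pos (Module.finrank K V) with h0 | hpos
    · exact (Submodule.finrank_le _).trans (by omega)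
    refine (hle x).trans ?_
    -- Testing maximality against the indicator of `[x, ∞)` compares the numbers of indices at least
    -- `x`.
    have h1 := hex.choose_spec e (fun y => if x ≤ y then 1 else 0) (fun y z hyz => by
      beta_reduce
      split_ifs with h h' <;> first | exact absurd (h.trans hyz) h' | norm_num)
      ⟨1, fun y => by split_ifs <;> norm_num⟩
    rw [hl3, hl3', integral_smul_sum_dirac, integral_smul_sum_dirac] at h1
    have h2 : 0 < ((Module.finrank K V : ℝ≥0∞)⁻¹).toReal := by
      rw [ENNReal.toReal_inv, ENNReal.toReal_natCast]
      positivity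
    have h3 := le_of_mul_le_mul_left h1 h2
    simp only [Finset.sum_boole] at h3
    exact_mod_cast h3

end RFiltration

end AdaptedBasis

/-! ### Distribution functions, quantiles and polygons -/

section Quantile

/-- A sequence of nonnegative decreasing functions whose primitives converge pointwise converges
almost everywhere. -/
theorem ae_exists_tendsto_of_tendsto_integral {h : ℕ → ℝ → ℝ} (hanti : ∀ n, Antitone (h n))
    (hpos : ∀ n x, 0 ≤ h n x) {a : ℝ}
    (hJ : ∀ c ≥ a, ∃ l, Tendsto (fun n => ∫ x in a..c, h n x) atTop (𝓝 l)) :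
    ∀ᵐ x, a < x → ∃ y, Tendsto (fun n => h n x) atTop (𝓝 y) := by
  have hint : ∀ n p q, IntervalIntegrable (h n) volume p q := fun n p q => (hanti n).intervalIntegrable
  -- The maximum extends the limit of the primitives to a monotone function on the whole line.
  choose J hJ using fun c : ℝ => hJ (max a c) (le_max_left a c)
  have hsub : ∀ p q, a ≤ p → p ≤ q → Tendsto (fun n => ∫ x in p..q, h n x) atTop (𝓝 (J q - J p)) := by
    intro p q hp hq
    refine ((hJ q).sub (hJ p)).congr fun n => ?_
    rw [max_eq_right hp, max_eq_right (hp.trans hq), intervalIntegral.integral_interval_sub_left]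
    · exact hint _ _ _
    · exact hint _ _ _
  have hmono : Monotone J := by
    intro p q hpq
    refine le_of_tendsto_of_tendsto' (hJ p) (hJ q) fun n => ?_
    exact intervalIntegral.integral_mono_interval le_rfl (le_max_left _ _)
      (max_le_max le_rfl hpq) (ae_of_all _ fun x => hpos n x) (hint _ _ _)
  -- By monotonicity `h n x` lies between its averages just right and just left of `x`. These
  -- averages tend to slopes of `J`, all close to the derivative at `x`.
  filter_upwards [hmono.ae_differentiableAt] with x hx hax
  refine ⟨deriv J x, ?_⟩
  have hslope := hasDerivAt_iff_tendsto_slope.1 hx.hasDerivAt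
  rw [tendsto_order]
  constructor
  · intro u hu
    have h1 : ∀ᶠ y in 𝓝[>] x, u < slope J x y :=
      (hslope.mono_left (nhdsWithin_mono x fun y hy => ne_of_gt hy)).eventually_const_lt hu
    obtain ⟨y, hy, hxy⟩ := (h1.and self_mem_nhdsWithin).exists
    have hxy' : 0 < y - x := sub_pos.2 hxy
    rw [slope_def_field, lt_div_iff₀ hxy'] at hy
    filter_upwards [(hsub x y hax.le hxy.le).eventually_const_lt hy] with n hn
    have h2 : ∫ t in x..y, h n t ≤ ∫ t in x..y, h n x :=
      intervalIntegral.integral_mono_on hxy.le (hint _ _ _) (by simp) fun t ht => hanti n ht.1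
    rw [intervalIntegral.integral_const, smul_eq_mul] at h2
    nlinarith
  · intro u hu
    have h1 : ∀ᶠ y in 𝓝[<] x, slope J x y < u ∧ a < y :=
      ((hslope.mono_left (nhdsWithin_mono x fun y hy => ne_of_lt hy)).eventually_lt_const hu).and
        (mem_nhdsWithin_of_mem_nhds (lt_mem_nhds hax))
    obtain ⟨y, ⟨hy, hay⟩, hxy⟩ := (h1.and self_mem_nhdsWithin).exists
    have hxy' : 0 < x - y := sub_pos.2 hxy
    rw [slope_comm, slope_def_field, div_lt_iff₀ hxy'] at hy
    filter_upwards [(hsub y x hay.le (le_of_lt hxy)).eventually_lt_const hy] with n hn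
    have h2 : ∫ t in y..x, h n x ≤ ∫ t in y..x, h n t :=
      intervalIntegral.integral_mono_on (le_of_lt hxy) (by simp) (hint _ _ _) fun t ht => hanti n ht.2
    rw [intervalIntegral.integral_const, smul_eq_mul] at h2
    nlinarith

theorem bddAbove_setOf_lt {h : ℝ → ℝ} {b : ℝ} (hb : ∀ x, b < x → h x = 0) {s : ℝ} (hs : 0 < s) :
    BddAbove {x | s < h x} :=
  ⟨b, fun x hx => by
    by_contra! hbx
    rw [Set.mem_ofPred_eq, hb x hbx] at hx
    exact absurd hx hs.not_gt⟩

theorem quasiInverse_mem_Icc {h : ℝ → ℝ} {a b : ℝ} (ha : ∀ x, x < a → h x = 1)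
    (hb : ∀ x, b < x → h x = 0) {s : ℝ} (hs : s ∈ Ioo (0 : ℝ) 1) : quasiInverse h s ∈ Icc a b := by
  have hmem : ∀ x, x < a → x ∈ {x | s < h x} := fun x hx => by
    rw [Set.mem_ofPred_eq, ha x hx]; exact hs.2
  constructor
  · refine le_of_forall_lt fun x hx => ?_
    obtain ⟨y, hxy, hya⟩ := exists_between hx
    exact hxy.trans_le (le_csSup (bddAbove_setOf_lt hb hs.1) (hmem y hya))
  · refine csSup_le ⟨a - 1, hmem _ (by linarith)⟩ fun x hx => ?_
    by_contra! hbx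
    rw [Set.mem_ofPred_eq, hb x hbx] at hx
    exact absurd hx hs.1.not_gt

theorem quasiInverse_antitoneOn {h : ℝ → ℝ} {a b : ℝ} (ha : ∀ x, x < a → h x = 1)
    (hb : ∀ x, b < x → h x = 0) : AntitoneOn (quasiInverse h) (Ioo 0 1) := by
  intro s hs t ht hst
  refine csSup_le_csSup (bddAbove_setOf_lt hb hs.1) ⟨a - 1, ?_⟩ fun x hx => hst.trans_lt hx
  rw [Set.mem_ofPred_eq, ha _ (by linarith)]
  exact ht.2

theorem aemeasurable_quasiInverse {h : ℝ → ℝ} {a b : ℝ} (ha : ∀ x, x < a → h x = 1)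
    (hb : ∀ x, b < x → h x = 0) :
    AEMeasurable (quasiInverse h) (volume.restrict (Ioo (0 : ℝ) 1)) :=
  aemeasurable_restrict_of_antitoneOn measurableSet_Ioo (quasiInverse_antitoneOn ha hb)

/-- Convergence of the quasi-inverses of decreasing functions converging almost everywhere. -/
theorem exists_ae_tendsto_quasiInverse {h : ℕ → ℝ → ℝ} (hanti : ∀ n, Antitone (h n)) {a b : ℝ}
    (ha : ∀ n x, x < a → h n x = 1) (hb : ∀ n x, b < x → h n x = 0)
    (hlim : ∀ᵐ x, ∃ y, Tendsto (fun n => h n x) atTop (𝓝 y)) :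
    ∃ q : ℝ → ℝ, AntitoneOn q (Ioo 0 1) ∧ ∀ᵐ s ∂(volume.restrict (Ioo (0 : ℝ) 1)),
      Tendsto (fun n => quasiInverse (h n) s) atTop (𝓝 (q s)) := by
  have hdense : Dense {x | ∃ y, Tendsto (fun n => h n x) atTop (𝓝 y)} := Measure.dense_of_ae hlim
  choose! H hH using fun (x : ℝ) (hx : ∃ y, Tendsto (fun n => h n x) atTop (𝓝 y)) => hx
  set D := {x | ∃ y, Tendsto (fun n => h n x) atTop (𝓝 y)}
  have hHanti : ∀ x ∈ D, ∀ y ∈ D, x ≤ y → H y ≤ H x := fun x hx y hy hxy =>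
    le_of_tendsto_of_tendsto' (hH y hy) (hH x hx) fun n => hanti n hxy
  have hHa : ∀ x ∈ D, x < a → H x = 1 := fun x hx hxa =>
    tendsto_nhds_unique (hH x hx) (tendsto_const_nhds.congr fun n => (ha n x hxa).symm)
  have hHb : ∀ x ∈ D, b < x → H x = 0 := fun x hx hxb =>
    tendsto_nhds_unique (hH x hx) (tendsto_const_nhds.congr fun n => (hb n x hxb).symm)
  -- The quasi-inverse of the limit, taken over the dense set of points where the limit exists.
  set q : ℝ → ℝ := fun s => sSup {x | x ∈ D ∧ s < H x} with hq
  have hbdd : ∀ s, 0 < s → BddAbove {x | x ∈ D ∧ s < H x} := fun s hs => ⟨b, fun x hx => by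
    by_contra! hbx
    have := hx.2
    rw [hHb x hx.1 hbx] at this
    exact absurd this hs.not_gt⟩
  have hne : ∀ s, s < 1 → {x | x ∈ D ∧ s < H x}.Nonempty := fun s hs => by
    obtain ⟨x, hxD, hx⟩ := hdense.exists_between (show a - 1 < a by linarith)
    exact ⟨x, hxD, by rw [hHa x hxD hx.2]; exact hs⟩
  have hqanti : AntitoneOn q (Ioo 0 1) := fun s hs t ht hst =>
    csSup_le_csSup (hbdd s hs.1) (hne t ht.2) fun x hx => ⟨hx.1, hst.trans_lt hx.2⟩
  refine ⟨q, hqanti, ?_⟩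
  rw [ae_restrict_iff' measurableSet_Ioo]
  -- Convergence is proved at continuity points of `q`: the upper bound at `s` needs values of `q`
  -- at `t < s`.
  have hcount := hqanti.countable_not_continuousWithinAt
  filter_upwards [hcount.ae_notMem volume] with s hs hs01
  have hcont : ContinuousWithinAt q (Ioo 0 1) s := by
    by_contra hcon
    exact hs ⟨hs01, hcon⟩
  have hcont' : ContinuousAt q s := hcont.continuousAt (Ioo_mem_nhds hs01.1 hs01.2)
  have hbdd' : ∀ n, BddAbove {x | s < h n x} := fun n => bddAbove_setOf_lt (hb n) hs01.1
  rw [tendsto_order]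
  constructor
  · intro u hu
    obtain ⟨x, ⟨hxD, hx⟩, hux⟩ := exists_lt_of_lt_csSup (hne s hs01.2) hu
    filter_upwards [(hH x hxD).eventually_const_lt hx] with n hn
    exact hux.trans_le (le_csSup (hbdd' n) hn)
  · intro u hu
    have h1 : ∀ᶠ t in 𝓝[<] s, q t < u ∧ t ∈ Ioo (0 : ℝ) 1 :=
      ((hcont'.eventually_lt_const hu).and (Ioo_mem_nhds hs01.1 hs01.2)).filter_mono
        nhdsWithin_le_nhds
    obtain ⟨t, ⟨ht, ht01⟩, hts⟩ := (h1.and self_mem_nhdsWithin).exists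
    obtain ⟨x, hxD, hqx, hxu⟩ := hdense.exists_between ht
    have hHx : H x ≤ t := by
      by_contra! hcon
      exact absurd (le_csSup (hbdd t ht01.1) ⟨hxD, hcon⟩) (not_le.2 hqx)
    filter_upwards [(hH x hxD).eventually_lt_const (hHx.trans_lt hts)] with n hn
    refine lt_of_le_of_lt (csSup_le ⟨a - 1, ?_⟩ fun y hy => ?_) hxu
    · rw [Set.mem_ofPred_eq, ha n _ (by linarith)]
      exact hs01.2
    · by_contra! hcon
      exact absurd (hy.trans_le (hanti n hcon.le)) hn.not_gt

theorem concaveOn_integral_of_antitoneOn {q : ℝ → ℝ} (hq : AntitoneOn q (Ioo 0 1))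
    (hint : IntegrableOn q (Ioo 0 1)) : ConcaveOn ℝ (Icc 0 1) fun t => ∫ s in (0 : ℝ)..t, q s := by
  have hint' : IntervalIntegrable q volume 0 1 := by
    rwa [intervalIntegrable_iff_integrableOn_Ioo_of_le zero_le_one]
  have hi : ∀ x ∈ Icc (0 : ℝ) 1, ∀ y ∈ Icc (0 : ℝ) 1, IntervalIntegrable q volume x y :=
    fun x hx y hy => hint'.mono_set (by
      rw [uIcc_of_le (zero_le_one' ℝ)]
      exact uIcc_subset_Icc hx hy)
  refine concaveOn_of_slope_anti_adjacent (convex_Icc 0 1) fun {x y z} hx hz hxy hyz => ?_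
  have h0 : (0 : ℝ) ∈ Icc (0 : ℝ) 1 := ⟨le_rfl, zero_le_one⟩
  have hy : y ∈ Ioo (0 : ℝ) 1 := ⟨hx.1.trans_lt hxy, hyz.trans_le hz.2⟩
  have hy' := Ioo_subset_Icc_self hy
  rw [intervalIntegral.integral_interval_sub_left (hi _ h0 _ hz) (hi _ h0 _ hy'),
    intervalIntegral.integral_interval_sub_left (hi _ h0 _ hy') (hi _ h0 _ hx)]
  have h1 : ∫ s in y..z, q s ≤ ∫ s in y..z, q y :=
    intervalIntegral.integral_mono_on_of_le_Ioo hyz.le (hi _ hy' _ hz) (by simp) fun s hs =>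
      hq hy ⟨hy.1.trans hs.1, hs.2.trans_le hz.2⟩ hs.1.le
  have h2 : ∫ s in x..y, q y ≤ ∫ s in x..y, q s :=
    intervalIntegral.integral_mono_on_of_le_Ioo hxy.le (by simp) (hi _ hx _ hy') fun s hs =>
      hq ⟨hx.1.trans_lt hs.1, hs.2.trans hy.2⟩ hy hs.2.le
  rw [intervalIntegral.integral_const, smul_eq_mul] at h1 h2
  calc _ ≤ q y := by rw [div_le_iff₀ (sub_pos.2 hyz)]; linarith
    _ ≤ _ := by rw [le_div_iff₀ (sub_pos.2 hxy)]; linarith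

variable {μ : Measure ℝ}

theorem antitone_real_Ioi [IsFiniteMeasure μ] : Antitone fun x => μ.real (Ioi x) :=
  fun _ _ hxy => measureReal_mono (Ioi_subset_Ioi hxy)

theorem real_Ioi_eq_one [IsProbabilityMeasure μ] {a b : ℝ} (h : μ (Icc a b)ᶜ = 0) {x : ℝ}
    (hx : x < a) : μ.real (Ioi x) = 1 := by
  have h0 : (Ioi x)ᶜ ⊆ (Icc a b)ᶜ := fun y hy hy' => hy (hx.trans_le hy'.1)
  have h1 : μ (Ioi x)ᶜ = 0 := measure_mono_null h0 h
  rw [measureReal_def, (prob_compl_eq_zero_iff measurableSet_Ioi).1 h1, ENNReal.toReal_one]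

theorem real_Ioi_eq_zero {a b : ℝ} (h : μ (Icc a b)ᶜ = 0) {x : ℝ}
    (hx : b < x) : μ.real (Ioi x) = 0 := by
  have h0 : Ioi x ⊆ (Icc a b)ᶜ := fun y hy hy' => absurd (hx.trans hy) hy'.2.not_gt
  have h1 : μ (Ioi x) = 0 := measure_mono_null h0 h
  rw [measureReal_def, h1, ENNReal.toReal_zero]

/-- A probability measure is the image of the uniform measure under its quantile function. -/
theorem map_quasiInverse [IsProbabilityMeasure μ] {a b : ℝ} (h : μ (Icc a b)ᶜ = 0) :
    (volume.restrict (Ioo (0 : ℝ) 1)).map (quasiInverse fun x => μ.real (Ioi x)) = μ := by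
  have ha : ∀ x, x < a → μ.real (Ioi x) = 1 := fun x hx => real_Ioi_eq_one h hx
  have hb : ∀ x, b < x → μ.real (Ioi x) = 0 := fun x hx => real_Ioi_eq_zero h hx
  have hm := aemeasurable_quasiInverse ha hb
  have : IsFiniteMeasure ((volume.restrict (Ioo (0 : ℝ) 1)).map
      (quasiInverse fun x => μ.real (Ioi x))) := Measure.isFiniteMeasure_map _ _
  refine Measure.ext_of_Iic _ _ fun x => ?_
  have hcdf : ∀ y, μ.real (Ioi y) = 1 - ProbabilityTheory.cdf μ y := fun y => by
    rw [ProbabilityTheory.cdf_eq_real, ← compl_Iic, probReal_compl_eq_one_sub measurableSet_Iic]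
  -- The Galois relation between a tail function and its quasi-inverse; right continuity of the tail
  -- supplies one implication.
  have key : ∀ s ∈ Ioo (0 : ℝ) 1,
      quasiInverse (fun x => μ.real (Ioi x)) s ≤ x ↔ μ.real (Ioi x) ≤ s := by
    intro s hs
    rw [← not_lt, ← not_lt, not_iff_not]
    constructor
    · intro hx
      have hne : {x | s < μ.real (Ioi x)}.Nonempty :=
        ⟨a - 1, by rw [Set.mem_ofPred_eq, ha _ (by linarith)]; exact hs.2⟩
      obtain ⟨y, hy, hxy⟩ := exists_lt_of_lt_csSup hne hx
      exact hy.trans_le (antitone_real_Ioi hxy.le)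
    · intro hx
      have h1 : ContinuousWithinAt (fun y => μ.real (Ioi y)) (Ioi x) x := by
        simp only [hcdf]
        exact (((ProbabilityTheory.cdf μ).right_continuous x).mono Ioi_subset_Ici_self).const_sub 1
      have h2 : ∀ᶠ y in 𝓝[>] x, s < μ.real (Ioi y) := h1.eventually_const_lt hx
      obtain ⟨y, hy, hxy⟩ := (h2.and self_mem_nhdsWithin).exists
      exact lt_of_lt_of_le hxy (le_csSup (bddAbove_setOf_lt hb hs.1) hy)
  rw [Measure.map_apply_of_aemeasurable hm measurableSet_Iic]
  have h3 : (volume.restrict (Ioo (0 : ℝ) 1))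
      ((quasiInverse fun x => μ.real (Ioi x)) ⁻¹' Iic x) =
      (volume.restrict (Ioo (0 : ℝ) 1)) (Ici (μ.real (Ioi x))) := by
    refine measure_congr ?_
    filter_upwards [ae_restrict_mem measurableSet_Ioo] with s hs
    exact propext (key s hs)
  have h4 : (volume.restrict (Ioo (0 : ℝ) 1)) (Ici (μ.real (Ioi x))) =
      volume (Ico (μ.real (Ioi x)) 1) := by
    rw [Measure.restrict_congr_set Ioo_ae_eq_Ico, Measure.restrict_apply measurableSet_Ici]
    congr 1
    ext s
    constructor
    · rintro ⟨h1, h2⟩; exact ⟨h1, h2.2⟩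
    · rintro ⟨h1, h2⟩; exact ⟨h1, measureReal_nonneg.trans h1, h2⟩
  rw [h3, h4, Real.volume_Ico, hcdf, sub_sub_cancel, ProbabilityTheory.ofReal_cdf]

/-- The quantile functions are uniformly bounded on `(0, 1)` and converge almost everywhere to a
decreasing `q`. The limit measure is the image of Lebesgue measure under `q`. Convergence in `L¹`
bounds the difference of the primitives uniformly in `t`, and the primitive of `q` is concave. -/
theorem exists_limit_of_ae_tendsto {ν : ℕ → Measure ℝ} [∀ n, IsProbabilityMeasure (ν n)] {a b : ℝ}
    (hν : ∀ n, ν n (Icc a b)ᶜ = 0)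
    (hlim : ∀ᵐ x, ∃ y, Tendsto (fun n => (ν n).real (Ioi x)) atTop (𝓝 y)) :
    (∃ μ : Measure ℝ, IsProbabilityMeasure μ ∧ ConvergesVaguely ν μ) ∧
    ∃ P : ℝ → ℝ, ConcaveOn ℝ (Icc 0 1) P ∧
      TendstoUniformlyOn (fun n t => polygon (ν n) t) P atTop (Icc 0 1) := by
  have ha : ∀ n x, x < a → (ν n).real (Ioi x) = 1 := fun n x hx => real_Ioi_eq_one (hν n) hx
  have hb : ∀ n x, b < x → (ν n).real (Ioi x) = 0 := fun n x hx => real_Ioi_eq_zero (hν n) hx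
  obtain ⟨q, hqanti, hq⟩ := exists_ae_tendsto_quasiInverse (fun n => antitone_real_Ioi) ha hb hlim
  have hmeas := fun n => aemeasurable_quasiInverse (ha n) (hb n)
  have hqm : AEMeasurable q (volume.restrict (Ioo (0 : ℝ) 1)) :=
    aemeasurable_restrict_of_antitoneOn measurableSet_Ioo hqanti
  have hprob : IsProbabilityMeasure (volume.restrict (Ioo (0 : ℝ) 1)) := ⟨by simp⟩
  set Q : ℕ → ℝ → ℝ := fun n => quasiInverse fun x => (ν n).real (Ioi x) with hQ
  have hQb : ∀ n, ∀ᵐ s ∂(volume.restrict (Ioo (0 : ℝ) 1)), ‖Q n s‖ ≤ max |a| |b| := fun n => by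
    filter_upwards [ae_restrict_mem measurableSet_Ioo] with s hs
    have := quasiInverse_mem_Icc (ha n) (hb n) hs
    exact abs_le_max_abs_abs this.1 this.2
  have hQint : ∀ n, IntegrableOn (Q n) (Ioo 0 1) := fun n =>
    Integrable.of_bound (hmeas n).aestronglyMeasurable _ (hQb n)
  have hqb : ∀ᵐ s ∂(volume.restrict (Ioo (0 : ℝ) 1)), ‖q s‖ ≤ max |a| |b| := by
    filter_upwards [hq, ae_all_iff.2 hQb] with s hs hs'
    exact le_of_tendsto hs.norm (Eventually.of_forall hs')
  have hqint : IntegrableOn q (Ioo 0 1) := Integrable.of_bound hqm.aestronglyMeasurable _ hqb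
  refine ⟨⟨(volume.restrict (Ioo (0 : ℝ) 1)).map q, Measure.isProbabilityMeasure_map hqm, ?_⟩,
    fun t => ∫ s in (0 : ℝ)..t, q s, concaveOn_integral_of_antitoneOn hqanti hqint, ?_⟩
  · intro g
    obtain ⟨C, hC⟩ := g.hasCompactSupport.exists_bound_of_continuous g.continuous
    have hg : Continuous fun x => g x := g.continuous
    have h1 : ∀ n, ∫ x, g x ∂(ν n) = ∫ s in Ioo (0 : ℝ) 1, g (Q n s) := fun n => by
      conv_lhs => rw [← map_quasiInverse (hν n)]
      rw [integral_map (hmeas n) hg.aestronglyMeasurable]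
    rw [integral_map hqm hg.aestronglyMeasurable]
    simp only [h1]
    refine tendsto_integral_of_dominated_convergence (fun _ => C)
      (fun n => (hg.measurable.comp_aemeasurable (hmeas n)).aestronglyMeasurable)
      (integrable_const _) (fun n => ae_of_all _ fun s => hC _) ?_
    filter_upwards [hq] with s hs
    exact (hg.tendsto _).comp hs
  · have h1 : Tendsto (fun n => ∫ s in Ioo (0 : ℝ) 1, ‖Q n s - q s‖) atTop (𝓝 0) := by
      have := tendsto_integral_of_dominated_convergence
        (F := fun n s => ‖Q n s - q s‖) (f := fun _ => (0 : ℝ))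
        (μ := volume.restrict (Ioo (0 : ℝ) 1)) (fun _ => max |a| |b| + max |a| |b|)
        (fun n => ((hmeas n).sub hqm).aestronglyMeasurable.norm)
        (integrable_const _) (fun n => ?_) ?_
      · simpa using this
      · filter_upwards [hQb n, hqb] with s h1 h2
        rw [norm_norm]
        exact (norm_sub_le _ _).trans (add_le_add h1 h2)
      · filter_upwards [hq] with s hs
        simpa using (hs.sub_const (q s)).norm
    rw [Metric.tendstoUniformlyOn_iff]
    intro ε hε
    filter_upwards [h1.eventually_lt_const hε] with n hn t ht
    refine lt_of_le_of_lt ?_ hn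
    have hQi : IntervalIntegrable (Q n) volume 0 t := by
      rw [intervalIntegrable_iff_integrableOn_Ioo_of_le ht.1]
      exact (hQint n).mono_set (Ioo_subset_Ioo_right ht.2)
    have hqi : IntervalIntegrable q volume 0 t := by
      rw [intervalIntegrable_iff_integrableOn_Ioo_of_le ht.1]
      exact hqint.mono_set (Ioo_subset_Ioo_right ht.2)
    rw [dist_comm, dist_eq_norm, polygon, ← intervalIntegral.integral_sub hQi hqi]
    refine (intervalIntegral.norm_integral_le_integral_norm ht.1).trans ?_
    rw [intervalIntegral.integral_of_le ht.1, integral_Ioc_eq_integral_Ioo]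
    exact setIntegral_mono_set ((hQint n).sub hqint).norm (ae_of_all _ fun _ => norm_nonneg _)
      (Ioo_subset_Ioo_right ht.2).eventuallyLE

open scoped Pointwise in
theorem polygon_dilate {ε : ℝ} (hε : 0 < ε) (ν : Measure ℝ) (t : ℝ) :
    polygon (dilate ε ν) t = ε * polygon ν t := by
  rw [polygon, polygon, ← intervalIntegral.integral_const_mul]
  refine intervalIntegral.integral_congr fun s _ => ?_
  have h1 : ∀ x, (dilate ε ν).real (Ioi x) = ν.real (Ioi (x / ε)) := by
    intro x
    rw [measureReal_def, measureReal_def, dilate,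
      Measure.map_apply (by fun_prop) measurableSet_Ioi]
    congr 2
    ext y
    simp [div_lt_iff₀' hε]
  have h2 : {x | s < (dilate ε ν).real (Ioi x)} = ε • {x | s < ν.real (Ioi x)} := by
    ext x
    rw [Set.mem_smul_set_iff_inv_smul_mem₀ hε.ne']
    simp [h1, div_eq_inv_mul]
  simp only [quasiInverse]
  rw [h2, Real.sSup_smul_of_nonneg hε.le, smul_eq_mul]

end Quantile

/-! ### Algebras generated in degree one -/

section StandardGraded

variable {K B : Type*} [Field K] [CommRing B] [Algebra K B]
  {𝒜 : ℕ → Submodule K B} [GradedAlgebra 𝒜]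

theorem pow_le_of_graded (n : ℕ) : 𝒜 1 ^ n ≤ 𝒜 n := by
  induction n with
  | zero =>
    rw [pow_zero, Submodule.one_le]
    exact SetLike.GradedOne.one_mem
  | succ n ih =>
    rw [pow_succ, Submodule.mul_le]
    exact fun x hx y hy => SetLike.mul_mem_graded (ih hx) hy

theorem decompose_mem_pow_of_mem_adjoin {b : B} (hb : b ∈ Algebra.adjoin K (𝒜 1 : Set B)) (n : ℕ) :
    (DirectSum.decompose 𝒜 b n : B) ∈ 𝒜 1 ^ n := by
  classical
  have key : ∀ (n i : ℕ), ∀ x ∈ 𝒜 1 ^ i, (DirectSum.decompose 𝒜 x n : B) ∈ 𝒜 1 ^ n := by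
    intro n i x hx
    by_cases h : i = n
    · subst h
      rwa [DirectSum.decompose_of_mem_same _ (pow_le_of_graded i hx)]
    · rw [DirectSum.decompose_of_mem_ne _ (pow_le_of_graded i hx) h]
      exact zero_mem _
  induction hb using Algebra.adjoin_induction generalizing n with
  | mem x hx => exact key n 1 x (by rwa [pow_one])
  | algebraMap r =>
    refine key n 0 _ ?_
    rw [pow_zero]
    exact Submodule.algebraMap_mem r
  | add x y _ _ hx hy =>
    rw [DirectSum.decompose_add, DirectSum.add_apply, Submodule.coe_add]
    exact add_mem (hx n) (hy n)
  | mul x y _ _ hx hy =>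
    rw [← DirectSum.sum_support_decompose 𝒜 x, ← DirectSum.sum_support_decompose 𝒜 y,
      Finset.sum_mul_sum, ← GradedRing.proj_apply, map_sum]
    refine sum_mem fun i _ => ?_
    rw [map_sum]
    refine sum_mem fun j _ => key n (i + j) _ ?_
    rw [pow_add]
    exact Submodule.mul_mem_mul (hx i) (hy j)

theorem eq_pow_of_adjoin_eq_top (h : Algebra.adjoin K (𝒜 1 : Set B) = ⊤) (n : ℕ) :
    𝒜 n = 𝒜 1 ^ n := by
  refine le_antisymm (fun b hb => ?_) (pow_le_of_graded n)
  have := decompose_mem_pow_of_mem_adjoin (𝒜 := 𝒜) (b := b) (by rw [h]; trivial) n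
  rwa [DirectSum.decompose_of_mem_same _ hb] at this

/-- The ideal spanned by `𝒜 1` is generated by finitely many elements of degree one. In degree one
the coefficients can be taken in `𝒜 0`, which consists of scalars, so these elements span `𝒜 1` over
`K`. -/
theorem finiteDimensional_of_adjoin_eq_top [Algebra.FiniteType K B]
    (h : Algebra.adjoin K (𝒜 1 : Set B) = ⊤) (n : ℕ) : FiniteDimensional K (𝒜 n) := by
  have : IsNoetherianRing B := Algebra.FiniteType.isNoetherianRing K B
  obtain ⟨T, hT, hT'⟩ := (Submodule.fg_span_iff_fg_span_finset_subset
    (𝒜 1 : Set B)).1 (IsNoetherian.noetherian (Ideal.span (𝒜 1 : Set B)))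
  have h1 : 𝒜 1 = Submodule.span K (T : Set B) := by
    refine le_antisymm (fun b hb => ?_) (Submodule.span_le.2 hT)
    have hb' : b ∈ Ideal.span (range fun t : T => (t : B)) := by
      have h2 : b ∈ Ideal.span (𝒜 1 : Set B) := Ideal.subset_span hb
      have h3 : b ∈ Ideal.span (T : Set B) := hT'.le h2
      simpa using h3
    obtain ⟨c, hc, -, rfl⟩ := exists_sum_mul_of_mem_span (d := fun _ => 1)
      (fun t : T => hT t.2) hb hb'
    refine sum_mem fun t _ => ?_
    have := hc t
    rw [Nat.sub_self, eq_pow_of_adjoin_eq_top h 0, pow_zero, Submodule.mem_one] at this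
    obtain ⟨k, hk⟩ := this
    rw [← hk, mul_comm, ← Algebra.smul_def]
    exact Submodule.smul_mem _ _ (Submodule.subset_span t.2)
  rw [← Submodule.fg_iff_finiteDimensional, eq_pow_of_adjoin_eq_top h n]
  refine Submodule.FG.pow ?_ n
  rw [h1]
  exact ⟨T, rfl⟩

theorem ne_bot_of_one_ne_bot [IsDomain B] (h : 𝒜 1 ≠ ⊥) (n : ℕ) : 𝒜 n ≠ ⊥ := by
  obtain ⟨u, hu, hu0⟩ := Submodule.exists_mem_ne_zero_of_ne_bot h
  refine (Submodule.ne_bot_iff _).2 ⟨u ^ n, ?_, pow_ne_zero n hu0⟩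
  simpa using SetLike.pow_mem_graded n hu

theorem one_ne_bot_of_ringKrullDim_pos [IsDomain B] (h : Algebra.adjoin K (𝒜 1 : Set B) = ⊤)
    (hdim : 0 < ringKrullDim B) : 𝒜 1 ≠ ⊥ := by
  intro hbot
  have h1 : Function.Surjective (algebraMap K B) := by
    intro b
    have hb : b ∈ Algebra.adjoin K (𝒜 1 : Set B) := by rw [h]; trivial
    have h2 : Algebra.adjoin K (𝒜 1 : Set B) = ⊥ := by
      rw [hbot, eq_bot_iff]
      refine Algebra.adjoin_le fun x hx => ?_
      rw [show x = 0 from hx]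
      exact zero_mem _
    rw [h2] at hb
    exact Algebra.mem_bot.1 hb
  have h2 := ringKrullDim_le_of_surjective _ h1
  rw [ringKrullDim_eq_zero_of_field] at h2
  exact absurd h2 (not_le.2 hdim)

/-- A nonzero element of positive degree embeds `𝒜 0` in a finite-dimensional component. -/
theorem finiteDimensional_zero [IsDomain B] (hfin : ∀ n, 0 < n → FiniteDimensional K (𝒜 n))
    (hne : ∀ᶠ n in atTop, 𝒜 n ≠ ⊥) : FiniteDimensional K (𝒜 0) := by
  obtain ⟨n, hn, hn0⟩ := (hne.and (eventually_gt_atTop 0)).exists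
  have := hfin n hn0
  obtain ⟨u, hu, hu0⟩ := Submodule.exists_mem_ne_zero_of_ne_bot hn
  refine Module.Finite.of_injective ((LinearMap.mulLeft K u).restrict (p := 𝒜 0) (q := 𝒜 n)
    fun x hx => by simpa using SetLike.mul_mem_graded hu hx) fun x y hxy => ?_
  exact Subtype.ext (mul_left_cancel₀ hu0 (Subtype.ext_iff.1 hxy))

/-- Superadditivity of the slopes on which the filtration is everything. -/
theorem envelope_mul_add (hgen : Algebra.adjoin K (𝒜 1 : Set B) = ⊤)
    {F : ℕ → ℝ → Submodule K B} {f : ℕ → ℝ≥0} {n₀ : ℕ} {m : ℕ → ℝ}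
    (hm : ∀ n ≥ n₀, 𝒜 n ≤ F n (m n)) {p s : ℕ} (hp : n₀ ≤ p) (hs : n₀ ≤ s) (q : ℕ) :
    𝒜 (q * p + s) ≤ envelope F f n₀ (q * p + s) (q * (m p - f p) + (m s - f s)) := by
  have h1 : ∀ n ≥ n₀, 𝒜 n ≤ envelope F f n₀ n (m n - f n) := fun n hn =>
    (hm n hn).trans (by simpa using le_envelope (F := F) (f := f) hn (m n - f n))
  induction q with
  | zero => simpa using h1 s hs
  | succ q ih =>
    have e1 : (q + 1) * p + s = p + (q * p + s) := by ring
    rw [e1, eq_pow_of_adjoin_eq_top hgen, pow_add, ← eq_pow_of_adjoin_eq_top hgen,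
      ← eq_pow_of_adjoin_eq_top hgen, Submodule.mul_le]
    intro x hx y hy
    have := mul_mem_envelope (h1 p hp hx) (ih hy)
    rwa [show (m p - f p) + (q * (m p - f p) + (m s - f s)) =
      ((q + 1 : ℕ) : ℝ) * (m p - f p) + (m s - f s) by push_cast; ring] at this

end StandardGraded

/-! ### Normalized sums of Dirac masses -/

section Atoms

variable {ι : Type*} [Fintype ι]

theorem real_smul_sum_dirac (c : ℝ≥0∞) (l : ι → ℝ) {S : Set ℝ} (hS : MeasurableSet S)
    [DecidablePred (· ∈ S)] : (c • ∑ i, Measure.dirac (l i)).real S =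
      c.toReal * (Finset.univ.filter fun i => l i ∈ S).card := by
  rw [← integral_indicator_one hS, integral_smul_sum_dirac]
  simp [Set.indicator_apply]

theorem smul_sum_dirac_eq_zero (c : ℝ≥0∞) {l : ι → ℝ} {S : Set ℝ} (hS : MeasurableSet S)
    (h : ∀ i, l i ∉ S) : (c • ∑ i, Measure.dirac (l i)) S = 0 := by
  simp [Measure.dirac_apply' _ hS, h]

theorem dilate_smul_sum_dirac (ε : ℝ) (c : ℝ≥0∞) (l : ι → ℝ) :
    dilate ε (c • ∑ i, Measure.dirac (l i)) = c • ∑ i, Measure.dirac (ε * l i) := by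
  have hm : Measurable fun x : ℝ => ε * x := by fun_prop
  rw [dilate, Measure.map_smul]
  congr 1
  ext S hS
  rw [Measure.map_apply hm hS, Measure.finsetSum_apply, Measure.finsetSum_apply]
  refine Finset.sum_congr rfl fun i _ => ?_
  rw [Measure.dirac_apply' _ hS, Measure.dirac_apply' _ (hm hS)]
  rfl

theorem isProbabilityMeasure_smul_sum_dirac {n : ℕ} (hn : 0 < n) (l : Fin n → ℝ) :
    IsProbabilityMeasure ((n : ℝ≥0∞)⁻¹ • ∑ i, Measure.dirac (l i)) := by
  refine ⟨?_⟩
  have h0 : (n : ℝ≥0∞) ≠ 0 := by exact_mod_cast hn.ne'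
  simp [ENNReal.inv_mul_cancel h0 (ENNReal.natCast_ne_top n)]

end Atoms

/-! ### Assembling the limits -/

section Limit

variable {K B : Type*} [Field K] [CommRing B] [Algebra K B] {𝒜 : ℕ → Submodule K B}

theorem EReal.div_natCast_le_iff {x : ℝ} {n : ℕ} {b : ℝ} :
    ((x : ℝ) : EReal) / (n : EReal) ≤ b ↔ x / n ≤ b := by
  rw [← EReal.coe_natCast, ← EReal.coe_div, EReal.coe_le_coe_iff]

/-- The subspaces of the algebra defined by the filtrations of its homogeneous components. -/
def ambient (F : ∀ n, RFiltration K (𝒜 n)) (n : ℕ) (s : ℝ) : Submodule K B :=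
  ((F n).sub s).map (𝒜 n).subtype

variable {F : ∀ n, RFiltration K (𝒜 n)}

theorem ambient_antitone (n : ℕ) : Antitone (ambient F n) :=
  fun _ _ hst => Submodule.map_mono ((F n).antitone_sub hst)

theorem ambient_le (n : ℕ) (s : ℝ) : ambient F n s ≤ 𝒜 n := Submodule.map_subtype_le _ _

theorem finrank_ambient (n : ℕ) (s : ℝ) :
    Module.finrank K (ambient F n s) = Module.finrank K ((F n).sub s) :=
  (Submodule.equivMapOfInjective _ (𝒜 n).injective_subtype _).finrank_eq.symm

theorem ambient_eq_iff {n : ℕ} {s : ℝ} : ambient F n s = 𝒜 n ↔ (F n).sub s = ⊤ := by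
  constructor
  · intro h
    apply Submodule.map_injective_of_injective (𝒜 n).injective_subtype
    rw [Submodule.map_subtype_top]
    exact h
  · intro h
    rw [ambient, h, Submodule.map_subtype_top]

theorem IsQuasiFiltered.exists_quasiMul {f : ℕ → ℝ≥0} (h : IsQuasiFiltered 𝒜 f F) :
    ∃ n₀ > 0, QuasiMul (ambient F) f n₀ := by
  obtain ⟨n₀, h⟩ := h
  -- Raising the threshold keeps all relevant degrees positive, where the filtrations are separated,
  -- exhaustive and left continuous.
  refine ⟨n₀ + 1, Nat.succ_pos _, fun r hr n s hn a ha => ?_⟩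
  choose a' ha' haa' using ha
  have := h r hr n s (fun i => (Nat.le_succ _).trans (hn i)) a' ha'
  have e : ∏ i, (a' i : B) = ∏ i, a i := Finset.prod_congr rfl fun i _ => haa' i
  rwa [e] at this

theorem eventually_index_le {F : ∀ n, RFiltration K (𝒜 n)}
    (hsup : limsup (fun n : ℕ => ⨆ a : 𝒜 n, ⨆ _ : a ≠ 0, (F n).index a / (n : EReal)) atTop < ⊤) :
    ∃ b : ℝ, ∀ᶠ n : ℕ in atTop, ∀ a : 𝒜 n, a ≠ 0 → ∀ l : ℝ, (F n).index a = l → l / n ≤ b := by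
  obtain ⟨b, hb, -⟩ := EReal.lt_iff_exists_real_btwn.1 hsup
  refine ⟨b, ?_⟩
  filter_upwards [eventually_lt_of_limsup_lt hb, eventually_gt_atTop 0] with n hn hn0 a ha l hl
  rw [← EReal.div_natCast_le_iff, ← hl]
  exact (le_iSup₂ (f := fun (a : 𝒜 n) (_ : a ≠ 0) => (F n).index a / (n : EReal)) a ha).trans hn.le

/-- The minimum is the largest level at which the filtration is the whole space, attained by a
vector of a maximal basis. The zero vector has index `⊤` and does not interfere. -/
theorem isLeast_index {V : Type*} [AddCommGroup V] [Module K V] [FiniteDimensional K V]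
    [Nontrivial V] {F : RFiltration K V} (hs : F.IsSeparated) (he : F.IsExhaustive)
    (hl : F.IsLeftContinuous) : ∃ m : ℝ, IsLeast (range F.index) (m : EReal) ∧ F.sub m = ⊤ ∧
      ∀ r, F.sub r = ⊤ → r ≤ m := by
  obtain ⟨e, l, h1, -, h3⟩ := RFiltration.exists_measure_eq hs he hl
  have hpos : 0 < Module.finrank K V := Module.finrank_pos
  have : Nonempty (Fin (Module.finrank K V)) := ⟨⟨0, hpos⟩⟩
  obtain ⟨i₀, -, hi₀⟩ := Finset.univ.exists_min_image l Finset.univ_nonempty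
  have htop : F.sub (l i₀) = ⊤ := by
    refine Submodule.eq_top_of_finrank_eq ?_
    rw [← h3, Finset.filter_true_of_mem hi₀, Finset.card_univ, Fintype.card_fin]
  refine ⟨l i₀, ⟨⟨e i₀, h1 i₀⟩, ?_⟩, htop, fun r hr => ?_⟩
  · rintro _ ⟨a, rfl⟩
    refine le_iSup₂ (f := fun (r : ℝ) (_ : a ∈ F.sub r) => (r : EReal)) (l i₀) ?_
    rw [htop]; trivial
  · have h4 := h3 r
    rw [hr, finrank_top] at h4
    have h5 := Finset.card_filter_eq_iff.1 (h4.trans (by simp))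
    exact h5 i₀ (Finset.mem_univ _)

variable [GradedAlgebra 𝒜]

/-- The minimal index `m n` is the largest level where the filtration is everything. Products of
full levels are full up to the loss `f`, so Fekete's lemma applies to `m` with correction `m - f`.
-/
theorem exists_tendsto_min_div [IsDomain B]
    (hfin : ∀ n, FiniteDimensional K (𝒜 n)) {f : ℕ → ℝ≥0}
    (hf : Tendsto (fun n : ℕ => (f n : ℝ) / n) atTop (𝓝 0))
    (hsep : ∀ n : ℕ, 0 < n → (F n).IsSeparated) (hexh : ∀ n : ℕ, 0 < n → (F n).IsExhaustive)
    (hleft : ∀ n : ℕ, 0 < n → (F n).IsLeftContinuous) (hquasi : IsQuasiFiltered 𝒜 f F)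
    (hsup : limsup (fun n : ℕ => ⨆ a : 𝒜 n, ⨆ _ : a ≠ 0, (F n).index a / (n : EReal)) atTop < ⊤)
    (hne : ∀ᶠ n in atTop, 𝒜 n ≠ ⊥) (hgen : Algebra.adjoin K (𝒜 1 : Set B) = ⊤) :
    ∃ (m : ℕ → ℝ) (l : ℝ),
      (∀ n : ℕ, 0 < n → IsLeast (Set.range fun a : 𝒜 n => (F n).index a) (m n : EReal)) ∧
      Tendsto (fun n : ℕ => m n / n) atTop (𝓝 l) := by
  have h1 : 𝒜 1 ≠ ⊥ := by
    intro hbot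
    obtain ⟨n, hn, hn0⟩ := (hne.and (eventually_gt_atTop 0)).exists
    rw [eq_pow_of_adjoin_eq_top hgen, hbot, ← Submodule.zero_eq_bot, zero_pow hn0.ne'] at hn
    exact hn rfl
  have hm : ∀ n, 0 < n → ∃ m : ℝ, IsLeast (range (F n).index) (m : EReal) ∧ (F n).sub m = ⊤ ∧
      ∀ r, (F n).sub r = ⊤ → r ≤ m := fun n hn => by
    have := hfin n
    have : Nontrivial (𝒜 n) := Submodule.nontrivial_iff_ne_bot.2 (ne_bot_of_one_ne_bot h1 n)
    exact isLeast_index (hsep n hn) (hexh n hn) (hleft n hn)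
  choose! m hm1 hm2 hm3 using hm
  obtain ⟨n₀, hn₀, hq⟩ := hquasi.exists_quasiMul
  obtain ⟨b, hb⟩ := eventually_index_le hsup
  have hmF : ∀ n ≥ n₀, 𝒜 n ≤ ambient F n (m n) := fun n hn =>
    (ambient_eq_iff.2 (hm2 n (hn₀.trans_le hn))).ge
  obtain ⟨l, hl⟩ := exists_tendsto_div_of_superadditive (a := m) (b := fun n => m n - f n) hn₀
    (fun p hp s hs q => by
      refine hm3 _ (by omega) _ (ambient_eq_iff.1 (le_antisymm (ambient_le _ _) ?_))
      exact (envelope_mul_add hgen hmF hp hs q).trans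
        (envelope_le ambient_antitone hq _ _)) (by simpa using hf) (M := b) (by
      filter_upwards [hb, eventually_gt_atTop 0] with n hn hn0
      have hn' : (0 : ℝ) < n := by exact_mod_cast hn0
      rw [← div_le_iff₀ hn']
      obtain ⟨u, hu, hu0⟩ := Submodule.exists_mem_ne_zero_of_ne_bot (ne_bot_of_one_ne_bot h1 n)
      have := hfin n
      have hu0' : (⟨u, hu⟩ : 𝒜 n) ≠ 0 := fun h => hu0 (congrArg Subtype.val h)
      obtain ⟨l, hl, -⟩ := RFiltration.exists_index_eq (hsep n hn0) (hexh n hn0) (hleft n hn0) hu0'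
      refine le_trans ?_ (hn _ hu0' l hl)
      gcongr
      rw [← EReal.coe_le_coe_iff, ← hl]
      exact (hm1 n hn0).2 ⟨_, rfl⟩)
  exact ⟨m, l, hm1, hl⟩

/-- The normalized measures of a quasi-filtered graded algebra as sums of Dirac measures. -/
theorem exists_dilate_measure_eq (hfin : ∀ n, FiniteDimensional K (𝒜 n))
    (hsep : ∀ n : ℕ, 0 < n → (F n).IsSeparated) (hexh : ∀ n : ℕ, 0 < n → (F n).IsExhaustive)
    (hleft : ∀ n : ℕ, 0 < n → (F n).IsLeftContinuous) {n : ℕ} (hn : 0 < n) :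
    ∃ (e : Module.Basis (Fin (Module.finrank K (𝒜 n))) K (𝒜 n))
      (l : Fin (Module.finrank K (𝒜 n)) → ℝ),
      (∀ i, (F n).index (e i) = ((n * l i : ℝ) : EReal)) ∧
      dilate (1 / (n : ℝ)) (F n).measure =
        (Module.finrank K (𝒜 n) : ℝ≥0∞)⁻¹ • ∑ i, Measure.dirac (l i) ∧
      ∀ x, (Finset.univ.filter fun i => x ≤ l i).card =
        Module.finrank K (ambient F n (n * x)) := by
  have := hfin n
  have hn' : (0 : ℝ) < n := by exact_mod_cast hn
  obtain ⟨e, l, h1, h2, h3⟩ :=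
    RFiltration.exists_measure_eq (hsep n hn) (hexh n hn) (hleft n hn)
  refine ⟨e, fun i => 1 / n * l i, fun i => ?_, ?_, fun x => ?_⟩
  · rw [h1]; congr 1; field_simp
  · rw [h2, dilate_smul_sum_dirac]
  · rw [finrank_ambient, ← h3]
    congr 1
    ext i
    simp only [Finset.mem_filter, Finset.mem_univ, true_and]
    rw [one_div_mul_eq_div, le_div_iff₀' hn']

/-- The tail of the normalized measure agrees almost everywhere with the dimension ratio whose
integrals are known to converge. The slope `a` and the upper limit bound put all atoms of large
degree in one interval. -/
theorem exists_limit_of_quasiFiltered [IsDomain B] [Algebra.FiniteType K B]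
    (hfin : ∀ n, FiniteDimensional K (𝒜 n)) {f : ℕ → ℝ≥0}
    (hf : Tendsto (fun n : ℕ => (f n : ℝ) / n) atTop (𝓝 0))
    (hsep : ∀ n : ℕ, 0 < n → (F n).IsSeparated) (hexh : ∀ n : ℕ, 0 < n → (F n).IsExhaustive)
    (hleft : ∀ n : ℕ, 0 < n → (F n).IsLeftContinuous) (hquasi : IsQuasiFiltered 𝒜 f F)
    (hsup : limsup (fun n : ℕ => ⨆ a : 𝒜 n, ⨆ _ : a ≠ 0, (F n).index a / (n : EReal)) atTop < ⊤)
    (hne : ∀ᶠ n in atTop, 𝒜 n ≠ ⊥) :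
    (∃ R : ℝ, ∀ n : ℕ, 0 < n →
      (dilate (1 / (n : ℝ)) (F n).measure).support ⊆ Set.Icc (-R) R) ∧
    (∃ ν : Measure ℝ, IsProbabilityMeasure ν ∧
      ConvergesVaguely (fun n : ℕ => dilate (1 / (n : ℝ)) (F n).measure) ν) ∧
    (∃ P : ℝ → ℝ, ConcaveOn ℝ (Set.Icc 0 1) P ∧
      TendstoUniformlyOn (fun (n : ℕ) (t : ℝ) => polygon (dilate (1 / (n : ℝ)) (F n).measure) t)
        P atTop (Set.Icc 0 1)) := by
  classical
  obtain ⟨n₀, hn₀, hq⟩ := hquasi.exists_quasiMul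
  obtain ⟨b, hb⟩ := eventually_index_le hsup
  obtain ⟨a, ha, hJ⟩ := exists_tendsto_integral_of_quasiMul hfin hne hn₀ ambient_antitone hq
    ambient_le (fun n hn => by
      have := hfin n
      obtain ⟨t, ht⟩ := (hexh n (hn₀.trans_le hn)).exists_sub_eq_top
      exact ⟨t, ambient_eq_iff.2 ht⟩) hf
  choose! e l h1 h2 h3 using fun (n : ℕ) (hn : 0 < n) =>
    exists_dilate_measure_eq hfin hsep hexh hleft hn
  have hev : ∀ᶠ n in atTop, 0 < n ∧ 𝒜 n ≠ ⊥ ∧ ∀ i, l n i ∈ Icc a b := by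
    filter_upwards [hb, hne, eventually_ge_atTop n₀] with n hn hn' hnn
    have hn0 : 0 < n := hn₀.trans_le hnn
    have hn0' : (0 : ℝ) < n := by exact_mod_cast hn0
    refine ⟨hn0, hn', fun i => ⟨?_, ?_⟩⟩
    · have h4 := h3 n hn0 a
      rw [mul_comm, ha n hnn] at h4
      exact Finset.card_filter_eq_iff.1 (h4.trans (by simp)) i (Finset.mem_univ _)
    · have := hn (e n hn0 i) ((e n hn0).ne_zero i) _ (h1 n hn0 i)
      rwa [mul_div_cancel_left₀ _ hn0'.ne'] at this
  obtain ⟨N, hN⟩ := eventually_atTop.1 hev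
  -- Indices are shifted by `N` because small degrees may have a zero component or atoms outside
  -- `[a, b]`.
  have hprob : ∀ n, IsProbabilityMeasure (dilate (1 / ((n + N : ℕ) : ℝ)) (F (n + N)).measure) := by
    intro n
    obtain ⟨hn0, hn, -⟩ := hN (n + N) (by omega)
    have := hfin (n + N)
    rw [h2 _ hn0]
    exact isProbabilityMeasure_smul_sum_dirac (Submodule.one_le_finrank_iff.2 hn) _
  have hsupp : ∀ n, dilate (1 / ((n + N : ℕ) : ℝ)) (F (n + N)).measure (Icc a b)ᶜ = 0 := by
    intro n
    obtain ⟨hn0, -, hn⟩ := hN (n + N) (by omega)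
    rw [h2 _ hn0]
    exact smul_sum_dirac_eq_zero _ measurableSet_Icc.compl fun i hi => hi (hn i)
  have hae : ∀ n : ℕ, 0 < n → ∀ᵐ x, (dilate (1 / (n : ℝ)) (F n).measure).real (Ioi x) =
      (Module.finrank K (ambient F n (n * x)) : ℝ) / Module.finrank K (𝒜 n) := by
    intro n hn
    filter_upwards [(finite_range (l n)).countable.ae_notMem volume] with x hx
    rw [h2 n hn, real_smul_sum_dirac _ _ measurableSet_Ioi, ← h3 n hn, ENNReal.toReal_inv,
      ENNReal.toReal_natCast, inv_mul_eq_div]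
    congr 3
    ext i
    simp only [Finset.mem_filter, Finset.mem_univ, true_and, mem_Ioi]
    exact ⟨le_of_lt, fun h => lt_of_le_of_ne h fun h' => hx ⟨i, h'.symm⟩⟩
  have hJ' : ∀ c ≥ a, ∃ y, Tendsto (fun n => ∫ x in a..c,
      (dilate (1 / ((n + N : ℕ) : ℝ)) (F (n + N)).measure).real (Ioi x)) atTop (𝓝 y) := by
    intro c hc
    obtain ⟨y, hy⟩ := hJ c hc
    refine ⟨y, ((tendsto_add_atTop_iff_nat N).2 hy).congr fun n => ?_⟩
    refine intervalIntegral.integral_congr_ae ?_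
    filter_upwards [hae (n + N) (hN (n + N) (by omega)).1] with x hx _
    exact hx.symm
  have hlim : ∀ᵐ x, ∃ y, Tendsto (fun n =>
      (dilate (1 / ((n + N : ℕ) : ℝ)) (F (n + N)).measure).real (Ioi x)) atTop (𝓝 y) := by
    filter_upwards [ae_exists_tendsto_of_tendsto_integral (fun n => antitone_real_Ioi)
      (fun n x => measureReal_nonneg) hJ', (countable_singleton a).ae_notMem volume] with x hx hxa
    rcases lt_trichotomy a x with h | h | h
    · exact hx h
    · exact absurd h.symm hxa
    · exact ⟨1, tendsto_const_nhds.congr fun n => (real_Ioi_eq_one (hsupp n) h).symm⟩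
  obtain ⟨⟨μ, hμ, hμ'⟩, P, hP, hP'⟩ := exists_limit_of_ae_tendsto hsupp hlim
  -- The sum absorbs the finitely many degrees below `N`, which also must lie in the common
  -- interval.
  refine ⟨⟨max |a| |b| + ∑ n ∈ Finset.range N, ∑ i, |l n i|, fun n hn => ?_⟩, ⟨μ, hμ, fun g => ?_⟩,
    P, hP, ?_⟩
  · have hs0 : ∀ n, 0 ≤ ∑ i, |l n i| := fun n => Finset.sum_nonneg fun i _ => abs_nonneg _
    have key : ∀ i, |l n i| ≤ max |a| |b| + ∑ n ∈ Finset.range N, ∑ i, |l n i| := by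
      intro i
      rcases le_or_gt N n with hNn | hNn
      · have := (hN n hNn).2.2 i
        have h4 : |l n i| ≤ max |a| |b| := abs_le_max_abs_abs this.1 this.2
        have h5 : 0 ≤ ∑ n ∈ Finset.range N, ∑ i, |l n i| := Finset.sum_nonneg fun n _ => hs0 n
        linarith
      · have h4 : |l n i| ≤ ∑ i, |l n i| :=
          Finset.single_le_sum (f := fun i => |l n i|) (fun i _ => abs_nonneg _) (Finset.mem_univ i)
        have h5 : ∑ i, |l n i| ≤ ∑ n ∈ Finset.range N, ∑ i, |l n i| := Finset.single_le_sum (f := fun n => ∑ i, |l n i|) (fun n _ => hs0 n)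
          (Finset.mem_range.2 hNn)
        have h6 : 0 ≤ max |a| |b| := (abs_nonneg a).trans (le_max_left _ _)
        linarith
    refine Measure.support_subset_of_isClosed isClosed_Icc ?_
    rw [mem_ae_iff, h2 n hn]
    exact smul_sum_dirac_eq_zero _ measurableSet_Icc.compl fun i hi => hi (abs_le.1 (key i))
  · exact (tendsto_add_atTop_iff_nat N).1 (hμ' g)
  · intro u hu
    have := hP' u hu
    rwa [← map_add_atTop_eq_nat N, eventually_map]

end Limit

theorem mainTheorem1 {K : Type*} {B : Type*} [Field K] [CommRing B] [IsDomain B] [Algebra K B]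
    [Algebra.FiniteType K B] (𝒜 : ℕ → Submodule K B) [GradedAlgebra 𝒜]
    (f : ℕ → ℝ≥0) (hf : Tendsto (fun n : ℕ => (f n : ℝ) / n) atTop (𝓝 0))
    (hB : (Algebra.adjoin K (𝒜 1 : Set B) = ⊤ ∧ 0 < ringKrullDim B) ∨
      ((∀ n : ℕ, 0 < n → FiniteDimensional K (𝒜 n)) ∧ ∀ᶠ n : ℕ in atTop, 𝒜 n ≠ ⊥))
    (F : ∀ n, RFiltration K (𝒜 n))
    (hsep : ∀ n : ℕ, 0 < n → (F n).IsSeparated)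
    (hexh : ∀ n : ℕ, 0 < n → (F n).IsExhaustive)
    (hleft : ∀ n : ℕ, 0 < n → (F n).IsLeftContinuous)
    (hquasi : IsQuasiFiltered 𝒜 f F)
    (hsup : limsup (fun n : ℕ => ⨆ a : 𝒜 n, ⨆ _ : a ≠ 0, (F n).index a / (n : EReal)) atTop < ⊤) :
    (Algebra.adjoin K (𝒜 1 : Set B) = ⊤ →
      ∃ (m : ℕ → ℝ) (l : ℝ),
        (∀ n : ℕ, 0 < n → IsLeast (Set.range fun a : 𝒜 n => (F n).index a) (m n : EReal)) ∧
        Tendsto (fun n : ℕ => m n / n) atTop (𝓝 l)) ∧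
    (∃ R : ℝ, ∀ n : ℕ, 0 < n →
      (dilate (1 / (n : ℝ)) (F n).measure).support ⊆ Set.Icc (-R) R) ∧
    (∃ ν : Measure ℝ, IsProbabilityMeasure ν ∧
      ConvergesVaguely (fun n : ℕ => dilate (1 / (n : ℝ)) (F n).measure) ν) ∧
    (∃ P : ℝ → ℝ, ConcaveOn ℝ (Set.Icc 0 1) P ∧
      TendstoUniformlyOn (fun (n : ℕ) (t : ℝ) => polygon (dilate (1 / (n : ℝ)) (F n).measure) t)
        P atTop (Set.Icc 0 1) ∧
      TendstoUniformlyOn (fun (n : ℕ) (t : ℝ) => 1 / (n : ℝ) * polygon (F n).measure t)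
        P atTop (Set.Icc 0 1)) := by
  -- Case (a) is contained in case (b): positive dimension forces `𝒜 1 ≠ 0`, and powers of a nonzero
  -- element stay nonzero.
  have hB' : (∀ n : ℕ, 0 < n → FiniteDimensional K (𝒜 n)) ∧ ∀ᶠ n : ℕ in atTop, 𝒜 n ≠ ⊥ := by
    rcases hB with ⟨hgen, hdim⟩ | hB
    · exact ⟨fun n _ => finiteDimensional_of_adjoin_eq_top hgen n, Eventually.of_forall
        (ne_bot_of_one_ne_bot (one_ne_bot_of_ringKrullDim_pos hgen hdim))⟩
    · exact hB
  obtain ⟨hfin', hne⟩ := hB'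
  have hfin : ∀ n, FiniteDimensional K (𝒜 n) := fun n => by
    rcases Nat.eq_zero_or_pos n with rfl | hn
    · exact finiteDimensional_zero hfin' hne
    · exact hfin' n hn
  obtain ⟨hR, hν, P, hP, hP'⟩ :=
    exists_limit_of_quasiFiltered hfin hf hsep hexh hleft hquasi hsup hne
  refine ⟨exists_tendsto_min_div hfin hf hsep hexh hleft hquasi hsup hne, hR, hν, P, hP, hP', ?_⟩
  refine hP'.congr ?_
  filter_upwards [eventually_gt_atTop 0] with n hn t _
  have hn' : (0 : ℝ) < n := by exact_mod_cast hn
  exact polygon_dilate (one_div_pos.2 hn') _ t
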